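/- Let $\nu>-1$, $N\ge 1$, and let $\xi_N=\sum_{i=1}^N\delta_{a_i}$, $0\le a_1\le\dots\le a_N$, be a configuration of $N$ points on $[0,\infty)$ (multiple points allowed). **The process.** For $t>0$ and $y\ge0$ let $p^{(\nu)}(t,y|x)=\frac1{2t}\left(\frac yx\right)^{\nu/2}e^{-(x+y)/2t}I_\nu\!\left(\frac{\sqrt{xy}}t\right)$ for $x>0$ and $p^{(\nu)}(t,y|0)=\frac{y^\nu e^{-y/2t}}{(2t)^{\nu+1}\Gamma(\nu+1)}$ be the transition density of the squared Bessel process with index $\nu$, where $I_\nu(x)=\sum_{n\ge0}\frac{(x/2)^{2n+\nu}}{\Gamma(n+1)\Gamma(n+1+\nu)}$. Put $\mathbb W_N^+=\{0\le x_1<\dots<x_N\}$, $h_N(\mathbf x)=\prod_{i<j}(x_j-x_i)$ and $f_N(t,\mathbf y|\mathbf x)=\det_{1\le i,j\le N}[p^{(\nu)}(t,y_i|x_j)]$. The noncolliding squared Bessel process $(\Xi^{(\nu)}(t),\mathbb P_\nu^{\xi_N})$ started from $\xi_N$ is the process of $N$-point configurations on $[0,\infty)$ with $\Xi^{(\nu)}(0)=\xi_N$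 whose ordered points at times $0<t_1<\dots<t_M$ have the joint density $$p_\nu^{\xi_N}(\mathbf x^{(1)},\dots,\mathbf x^{(M)})=h_N(\mathbf x^{(M)})\prod_{m=1}^{M-1}f_N(t_{m+1}-t_m,\mathbf x^{(m+1)}|\mathbf x^{(m)})\,\frac{f_N(t_1,\mathbf x^{(1)}|\mathbf a)}{h_N(\mathbf a)}$$ on $(\mathbb W_N^+)^M$; here $f_N(t,\mathbf y|\mathbf a)/h_N(\mathbf a)$ denotes the limit of $f_N(t,\mathbf y|\mathbf x)/h_N(\mathbf x)$ as $\mathbf x\to\mathbf a$, $\mathbf x\in\mathbb W_N^+$ (which exists for $t>0$ and $y_1,\dots,y_N>0$). For $0\le N_m\le N$ its correlation functions are $$\rho(\mathbf x^{(1)}_{N_1};\dots;\mathbf x^{(M)}_{N_M})=\prod_{m}\frac1{(N-N_m)!}\int p_\nu^{\xi_N}\prod_{m}\prod_{i>N_m}dx^{(m)}_i,$$ the integral being over $[0,\infty)^{\sum_m(N-N_m)}$. **Determinantal.** The process is determinantal with correlation kernel $\mathbb K$ if $\mathbb K(s,\cdot\,;t,\cdot)$ is continuous on $(0,\infty)^2$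 for all $s,t>0$ and, for all $M\ge1$ and $0<t_1<\dots<t_M$: for all $N_m\le N$ and all positive points, $$\rho(\mathbf x^{(1)}_{N_1};\dots;\mathbf x^{(M)}_{N_M})=\det\big[\mathbb K(t_m,x^{(m)}_i;t_n,x^{(n)}_j)\big]_{1\le i\le N_m,\,1\le j\le N_n,\,1\le m,n\le M},$$ and for all continuous compactly supported $f_m$ and $\theta_m\in\mathbb R$, with $\chi_m=e^{\theta_mf_m}-1$, $$\mathbb E\Big[e^{\sum_m\theta_m\int f_m\,d\Xi^{(\nu)}(t_m)}\Big]=\sum_{N_1,\dots,N_M=0}^N\ \prod_m\frac1{N_m!}\int_{\prod_m(0,\infty)^{N_m}}\prod_{m}\prod_{i=1}^{N_m}\chi_m(x_i^{(m)})\,\det\big[\mathbb K(t_m,x^{(m)}_i;t_n,x^{(n)}_j)\big]\,\prod_m d\mathbf x^{(m)}_{N_m},$$ the right-hand side being the Fredholm determinant of $\delta_{mn}\delta(x-y)+\mathbb K(t_m,x;t_n,y)\chi_n(y)$. **Complex extension.** All complex powers are principal ($-\pi<\arg\le\pi$), and a power of a quotient, $(u/v)^{\alpha}$, is read as $u^\alpha/v^\alpha$.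 For $t\in\mathbb R\setminus\{0\}$ and $x,y\in\mathbb C$ put $$p^{(\nu)}(t,y|x)=\frac1{2|t|}\Big(\frac yx\Big)^{\nu/2}e^{-(x+y)/2t}I_\nu\Big(\frac{\sqrt{xy}}t\Big)\ (x\ne0),\qquad p^{(\nu)}(t,y|0)=\frac{y^\nu e^{-y/2t}}{(2|t|)^{\nu+1}\Gamma(\nu+1)},$$ $$p_{J_\nu}(t,y|x)=\Big(\frac xy\Big)^{\nu/2}p^{(\nu)}(t,y|x)\ (x\neq0),\qquad p_{J_\nu}(t,y|0)=y^{-\nu/2}p^{(\nu)}(t,y|0),$$ $$\Phi_0(\xi_N,w,z)=\prod_{i:\,a_i\ne w}\Big(1-\frac{z-w}{a_i-w}\Big),\qquad \Phi^{(\nu)}(\xi_N,w,z)=\begin{cases}(z/w)^{\nu/2}\,\Phi_0(\xi_N,w,z),&w\ne0,\\ z^{\nu/2}\,\Phi_0(\xi_N,0,z),&w=0.\end{cases}$$ **Theorem.** (i) The process $(\Xi^{(\nu)}(t),\mathbb P_\nu^{\xi_N})$ is determinantal with the correlation kernel $$\mathbb K_\nu^{\xi_N}(s,x;t,y)=\lim_{\varepsilon\downarrow0}\frac1{2\pi\sqrt{-1}}\int_{-\infty}^{-\varepsilon}dy'\oint_{\Gamma_{y'}(\xi_N)}dz\;p^{(\nu)}(s,x|z)\frac1{y'-z}\Phi_0(\xi_N,z,y')\,p^{(\nu)}(-t,y'|y)-\mathbf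 1(s>t)\,p^{(\nu)}(s-t,x|y)$$ for $s,t>0$ and $x,y>0$, where $\Gamma_{y'}(\xi_N)$ is any closed contour that winds once counterclockwise around each point of $\operatorname{supp}\xi_N$ and does not encircle $y'$; such contours exist for all $y'<0$, and the limit exists. (ii) If $a_1<\dots<a_N$, then for $s,t,x,y>0$ $$\mathbb K_\nu^{\xi_N}(s,x;t,y)=\sum_{i=1}^N\int_{-\infty}^0dy'\,p^{(\nu)}(s,x|a_i)\,\Phi_0(\xi_N,a_i,y')\,p^{(\nu)}(-t,y'|y)-\mathbf 1(s>t)\,p^{(\nu)}(s-t,x|y),$$ and the process is also determinantal with the kernel $$\mathbb K_{J_\nu}^{\xi_N}(s,x;t,y)=\sum_{i=1}^N\int_{-\infty}^0dy'\,p_{J_\nu}(s,x|a_i)\,\Phi^{(\nu)}(\xi_N,a_i,y')\,p_{J_\nu}(-t,y'|y)-\mathbf 1(s>t)\,p_{J_\nu}(s-t,x|y),$$ which satisfies $\mathbb K_\nu^{\xi_N}(s,x;t,y)=(x/y)^{\nu/2}\,\mathbb K_{J_\nu}^{\xi_N}(s,x;t,y)$. -/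

import Mathlib

open Set Filter Topology MeasureTheory
open scoped Nat

noncomputable section

namespace NoncollidingBESQ

/-! ## Squared Bessel transition density and the law of the noncolliding system

A finite configuration `ξ_N = ∑ δ_{a i}` on `[0, ∞)` is given by its nondecreasing labelling
`a : Fin N → ℝ`, `0 ≤ a 0 ≤ a 1 ≤ ⋯`. -/

/-- The modified Bessel function `I_ν` on the half line. -/
def besselI (ν x : ℝ) : ℝ :=
  ∑' n : ℕ, 1 / (Real.Gamma (n + 1) * Real.Gamma (n + 1 + ν)) * (x / 2) ^ (2 * (n : ℝ) + ν)

/-- The transition density `p^{(ν)}(t, y | x)` of BESQ`^{(ν)}` for `t > 0`, `x, y ≥ 0`. -/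
def besq (ν t y x : ℝ) : ℝ :=
  if x = 0 then
    y ^ ν / ((2 * t) ^ (ν + 1) * Real.Gamma (ν + 1)) * Real.exp (-y / (2 * t))
  else
    1 / (2 * t) * (y / x) ^ (ν / 2) * Real.exp (-(x + y) / (2 * t)) *
      besselI ν (Real.sqrt (x * y) / t)

/-- The Weyl chamber `0 ≤ x_1 < x_2 < ⋯ < x_N`. -/
def weylChamber (N : ℕ) : Set (Fin N → ℝ) := {x | (∀ i, 0 ≤ x i) ∧ StrictMono x}

/-- The Vandermonde determinant `h_N`. -/
def vand {N : ℕ} (x : Fin N → ℝ) : ℝ := (Matrix.vandermonde x).det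

/-- The Karlin–McGregor determinant `f_N^{(ν)}(t, y | x) = det [p^{(ν)}(t, y_i | x_j)]`. -/
def karlinMcGregor {N : ℕ} (ν t : ℝ) (y x : Fin N → ℝ) : ℝ :=
  (Matrix.of fun i j => besq ν t (y i) (x j)).det

/-- The factor `f_N^{(ν)}(t, y | a) / h_N(a)`, continued to configurations with multiple points by
the limit `x → a` inside the Weyl chamber. -/
def kmRatio {N : ℕ} (ν t : ℝ) (y a : Fin N → ℝ) : ℝ :=
  limUnder (𝓝[weylChamber N] a) fun x => karlinMcGregor ν t y x / vand x

/-- The multitime probability density of the noncolliding BESQ`^{(ν)}` started from `∑ δ_{a i}`,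
at the `M + 1` times `t 0 < ⋯ < t M` and the labelled configurations `X 0, …, X M`. -/
def multitimeDensity {N M : ℕ} (ν : ℝ) (a : Fin N → ℝ) (t : Fin (M + 1) → ℝ)
    (X : Fin (M + 1) → Fin N → ℝ) : ℝ :=
  vand (X (Fin.last M)) *
    (∏ m : Fin M, karlinMcGregor ν (t m.succ - t m.castSucc) (X m.succ) (X m.castSucc)) *
    kmRatio ν (t 0) (X 0) a

/-- The unlabelled configuration `∑ δ_{x i}`. -/
def config {N : ℕ} (x : Fin N → ℝ) : Measure ℝ := ∑ i, Measure.dirac (x i)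

/-- `(Ξ(t), P)` is a noncolliding BESQ`^{(ν)}` started from `∑ δ_{a i}`: a process of point
configurations (random measures) with the prescribed initial value and finite dimensional
distributions. Only times `t ≥ 0` are relevant. -/
structure IsNoncollidingBESQ {N : ℕ} (ν : ℝ) (a : Fin N → ℝ) {Ω : Type*} [MeasurableSpace Ω]
    (P : Measure Ω) (Ξ : ℝ → Ω → Measure ℝ) : Prop where
  measurable : ∀ t, 0 ≤ t → Measurable (Ξ t)
  initial : ∀ᵐ ω ∂P, Ξ 0 ω = config a
  fdd : ∀ (M : ℕ) (t : Fin (M + 1) → ℝ), (∀ m, 0 < t m) → StrictMono t →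
    P.map (fun ω m => Ξ (t m) ω) =
      Measure.map (fun (X : Fin (M + 1) → Fin N → ℝ) m => config (X m))
        ((volume.restrict {X : Fin (M + 1) → Fin N → ℝ | ∀ m, X m ∈ weylChamber N}).withDensity
          fun X => ENNReal.ofReal (multitimeDensity ν a t X))

/-! ## Correlation functions, generating function, Fredholm determinant -/

/-- For each time `m`, the first `n m` particles are placed at `X ⟨m, ·⟩` and the others at
`Y m`. -/
def combine {N M : ℕ} (n : Fin (M + 1) → ℕ) (X : (Σ m, Fin (n m)) → ℝ)
    (Y : (m : Fin (M + 1)) → Fin (N - n m) → ℝ) (m : Fin (M + 1)) (i : Fin N) : ℝ :=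
  if h : (i : ℕ) < n m then X ⟨m, ⟨i, h⟩⟩ else Y m ⟨i - n m, by omega⟩

/-- The set over which the unobserved particles are integrated. -/
def unobserved {M : ℕ} (N : ℕ) (n : Fin (M + 1) → ℕ) :
    Set ((m : Fin (M + 1)) → Fin (N - n m) → ℝ) := {Y | ∀ m i, 0 < Y m i}

/-- The `(n 0, …, n M)`-multitime correlation function. -/
def correlation {N M : ℕ} (ν : ℝ) (a : Fin N → ℝ) (t : Fin (M + 1) → ℝ)
    (n : Fin (M + 1) → ℕ) (X : (Σ m, Fin (n m)) → ℝ) : ℝ :=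
  (∏ m, ((N - n m)! : ℝ)⁻¹) *
    ∫ Y in unobserved N n, multitimeDensity ν a t (combine n X Y)

/-- The Laplace transform of the multitime density. -/
def generatingFunction {N M : ℕ} (ν : ℝ) (a : Fin N → ℝ) (t : Fin (M + 1) → ℝ)
    (θ : Fin (M + 1) → ℝ) (f : Fin (M + 1) → ℝ → ℝ) : ℝ :=
  ∫ X in {X : Fin (M + 1) → Fin N → ℝ | ∀ m, X m ∈ weylChamber N},
    multitimeDensity ν a t X * Real.exp (∑ m, θ m * ∑ i, f m (X m i))

/-- `det [K(t_m, x_i^{(m)}; t_n, x_j^{(n)})]` over all pairs of observed particles. -/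
def kernelDet {M : ℕ} (K : ℝ → ℝ → ℝ → ℝ → ℂ) (t : Fin (M + 1) → ℝ) (n : Fin (M + 1) → ℕ)
    (X : (Σ m, Fin (n m)) → ℝ) : ℂ :=
  (Matrix.of fun p q : (Σ m, Fin (n m)) => K (t p.1) (X p) (t q.1) (X q)).det

/-- The Fredholm determinant `Det [δ_{mn} δ(x - y) + K(t_m, x; t_n, y) χ_n(y)]`, for a system of
`N` particles. -/
def fredholmDet {M : ℕ} (N : ℕ) (K : ℝ → ℝ → ℝ → ℝ → ℂ) (t : Fin (M + 1) → ℝ)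
    (χ : Fin (M + 1) → ℝ → ℝ) : ℂ :=
  ∑ n ∈ Fintype.piFinset (fun _ : Fin (M + 1) => Finset.range (N + 1)),
    (∏ m, ((n m)! : ℂ)⁻¹) *
      ∫ X in {X : (Σ m, Fin (n m)) → ℝ | ∀ p, 0 < X p},
        (∏ p, (χ p.1 (X p) : ℂ)) * kernelDet K t n X

/-- The noncolliding BESQ`^{(ν)}` started from `∑ δ_{a i}` is determinantal with the correlation
kernel `K(s, x; t, y)`. -/
structure IsDeterminantalWith.{u} {N : ℕ} (ν : ℝ) (a : Fin N → ℝ)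
    (K : ℝ → ℝ → ℝ → ℝ → ℂ) : Prop where
  continuousOn : ∀ s t, 0 < s → 0 < t →
    ContinuousOn (fun p : ℝ × ℝ => K s p.1 t p.2) (Ioi 0 ×ˢ Ioi 0)
  correlation_eq : ∀ (M : ℕ) (t : Fin (M + 1) → ℝ), (∀ m, 0 < t m) → StrictMono t →
    ∀ n : Fin (M + 1) → ℕ, (∀ m, n m ≤ N) →
    ∀ X : (Σ m, Fin (n m)) → ℝ, (∀ p, 0 < X p) →
      IntegrableOn (fun Y => multitimeDensity ν a t (combine n X Y)) (unobserved N n) ∧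
      (correlation ν a t n X : ℂ) = kernelDet K t n X
  generating_eq : ∀ (M : ℕ) (t : Fin (M + 1) → ℝ), (∀ m, 0 < t m) → StrictMono t →
    ∀ (θ : Fin (M + 1) → ℝ) (f : Fin (M + 1) → ℝ → ℝ),
      (∀ m, Continuous (f m)) → (∀ m, HasCompactSupport (f m)) →
      (generatingFunction ν a t θ f : ℂ) =
        fredholmDet N K t fun m x => Real.exp (θ m * f m x) - 1
  expectation_eq : ∀ (Ω : Type u) [MeasurableSpace Ω] (P : Measure Ω) [IsProbabilityMeasure P]
    (Ξ : ℝ → Ω → Measure ℝ), IsNoncollidingBESQ ν a P Ξ →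
    ∀ (M : ℕ) (t : Fin (M + 1) → ℝ), (∀ m, 0 < t m) → StrictMono t →
    ∀ (θ : Fin (M + 1) → ℝ) (f : Fin (M + 1) → ℝ → ℝ),
      (∀ m, Continuous (f m)) → (∀ m, HasCompactSupport (f m)) →
      ((∫ ω, Real.exp (∑ m, θ m * ∫ x, f m x ∂(Ξ (t m) ω)) ∂P : ℝ) : ℂ) =
        fredholmDet N K t fun m x => Real.exp (θ m * f m x) - 1

/-! ## Complex extensions -/

/-- `(a / b)^α`, understood as the quotient `a^α / b^α` of principal powers. This is the reading
that makes `p^{(ν)}(t, x | ·)` an entire function, and `(a / b)^α (b / a)^α = 1`, also on the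
negative axis. -/
def quotPow (a b α : ℂ) : ℂ := a ^ α / b ^ α

/-- The modified Bessel function on `ℂ`, with principal powers (`-π < arg z ≤ π`). -/
def besselIC (ν : ℝ) (z : ℂ) : ℂ :=
  ∑' n : ℕ, 1 / (Complex.Gamma (n + 1) * Complex.Gamma (n + 1 + ν)) *
    (z / 2) ^ (2 * (n : ℂ) + ν)

/-- `p^{(ν)}(t, y | x)` for real `t ≠ 0` and complex `x, y`. At `t = 0` it is a delta function and
is not used. -/
def besqC (ν t : ℝ) (y x : ℂ) : ℂ :=
  if x = 0 then
    y ^ (ν : ℂ) / ((((2 * |t|) ^ (ν + 1) * Real.Gamma (ν + 1) : ℝ)) : ℂ) *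
      Complex.exp (-y / (2 * t))
  else
    1 / (2 * (|t| : ℝ)) * quotPow y x (ν / 2) * Complex.exp (-(x + y) / (2 * t)) *
      besselIC ν ((x * y) ^ (1 / 2 : ℂ) / t)

/-- `p_{J_ν}(t, y | x)`. -/
def besqJ (ν t : ℝ) (y x : ℂ) : ℂ :=
  if x = 0 then y ^ (-(ν : ℂ) / 2) * besqC ν t y 0
  else quotPow x y (ν / 2) * besqC ν t y x

/-- `Π_0(ξ, z)`, the product over the nonzero points of the configuration. -/
def Pi0 {N : ℕ} (a : Fin N → ℂ) (z : ℂ) : ℂ :=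
  ∏ i with a i ≠ 0, (1 - z / a i)

/-- `Π^{(ν)}(ξ, z)`. -/
def PiNu {N : ℕ} (ν : ℝ) (a : Fin N → ℂ) (z : ℂ) : ℂ := z ^ ((ν : ℂ) / 2) * Pi0 a z

/-- `Φ_0(ξ, w, z) = Π_0(τ_{-w} ξ, z - w)`. -/
def Phi0 {N : ℕ} (a : Fin N → ℂ) (w z : ℂ) : ℂ := Pi0 (fun i => a i - w) (z - w)

/-- `Φ^{(ν)}(ξ, w, z)`. -/
def PhiNu {N : ℕ} (ν : ℝ) (a : Fin N → ℂ) (w z : ℂ) : ℂ :=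
  if w = 0 then PiNu ν a z else quotPow z w (ν / 2) * Phi0 a w z

/-! ## Contours -/

/-- `∮_γ g(z) dz` along a curve parametrized by `[0, 2π]`. -/
def contourIntegral (γ : ℝ → ℂ) (g : ℂ → ℂ) : ℂ :=
  ∫ u in (0 : ℝ)..2 * Real.pi, deriv γ u * g (γ u)

/-- The winding number of `γ` about `w`. -/
def windingNumber (γ : ℝ → ℂ) (w : ℂ) : ℂ :=
  (2 * Real.pi * Complex.I)⁻¹ * contourIntegral γ fun z => (z - w)⁻¹

/-- `γ` is a closed piecewise continuously differentiable curve. -/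
structure IsClosedCurve (γ : ℝ → ℂ) : Prop where
  continuousOn : ContinuousOn γ (Icc 0 (2 * Real.pi))
  closed : γ 0 = γ (2 * Real.pi)
  piecewise : ∃ S : Finset ℝ, ∀ u ∈ Ioo 0 (2 * Real.pi), u ∉ S →
    DifferentiableAt ℝ γ u ∧ ContinuousAt (deriv γ) u
  integrable : IntervalIntegrable (deriv γ) volume 0 (2 * Real.pi)

/-- `γ` is a contour that encircles each point of the configuration `a` once counterclockwise, but
does not encircle the point `y'`. -/
structure Encircles {N : ℕ} (γ : ℝ → ℂ) (a : Fin N → ℝ) (y' : ℝ) : Prop where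
  curve : IsClosedCurve γ
  avoids_points : ∀ u ∈ Icc 0 (2 * Real.pi), ∀ i, γ u ≠ a i
  avoids_outer : ∀ u ∈ Icc 0 (2 * Real.pi), γ u ≠ y'
  winding_points : ∀ i, windingNumber γ (a i) = 1
  winding_outer : windingNumber γ y' = 0

/-! ## The correlation kernels -/

/-- The contour integral under the `y'`-integral, including the factor `1 / (2πi)`. -/
def contourIntegrand {N : ℕ} (ν : ℝ) (a : Fin N → ℝ) (Γ : ℝ → ℝ → ℂ) (s x t y y' : ℝ) : ℂ :=
  1 / (2 * Real.pi * Complex.I) * contourIntegral (Γ y') fun z =>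
    besqC ν s x z * (1 / (y' - z)) * Phi0 (fun i => (a i : ℂ)) z y' * besqC ν (-t) y' y

/-- The contour kernel, for a choice of contours `Γ y'`, `y' < 0`. -/
def contourKernel {N : ℕ} (ν : ℝ) (a : Fin N → ℝ) (Γ : ℝ → ℝ → ℂ) (s x t y : ℝ) : ℂ :=
  limUnder (𝓝[>] (0 : ℝ)) (fun ε => ∫ y' in Iic (-ε), contourIntegrand ν a Γ s x t y y') -
    if t < s then besqC ν (s - t) x y else 0

/-- The integrand of the sum–integral kernel at the point `a i`. -/
def simpleIntegrand {N : ℕ} (ν : ℝ) (a : Fin N → ℝ) (s x t y : ℝ) (i : Fin N) (y' : ℝ) : ℂ :=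
  besqC ν s x (a i) * Phi0 (fun j => (a j : ℂ)) (a i) y' * besqC ν (-t) y' y

/-- The sum–integral kernel. -/
def simpleKernel {N : ℕ} (ν : ℝ) (a : Fin N → ℝ) (s x t y : ℝ) : ℂ :=
  (∑ i, ∫ y' in Iio (0 : ℝ), simpleIntegrand ν a s x t y i y') -
    if t < s then besqC ν (s - t) x y else 0

/-- The integrand of the kernel built from `p_{J_ν}` and `Φ^{(ν)}` at the point `a i`. -/
def besselIntegrand {N : ℕ} (ν : ℝ) (a : Fin N → ℝ) (s x t y : ℝ) (i : Fin N) (y' : ℝ) : ℂ :=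
  besqJ ν s x (a i) * PhiNu ν (fun j => (a j : ℂ)) (a i) y' * besqJ ν (-t) y' y

/-- The kernel built from `p_{J_ν}` and `Φ^{(ν)}`. -/
def besselKernel {N : ℕ} (ν : ℝ) (a : Fin N → ℝ) (s x t y : ℝ) : ℂ :=
  (∑ i, ∫ y' in Iio (0 : ℝ), besselIntegrand ν a s x t y i y') -
    if t < s then besqJ ν (s - t) x y else 0

end NoncollidingBESQ

end

universe u

open NoncollidingBESQ

open Set Filter Topology MeasureTheory
open scoped Nat

noncomputable section

namespace NoncollidingBESQ

/-! ## The entire function behind the Bessel functions -/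

/-! The process is determinantal because its multitime density is itself a determinant, over all
particles at all times, of a kernel that reproduces under composition.

As a function of its starting point the transition density is entire (`besqEntire`), so it can be
expanded by Newton interpolation at the points of the configuration, coincident points included. The
matrix `p(t, y_i | a_j)` factors into the divided differences `besqDivDiff` and the values of the
Newton polynomials at the points; the determinant of the latter is `h_N(a)`. Thus the Vandermonde
factor cancels algebraically, and `f_N / h_N` becomes a determinant of divided differences,
continuous in `a` even where points merge.

On polynomials the squared Bessel semigroup is unipotent triangular with entries polynomial in time
(`besqPoly`), so it can be run backwards. The Newton polynomials run back by time `t` (`besqNewton`)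
stay monic, hence their determinant at the last time is again a Vandermonde determinant; and they
are biorthogonal to the divided differences at time `t`, since integration undoes the backward
evolution and divided differences are dual to Newton polynomials. The density is therefore a chain
of determinants with biorthogonal ends (the Eynard–Mehta situation), and a Schur complement
(`det_chain`) turns it into one determinant of `coreKernel`, that is of `∑ₖ φₖ(s, x) ψₖ(t, y) - 1(s
> t) p(s - t, x | y)`.

Biorthogonality and Chapman–Kolmogorov give `integral_coreKernel_mul_coreKernel` and the trace `N`.
With a domination bound these are all that is needed (`IsExtendedKernel`) to integrate particles out
one at a time, which yields the correlation functions; expanding `∏ (1 + χ)` over subsets of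
particles then yields the Fredholm determinant.

The stated kernels are `coreKernel` in disguise. The density at time `-t` and endpoint `y' < 0` is
the continuation of `p(t, -y' | ·)` to `-y`; reflection exchanges the semigroup at times `t` and
`-t`, so integrating a polynomial in `y'` against it runs the semigroup backwards. The contour
integral is Hermite's formula for the polynomial interpolating `p(s, x | ·)` at the configuration:
its Newton form gives `coreKernel` and, for distinct points, its Lagrange form gives the sum over
`i`. The version with `p_{J_ν}` is a conjugation by `x ^ (ν / 2)`, invisible to determinants. -/

/-- The coefficients `1 / (n! Γ(n + 1 + ν))`. -/
def besselCoeff (ν : ℝ) (n : ℕ) : ℝ := 1 / (n ! * Real.Gamma (n + 1 + ν))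

/-- The entire function `∑ wⁿ / (n! Γ(n + 1 + ν))`. -/
def besselE (ν : ℝ) (w : ℂ) : ℂ := ∑' n : ℕ, (besselCoeff ν n : ℂ) * w ^ n

/-- The transition density `p^{(ν)}(t, y | z)`, `t, y > 0`, as an entire function of `z`. -/
def besqEntire (ν t y : ℝ) (z : ℂ) : ℂ :=
  ((y ^ ν * (2 * t) ^ (-(ν + 1)) : ℝ) : ℂ) * Complex.exp (-(y + z) / (2 * t)) *
    besselE ν (y * z / (4 * t ^ 2))

lemma gamma_pos_of_index {ν : ℝ} (hν : -1 < ν) (n : ℕ) : 0 < Real.Gamma (n + 1 + ν) :=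
  Real.Gamma_pos_of_pos (by have : (0 : ℝ) ≤ n := n.cast_nonneg; linarith)

lemma besselCoeff_pos {ν : ℝ} (hν : -1 < ν) (n : ℕ) : 0 < besselCoeff ν n := by
  have := gamma_pos_of_index hν n
  unfold besselCoeff
  positivity

/-- Geometric comparison of `n!` with `Γ(n + 1 + ν)`. -/
lemma exists_inv_gamma_le {ν : ℝ} (hν : -1 < ν) {κ : ℝ} (hκ : 1 < κ) :
    ∃ C > 0, ∀ n : ℕ, 1 / Real.Gamma (n + 1 + ν) ≤ C * (κ ^ n / n !) := by
  have hκ0 : 0 < κ := by linarith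
  -- The ratio of consecutive terms tends to `1 / κ < 1`; the terms are then summable, and in
  -- particular bounded, which is all that is used.
  have hs : Summable fun n : ℕ => (n ! : ℝ) / (κ ^ n * Real.Gamma (n + 1 + ν)) := by
    refine summable_of_ratio_test_tendsto_lt_one (l := 1 / κ) ?_ ?_ ?_
    · rw [div_lt_one hκ0]; exact hκ
    · refine Eventually.of_forall fun n => ?_
      have := gamma_pos_of_index hν n
      positivity
    · have h1 : ∀ n : ℕ, ‖((n + 1)! : ℝ) / (κ ^ (n + 1) * Real.Gamma ((n + 1 : ℕ) + 1 + ν))‖ /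
          ‖(n ! : ℝ) / (κ ^ n * Real.Gamma (n + 1 + ν))‖ = 1 / κ * (1 - ν / (n + 1 + ν)) := by
        intro n
        have hg := gamma_pos_of_index hν n
        have hn : (0 : ℝ) ≤ n := n.cast_nonneg
        have hn1 : (0 : ℝ) < n + 1 + ν := by linarith
        have hG : Real.Gamma ((n + 1 : ℕ) + 1 + ν) = (n + 1 + ν) * Real.Gamma (n + 1 + ν) := by
          rw [← Real.Gamma_add_one hn1.ne']
          push_cast
          congr 1
          ring
        rw [hG, Real.norm_of_nonneg (by positivity), Real.norm_of_nonneg (by positivity),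
          Nat.factorial_succ]
        push_cast
        field_simp
        ring
      simp_rw [h1]
      have h2 : Tendsto (fun n : ℕ => (n : ℝ) + 1 + ν) atTop atTop :=
        tendsto_atTop_add_const_right _ _
          (tendsto_atTop_add_const_right _ _ tendsto_natCast_atTop_atTop)
      simpa using ((tendsto_const_nhds (x := ν)).div_atTop h2).const_sub 1 |>.const_mul (1 / κ)
  obtain ⟨C, hC⟩ := hs.tendsto_atTop_zero.bddAbove_range
  refine ⟨max C 1, by positivity, fun n => ?_⟩
  have hg := gamma_pos_of_index hν n
  have h := (hC ⟨n, rfl⟩).trans (le_max_left C 1)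
  rw [div_le_iff₀ (by positivity)] at h
  rw [div_le_iff₀ hg, mul_assoc, div_mul_eq_mul_div, mul_div_assoc', le_div_iff₀ (by positivity)]
  linarith

lemma summable_besselCoeff {ν : ℝ} (hν : -1 < ν) (r : ℝ) :
    Summable fun n : ℕ => besselCoeff ν n * |r| ^ n := by
  obtain ⟨C, hC0, hC⟩ := exists_inv_gamma_le hν (one_lt_two)
  refine Summable.of_nonneg_of_le (fun n => ?_) (fun n => ?_)
    ((Real.summable_pow_div_factorial (2 * |r|)).mul_left C)
  · have := besselCoeff_pos hν n
    positivity
  · have h := hC n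
    have h1 : (1 : ℝ) ≤ n ! := by exact_mod_cast n.factorial_pos
    have hg := gamma_pos_of_index hν n
    have h2 : besselCoeff ν n ≤ 1 / Real.Gamma (n + 1 + ν) := by
      unfold besselCoeff
      exact one_div_le_one_div_of_le hg (le_mul_of_one_le_left hg.le h1)
    calc besselCoeff ν n * |r| ^ n ≤ C * (2 ^ n / n !) * |r| ^ n := by
          gcongr
          exact h2.trans h
      _ = C * ((2 * |r|) ^ n / n !) := by rw [mul_pow]; ring

lemma norm_besselCoeff_mul {ν : ℝ} (hν : -1 < ν) (w : ℂ) (n : ℕ) :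
    ‖(besselCoeff ν n : ℂ) * w ^ n‖ = besselCoeff ν n * ‖w‖ ^ n := by
  rw [norm_mul, norm_pow, Complex.norm_of_nonneg (besselCoeff_pos hν n).le]

lemma summable_norm_besselE {ν : ℝ} (hν : -1 < ν) (w : ℂ) :
    Summable fun n : ℕ => ‖(besselCoeff ν n : ℂ) * w ^ n‖ := by
  simp_rw [norm_besselCoeff_mul hν]
  simpa using summable_besselCoeff hν ‖w‖

lemma hasSum_besselE {ν : ℝ} (hν : -1 < ν) (w : ℂ) :
    HasSum (fun n : ℕ => (besselCoeff ν n : ℂ) * w ^ n) (besselE ν w) :=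
  (summable_norm_besselE hν w).of_norm.hasSum

lemma differentiable_besselE {ν : ℝ} (hν : -1 < ν) : Differentiable ℂ (besselE ν) := by
  intro w
  have h : DifferentiableOn ℂ (besselE ν) (Metric.ball 0 (‖w‖ + 1)) := by
    refine Complex.differentiableOn_tsum_of_summable_norm
      (u := fun n => besselCoeff ν n * |‖w‖ + 1| ^ n) (summable_besselCoeff hν _)
      (fun n => by fun_prop) Metric.isOpen_ball fun n z hz => ?_
    rw [norm_besselCoeff_mul hν]
    have hz' : ‖z‖ ≤ |‖w‖ + 1| := (mem_ball_zero_iff.1 hz).le.trans (le_abs_self _)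
    have := besselCoeff_pos hν n
    gcongr
  exact h.differentiableAt (Metric.isOpen_ball.mem_nhds (by simp))

lemma continuous_besselE {ν : ℝ} (hν : -1 < ν) : Continuous (besselE ν) :=
  (differentiable_besselE hν).continuous

/-- A two-parameter exponential bound for `besselE`. -/
lemma exists_norm_besselE_le {ν : ℝ} (hν : -1 < ν) {κ : ℝ} (hκ : 1 < κ) :
    ∃ C > 0, ∀ (A B : ℝ) (w : ℂ), 0 ≤ A → 0 ≤ B → ‖w‖ ≤ A * B →
      ‖besselE ν w‖ ≤ C * Real.exp (A + κ * B) := by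
  obtain ⟨C, hC0, hC⟩ := exists_inv_gamma_le hν hκ
  refine ⟨C, hC0, fun A B w hA hB hw => ?_⟩
  have hκ0 : 0 < κ := by linarith
  have hexp : HasSum (fun n : ℕ => C * Real.exp (κ * B) * (A ^ n / n !))
      (C * Real.exp (κ * B) * Real.exp A) := by
    refine HasSum.mul_left _ ?_
    rw [Real.exp_eq_exp_ℝ]
    exact NormedSpace.expSeries_div_hasSum_exp A
  -- One factorial is spent on `(κ B)ⁿ / n! ≤ exp (κ B)`, the other on the exponential series of
  -- `A`. The freedom in splitting `‖w‖ ≤ A * B` later decides which variable pays for the growth.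
  have hle : ∀ n : ℕ, ‖(besselCoeff ν n : ℂ) * w ^ n‖ ≤ C * Real.exp (κ * B) * (A ^ n / n !) := by
    intro n
    rw [norm_besselCoeff_mul hν]
    have hg := gamma_pos_of_index hν n
    have h1 : (κ * B) ^ n / n ! ≤ Real.exp (κ * B) :=
      Real.pow_div_factorial_le_exp _ (by positivity) n
    calc besselCoeff ν n * ‖w‖ ^ n ≤ besselCoeff ν n * (A * B) ^ n := by
          have := besselCoeff_pos hν n
          gcongr
      _ = (1 / Real.Gamma (n + 1 + ν)) * B ^ n * (A ^ n / n !) := by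
          unfold besselCoeff
          rw [mul_pow]
          field_simp
      _ ≤ (C * (κ ^ n / n !)) * B ^ n * (A ^ n / n !) := by
          gcongr
          exact hC n
      _ = C * ((κ * B) ^ n / n !) * (A ^ n / n !) := by rw [mul_pow]; ring
      _ ≤ C * Real.exp (κ * B) * (A ^ n / n !) := by gcongr
  have h := tsum_of_norm_bounded hexp hle
  refine h.trans (le_of_eq ?_)
  rw [Real.exp_add]
  ring

lemma differentiable_besqEntire {ν : ℝ} (hν : -1 < ν) (t y : ℝ) :
    Differentiable ℂ (besqEntire ν t y) := by
  have h := differentiable_besselE hν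
  unfold besqEntire
  fun_prop

/-! ## Identification of the transition densities -/

/-- A power whose base is given with a logarithm in the principal strip. -/
lemma exp_cpow {L : ℂ} (h1 : -Real.pi < L.im) (h2 : L.im ≤ Real.pi) (c : ℂ) :
    Complex.exp L ^ c = Complex.exp (L * c) := by
  rw [Complex.cpow_def_of_ne_zero (Complex.exp_ne_zero _), Complex.log_exp h1 h2]

/-- Once the argument is given by a logarithm in the principal strip, every principal power is an
exponential linear in `L`, and branch questions reduce to adding exponents. -/
lemma besselIC_two_mul_exp {ν : ℝ} {L : ℂ} (h1 : -Real.pi < L.im)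
    (h2 : L.im ≤ Real.pi) :
    besselIC ν (2 * Complex.exp L) = Complex.exp (L * ν) * besselE ν (Complex.exp (2 * L)) := by
  unfold besselIC besselE
  rw [← tsum_mul_left]
  refine tsum_congr fun n => ?_
  rw [mul_div_cancel_left₀ _ (two_ne_zero' ℂ), exp_cpow h1 h2, mul_add, Complex.exp_add,
    ← Complex.exp_nat_mul, besselCoeff, Complex.Gamma_nat_eq_factorial]
  have h3 : Complex.Gamma ((n : ℂ) + 1 + ν) = (Real.Gamma (n + 1 + ν) : ℝ) := by
    rw [← Complex.Gamma_ofReal]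
    push_cast
    rfl
  rw [h3]
  push_cast
  rw [show L * (2 * (n : ℂ)) = n * (2 * L) by ring]
  ring

lemma besselE_zero {ν : ℝ} : besselE ν 0 = ((Real.Gamma (ν + 1))⁻¹ : ℝ) := by
  unfold besselE
  rw [tsum_eq_single 0 (fun n hn => by simp [hn])]
  simp [besselCoeff, add_comm]

lemma ofReal_exp_log {x : ℝ} (hx : 0 < x) : Complex.exp (Real.log x : ℂ) = x := by
  rw [← Complex.ofReal_exp, Real.exp_log hx]

lemma ofReal_rpow_eq_exp {x : ℝ} (hx : 0 < x) (r : ℝ) :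
    ((x ^ r : ℝ) : ℂ) = Complex.exp (Real.log x * r) := by
  rw [Real.rpow_def_of_pos hx]
  push_cast
  rfl

/-- For positive `t` and `y`, the complex transition density is `besqEntire`. -/
lemma besqC_eq_besqEntire {ν t y : ℝ} (ht : 0 < t) (hy : 0 < y) (z : ℂ) :
    besqC ν t y z = besqEntire ν t y z := by
  unfold besqC besqEntire
  split_ifs with hz
  · subst hz
    rw [mul_zero, zero_div, besselE_zero, abs_of_pos ht, add_zero,
      Real.rpow_neg (by positivity), ← Complex.ofReal_cpow hy.le]
    push_cast
    rw [div_eq_mul_inv, mul_inv]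
    ring
  · have h2t : 0 < 2 * t := by positivity
    -- `L` is the logarithm of `√(z y) / (2 t)`. Its imaginary part is half of `arg z`, so it lies
    -- in the principal strip.
    set L : ℂ := (Complex.log z + Real.log y) / 2 - Real.log (2 * t) with hL
    have him : L.im = z.arg / 2 := by
      have : L = (Complex.log z + Real.log y) * ((1 / 2 : ℝ) : ℂ) + ((-Real.log (2 * t) : ℝ) : ℂ) := by
        rw [hL]; push_cast; ring
      rw [this, Complex.add_im, Complex.im_mul_ofReal, Complex.add_im, Complex.ofReal_im,
        Complex.ofReal_im, Complex.log_im]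
      ring
    have hlog : Complex.log (z * y) = Real.log y + Complex.log z :=
      Complex.log_mul_ofReal y hy z hz
    have hy0 : (y : ℂ) ≠ 0 := by exact_mod_cast hy.ne'
    have hsqrt : (z * y) ^ (1 / 2 : ℂ) / t = 2 * Complex.exp L := by
      rw [Complex.cpow_def_of_ne_zero (mul_ne_zero hz hy0), hlog, hL, Complex.exp_sub,
        ofReal_exp_log h2t]
      have : (t : ℂ) ≠ 0 := by exact_mod_cast ht.ne'
      push_cast
      field_simp
      ring_nf
    have hpi := Real.pi_pos
    have ha1 := Complex.neg_pi_lt_arg z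
    have ha2 := Complex.arg_le_pi z
    rw [hsqrt, besselIC_two_mul_exp (by rw [him]; linarith) (by rw [him]; linarith),
      abs_of_pos ht, quotPow, Complex.cpow_def_of_ne_zero hy0, Complex.cpow_def_of_ne_zero hz,
      ← Complex.ofReal_log hy.le]
    have hE : Complex.exp (2 * L) = y * z / (4 * t ^ 2) := by
      rw [hL, mul_sub, Complex.exp_sub, show (2 : ℂ) * ((Complex.log z + Real.log y) / 2) =
        Complex.log z + Real.log y by ring, Complex.exp_add, Complex.exp_log hz, ofReal_exp_log hy,
        two_mul, Complex.exp_add, ofReal_exp_log h2t]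
      push_cast
      ring
    rw [hE, Complex.ofReal_mul, ofReal_rpow_eq_exp hy, ofReal_rpow_eq_exp h2t]
    have h2 : (1 : ℂ) / (2 * (t : ℝ)) = Complex.exp (-Real.log (2 * t)) := by
      rw [Complex.exp_neg, ofReal_exp_log h2t]
      push_cast
      rw [one_div]
    rw [h2, add_comm z (y : ℂ)]
    -- The branch of `z ^ (ν / 2)` in the denominator cancels the branch in `I_ν`, leaving no power
    -- of `z`; this is why the density is entire.
    have key : Complex.exp (-(Real.log (2 * t))) *
        (Complex.exp (Real.log y * (ν / 2)) / Complex.exp (Complex.log z * (ν / 2))) *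
        Complex.exp (L * ν) = Complex.exp (Real.log y * ν) *
          Complex.exp (Real.log (2 * t) * (-(ν + 1) : ℝ)) := by
      rw [← Complex.exp_sub, ← Complex.exp_add, ← Complex.exp_add, ← Complex.exp_add, hL]
      congr 1
      push_cast
      ring
    rw [← key]
    ring

/-- The density at negative time and negative endpoint. -/
lemma besqC_neg_eq_besqEntire {ν t u y : ℝ} (ht : 0 < t) (hu : 0 < u) (hy : 0 < y) :
    besqC ν (-t) ((-u : ℝ) : ℂ) y = besqEntire ν t u (-y) := by
  have h2t : 0 < 2 * t := by positivity
  have hy0 : (y : ℂ) ≠ 0 := by exact_mod_cast hy.ne'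
  have hu0 : ((-u : ℝ) : ℂ) ≠ 0 := by
    rw [Complex.ofReal_ne_zero]; linarith
  have huy : 0 < u * y := by positivity
  have ht0 : (t : ℂ) ≠ 0 := by exact_mod_cast ht.ne'
  unfold besqC besqEntire
  rw [if_neg hy0, abs_neg, abs_of_pos ht, quotPow]
  -- The root of `-u y` contributes `i π / 2`, and dividing by the negative time turns it into `-i π
  -- / 2`. In the final exponents this cancels the phase of `(-u) ^ (ν / 2)`, so no phase depending
  -- on `ν` survives.
  set L : ℂ := Real.log (u * y) / 2 - Real.log (2 * t) - Real.pi / 2 * Complex.I with hL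
  have him : L.im = -(Real.pi / 2) := by
    have : L = ((Real.log (u * y) / 2 - Real.log (2 * t) : ℝ) : ℂ) +
        ((-(Real.pi / 2) : ℝ) : ℂ) * Complex.I := by
      rw [hL]; push_cast; ring
    rw [this]
    simp [-Complex.ofReal_neg, -Complex.ofReal_sub, -Complex.ofReal_div]
  have hlogu : Complex.log ((-u : ℝ) : ℂ) = Real.log u + Real.pi * Complex.I := by
    rw [Complex.ofReal_neg, ← neg_one_mul, mul_comm, Complex.log_ofReal_mul hu (by simp),
      Complex.log_neg_one]
  have hlog : Complex.log (y * ((-u : ℝ) : ℂ)) = Real.log (u * y) + Real.pi * Complex.I := by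
    rw [Complex.log_ofReal_mul hy hu0, hlogu, Real.log_mul hu.ne' hy.ne']
    push_cast
    ring
  have hexpI : Complex.exp (Real.pi / 2 * Complex.I) = Complex.I := Complex.exp_pi_div_two_mul_I
  have hsqrt : ((y : ℂ) * ((-u : ℝ) : ℂ)) ^ (1 / 2 : ℂ) / ((-t : ℝ) : ℂ) = 2 * Complex.exp L := by
    rw [Complex.cpow_def_of_ne_zero (mul_ne_zero hy0 hu0), hlog, hL, Complex.exp_sub,
      Complex.exp_sub, ofReal_exp_log h2t, hexpI, show ((Real.log (u * y) : ℂ) + Real.pi *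
        Complex.I) * (1 / 2) = Real.log (u * y) / 2 + Real.pi / 2 * Complex.I by ring,
      Complex.exp_add, hexpI]
    have hI := Complex.I_ne_zero
    push_cast
    field_simp
    rw [Complex.I_sq, neg_neg]
  have hpi := Real.pi_pos
  rw [hsqrt, besselIC_two_mul_exp (by rw [him]; linarith) (by rw [him]; linarith),
    Complex.cpow_def_of_ne_zero hu0, hlogu, Complex.cpow_def_of_ne_zero hy0,
    ← Complex.ofReal_log hy.le]
  have hE : Complex.exp (2 * L) = u * (-y : ℂ) / (4 * t ^ 2) := by
    rw [hL, show (2 : ℂ) * (Real.log (u * y) / 2 - Real.log (2 * t) - Real.pi / 2 * Complex.I) =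
      Real.log (u * y) - (Real.log (2 * t) + Real.log (2 * t)) - Real.pi * Complex.I by ring,
      Complex.exp_sub, Complex.exp_sub, Complex.exp_add, ofReal_exp_log h2t, ofReal_exp_log huy,
      Complex.exp_pi_mul_I]
    push_cast
    field_simp
    ring
  rw [hE, Complex.ofReal_mul, ofReal_rpow_eq_exp hu, ofReal_rpow_eq_exp h2t]
  have h2 : (1 : ℂ) / (2 * (t : ℝ)) = Complex.exp (-Real.log (2 * t)) := by
    rw [Complex.exp_neg, ofReal_exp_log h2t]
    push_cast
    rw [one_div]
  rw [h2]
  have key : Complex.exp (-(Real.log (2 * t))) *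
      (Complex.exp ((Real.log u + Real.pi * Complex.I) * (ν / 2)) /
        Complex.exp (Real.log y * (ν / 2))) * Complex.exp (L * ν) =
      Complex.exp (Real.log u * ν) * Complex.exp (Real.log (2 * t) * (-(ν + 1) : ℝ)) := by
    rw [← Complex.exp_sub, ← Complex.exp_add, ← Complex.exp_add, ← Complex.exp_add, hL,
      Real.log_mul hu.ne' hy.ne']
    congr 1
    push_cast
    ring
  rw [← key, show -((y : ℂ) + ((-u : ℝ) : ℂ)) / (2 * ((-t : ℝ) : ℂ)) =
    -((u : ℂ) + -y) / (2 * t) by push_cast; field_simp; ring]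
  ring

lemma ofReal_besselI {ν x : ℝ} (hx : 0 ≤ x) : (besselI ν x : ℂ) = besselIC ν x := by
  unfold besselI besselIC
  rw [Complex.ofReal_tsum]
  refine tsum_congr fun n => ?_
  rw [Complex.ofReal_mul, Complex.ofReal_cpow (by positivity)]
  push_cast
  rw [← Complex.Gamma_ofReal, ← Complex.Gamma_ofReal]
  push_cast
  rfl

/-- The real transition density is the restriction of `besqEntire`. -/
lemma ofReal_besq {ν t y x : ℝ} (ht : 0 < t) (hy : 0 < y) (hx : 0 ≤ x) :
    (besq ν t y x : ℂ) = besqEntire ν t y x := by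
  rw [← besqC_eq_besqEntire ht hy]
  unfold besq besqC
  simp only [Complex.ofReal_eq_zero]
  split_ifs with h
  · rw [Complex.ofReal_mul, Complex.ofReal_div, Complex.ofReal_cpow hy.le, abs_of_pos ht]
    push_cast
    rfl
  · have hx' : 0 < x := lt_of_le_of_ne hx (Ne.symm h)
    rw [Complex.ofReal_mul, Complex.ofReal_mul, Complex.ofReal_mul,
      ofReal_besselI (by positivity), Real.div_rpow hy.le hx, abs_of_pos ht, quotPow,
      Real.sqrt_eq_rpow, Complex.ofReal_div, Complex.ofReal_div, Complex.ofReal_div,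
      Complex.ofReal_cpow hy.le, Complex.ofReal_cpow hx,
      Complex.ofReal_cpow (by positivity : 0 ≤ x * y)]
    push_cast
    rfl

/-! ## Moments and the Chapman–Kolmogorov equation -/

/-- Chu–Vandermonde, in terms of the Gamma function. -/
lemma sum_choose_mul_descFactorial_mul_gamma (m n : ℕ) {ν : ℝ} (hν : -1 < ν) :
    ∑ k ∈ Finset.range (m + 1), (m.choose k : ℝ) * n.descFactorial k *
      (Real.Gamma (ν + m + 1) / Real.Gamma (ν + k + 1)) =
      Real.Gamma (ν + m + n + 1) / Real.Gamma (ν + n + 1) := by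
  have hG : ∀ (μ : ℝ) (j : ℕ), -1 < μ → 0 < Real.Gamma (μ + j + 1) := fun μ j hμ =>
    Real.Gamma_pos_of_pos (by have : (0 : ℝ) ≤ j := j.cast_nonneg; linarith)
  -- The induction raises `ν` by one: Pascal's rule splits the binomial coefficient, the second half
  -- is reindexed, and the two halves then match the formula for `ν + 1` term by term.
  induction m generalizing ν with
  | zero =>
    have := (hG ν 0 hν).ne'
    simp only [Nat.cast_zero, add_zero] at this
    have h2 := (hG ν n hν).ne'
    simp [this, h2]
  | succ m ih =>
    have hν1 : -1 < ν + 1 := by linarith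
    have hrec : ∀ x : ℝ, 0 < x → Real.Gamma (x + 1) = x * Real.Gamma x :=
      fun x hx => Real.Gamma_add_one hx.ne'
    have hn0 : (0 : ℝ) ≤ n := n.cast_nonneg
    have hR : Real.Gamma (ν + (m + 1 : ℕ) + n + 1) / Real.Gamma (ν + n + 1) =
        (ν + 1 + n) * (Real.Gamma (ν + 1 + m + n + 1) / Real.Gamma (ν + 1 + n + 1)) := by
      have h1 : Real.Gamma (ν + 1 + n + 1) = (ν + n + 1) * Real.Gamma (ν + n + 1) := by
        rw [← hrec _ (by linarith)]
        congr 1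
        ring
      have h3 : ν + n + 1 ≠ 0 := by linarith
      have h4 := (hG ν n hν).ne'
      rw [h1]
      push_cast
      field_simp
      rw [show ν + 1 + (n : ℝ) = ν + n + 1 by ring, mul_comm,
        show ν + ((m : ℝ) + 1) + n + 1 = ν + 1 + m + n + 1 by ring]
    rw [hR, ← ih hν1, Finset.mul_sum]
    have hm : Real.Gamma (ν + (m + 1 : ℕ) + 1) = Real.Gamma (ν + 1 + m + 1) := by
      congr 1
      push_cast
      ring
    rw [hm]
    set G := Real.Gamma (ν + 1 + m + 1) with hGdef
    have hsplit : ∀ k : ℕ, ((m + 1).choose (k + 1) : ℝ) = m.choose k + m.choose (k + 1) := by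
      intro k
      rw [Nat.choose_succ_succ]
      push_cast
      rfl
    rw [Finset.sum_range_succ']
    simp_rw [hsplit, add_mul]
    rw [Finset.sum_add_distrib, add_assoc]
    have htail : ∑ k ∈ Finset.range (m + 1), (m.choose (k + 1) : ℝ) * n.descFactorial (k + 1) *
        (G / Real.Gamma (ν + (k + 1 : ℕ) + 1)) + ((m + 1).choose 0 : ℝ) * n.descFactorial 0 *
        (G / Real.Gamma (ν + (0 : ℕ) + 1)) = ∑ k ∈ Finset.range (m + 1), (m.choose k : ℝ) *
        n.descFactorial k * (G / Real.Gamma (ν + k + 1)) := by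
      rw [show (m + 1).choose 0 = m.choose 0 by simp,
        ← Finset.sum_range_succ' (fun k => (m.choose k : ℝ) * n.descFactorial k *
          (G / Real.Gamma (ν + k + 1))), Finset.sum_range_succ _ (m + 1)]
      simp
    rw [htail, ← Finset.sum_add_distrib]
    refine Finset.sum_congr rfl fun k _ => ?_
    have hk0 : (0 : ℝ) ≤ k := k.cast_nonneg
    have h1 : Real.Gamma (ν + (k + 1 : ℕ) + 1) = (ν + k + 1) * Real.Gamma (ν + k + 1) := by
      rw [← hrec _ (by linarith)]
      congr 1
      push_cast
      ring
    have h2 : Real.Gamma (ν + 1 + k + 1) = (ν + k + 1) * Real.Gamma (ν + k + 1) := by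
      rw [← hrec _ (by linarith)]
      congr 1
      ring
    have h3 : ν + k + 1 ≠ 0 := by linarith
    have h4 := (hG ν k hν).ne'
    have hdesc : (n.descFactorial (k + 1) : ℝ) = (n - k) * n.descFactorial k := by
      rw [Nat.descFactorial_succ]
      push_cast
      rcases le_or_gt k n with h | h
      · rw [Nat.cast_sub h]
      · rw [Nat.descFactorial_of_lt h]
        simp
    rw [h1, h2, hdesc]
    field_simp
    ring

/-- This is `wᵏ` times the `k`-th derivative of the exponential series; the terms with `n < k`
vanish. -/
lemma hasSum_descFactorial_mul_pow_div_factorial (k : ℕ) (w : ℂ) :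
    HasSum (fun n : ℕ => (n.descFactorial k : ℂ) * (w ^ n / n !)) (w ^ k * Complex.exp w) := by
  rw [← hasSum_nat_add_iff' k]
  have h0 : ∑ i ∈ Finset.range k, (i.descFactorial k : ℂ) * (w ^ i / i !) = 0 :=
    Finset.sum_eq_zero fun i hi => by
      rw [Nat.descFactorial_of_lt (Finset.mem_range.1 hi)]
      simp
  rw [h0, sub_zero]
  have h := (NormedSpace.expSeries_div_hasSum_exp w).mul_left (w ^ k)
  rw [← Complex.exp_eq_exp_ℂ] at h
  refine h.congr_fun fun n => ?_
  have hf : (n ! : ℂ) * ((n + k).descFactorial k : ℂ) = ((n + k)! : ℂ) := by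
    have := Nat.factorial_mul_descFactorial (Nat.le_add_left k n)
    rw [Nat.add_sub_cancel] at this
    exact_mod_cast this
  have h1 : (n ! : ℂ) ≠ 0 := by exact_mod_cast n.factorial_ne_zero
  have h2 : ((n + k)! : ℂ) ≠ 0 := by exact_mod_cast (n + k).factorial_ne_zero
  field_simp
  rw [← hf, pow_add]
  ring

/-- The polynomials `∑ₖ C(m, k) Γ(ν + m + 1) / Γ(ν + k + 1) wᵏ`. -/
def laguerreSum (ν : ℝ) (m : ℕ) (w : ℂ) : ℂ :=
  ∑ k ∈ Finset.range (m + 1),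
    ((m.choose k * (Real.Gamma (ν + m + 1) / Real.Gamma (ν + k + 1)) : ℝ) : ℂ) * w ^ k

/-- Kummer's transformation in its polynomial case: Chu–Vandermonde expands `Γ(ν + m + n + 1) / Γ(ν
+ n + 1)` in falling factorials of `n`, each of which sums to a power of `w` times `exp w`. -/
lemma hasSum_laguerreSum {ν : ℝ} (hν : -1 < ν) (m : ℕ) (w : ℂ) :
    HasSum (fun n : ℕ => ((besselCoeff ν n * Real.Gamma (ν + m + n + 1) : ℝ) : ℂ) * w ^ n)
      (Complex.exp w * laguerreSum ν m w) := by
  have h : HasSum (fun n : ℕ => ∑ k ∈ Finset.range (m + 1),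
      ((m.choose k * (Real.Gamma (ν + m + 1) / Real.Gamma (ν + k + 1)) : ℝ) : ℂ) *
        ((n.descFactorial k : ℂ) * (w ^ n / n !))) (∑ k ∈ Finset.range (m + 1),
      ((m.choose k * (Real.Gamma (ν + m + 1) / Real.Gamma (ν + k + 1)) : ℝ) : ℂ) *
        (w ^ k * Complex.exp w)) :=
    hasSum_sum fun k _ => (hasSum_descFactorial_mul_pow_div_factorial k w).mul_left _
  have hval : Complex.exp w * laguerreSum ν m w = ∑ k ∈ Finset.range (m + 1),
      ((m.choose k * (Real.Gamma (ν + m + 1) / Real.Gamma (ν + k + 1)) : ℝ) : ℂ) *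
        (w ^ k * Complex.exp w) := by
    rw [laguerreSum, Finset.mul_sum]
    exact Finset.sum_congr rfl fun k _ => by ring
  rw [hval]
  refine h.congr_fun fun n => ?_
  have hcv := sum_choose_mul_descFactorial_mul_gamma m n hν
  have : besselCoeff ν n * Real.Gamma (ν + m + n + 1) = ∑ k ∈ Finset.range (m + 1),
      (m.choose k * (Real.Gamma (ν + m + 1) / Real.Gamma (ν + k + 1))) *
        (n.descFactorial k * (1 / n !)) := by
    unfold besselCoeff
    rw [show (n : ℝ) + 1 + ν = ν + n + 1 by ring, one_div, mul_inv, mul_assoc,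
      inv_mul_eq_div (Real.Gamma (ν + n + 1)), ← hcv, Finset.mul_sum]
    exact Finset.sum_congr rfl fun k _ => by ring
  rw [this]
  push_cast
  rw [Finset.sum_mul]
  exact Finset.sum_congr rfl fun k _ => by ring

lemma integrableOn_rpow_mul_pow_mul_exp {ν : ℝ} (hν : -1 < ν) (m : ℕ) {b : ℝ} (hb : 0 < b) :
    IntegrableOn (fun y : ℝ => y ^ ν * y ^ m * Real.exp (-(b * y))) (Ioi 0) := by
  have h := integrableOn_rpow_mul_exp_neg_mul_rpow (p := 1) (s := ν + m) (b := b)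
    (by have : (0 : ℝ) ≤ m := m.cast_nonneg; linarith) one_pos hb
  refine h.congr_fun (fun y hy => ?_) measurableSet_Ioi
  have hy : 0 < y := hy
  simp only [Real.rpow_one, Real.rpow_add hy, Real.rpow_natCast, neg_mul]

lemma integral_rpow_mul_pow_mul_exp {ν : ℝ} (hν : -1 < ν) (m : ℕ) {b : ℝ} (hb : 0 < b) :
    ∫ y in Ioi (0 : ℝ), y ^ ν * y ^ m * Real.exp (-(b * y)) =
      (1 / b) ^ (ν + 1) * (1 / b) ^ m * Real.Gamma (ν + m + 1) := by
  have h := Real.integral_rpow_mul_exp_neg_mul_Ioi (a := ν + m + 1) (r := b)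
    (by have : (0 : ℝ) ≤ m := m.cast_nonneg; linarith) hb
  rw [show ν + (m : ℝ) + 1 = (ν + 1) + m by ring, Real.rpow_add (by positivity),
    Real.rpow_natCast] at h
  rw [show ν + (m : ℝ) + 1 = (ν + 1) + m by ring, ← h]
  refine setIntegral_congr_fun measurableSet_Ioi fun y hy => ?_
  have hy : 0 < y := hy
  simp only [show ν + 1 + (m : ℝ) - 1 = ν + m by ring, Real.rpow_add hy, Real.rpow_natCast]

lemma measurable_rpow_mul_pow_mul_exp (ν : ℝ) (m : ℕ) (b : ℝ) :
    Measurable fun y : ℝ => y ^ ν * y ^ m * Real.exp (-(b * y)) := by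
  fun_prop

lemma integrableOn_mul_besselE {ν : ℝ} (hν : -1 < ν) (m : ℕ) {b : ℝ} (hb : 0 < b) (c : ℂ) :
    IntegrableOn (fun y : ℝ => ((y ^ ν * y ^ m * Real.exp (-(b * y)) : ℝ) : ℂ) *
      besselE ν (c * y)) (Ioi 0) := by
  obtain ⟨C, hC0, hC⟩ := exists_norm_besselE_le hν (one_lt_two)
  have hg := (integrableOn_rpow_mul_pow_mul_exp hν m (half_pos hb)).mul_const
    (C * Real.exp (2 * (‖c‖ / (b / 2))))
  refine Integrable.mono' hg ?_ ?_
  · have := (continuous_besselE hν).measurable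
    have := measurable_rpow_mul_pow_mul_exp ν m b
    exact Measurable.aestronglyMeasurable (by fun_prop)
  · refine (ae_restrict_iff' measurableSet_Ioi).2 (Eventually.of_forall fun y hy => ?_)
    have hy : 0 < y := hy
    -- The split lets the Bessel factor consume only half of the decay `exp (-(b y))`, whatever the
    -- size of `c`.
    have h := hC (b / 2 * y) (‖c‖ / (b / 2)) (c * y) (by positivity) (by positivity) (by
      rw [norm_mul, Complex.norm_of_nonneg hy.le]
      field_simp
      rfl)
    rw [norm_mul, Complex.norm_of_nonneg (by positivity)]
    calc y ^ ν * y ^ m * Real.exp (-(b * y)) * ‖besselE ν (c * y)‖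
        ≤ y ^ ν * y ^ m * Real.exp (-(b * y)) *
          (C * Real.exp (b / 2 * y + 2 * (‖c‖ / (b / 2)))) := by gcongr
      _ = y ^ ν * y ^ m * (Real.exp (-(b * y)) * Real.exp (b / 2 * y)) *
          (C * Real.exp (2 * (‖c‖ / (b / 2)))) := by rw [Real.exp_add]; ring
      _ = _ := by
        rw [← Real.exp_add]
        congr 4
        ring

/-- Laplace transform of `y ^ (ν + m) besselE ν (c y)`. -/
lemma integral_mul_besselE {ν : ℝ} (hν : -1 < ν) (m : ℕ) {b : ℝ} (hb : 0 < b) (c : ℂ) :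
    ∫ y in Ioi (0 : ℝ), ((y ^ ν * y ^ m * Real.exp (-(b * y)) : ℝ) : ℂ) * besselE ν (c * y) =
      (((1 / b) ^ (ν + 1) * (1 / b) ^ m : ℝ) : ℂ) *
        (Complex.exp (c / b) * laguerreSum ν m (c / b)) := by
  let F : ℕ → ℝ → ℂ := fun n y =>
    ((besselCoeff ν n : ℝ) : ℂ) * c ^ n * ((y ^ ν * y ^ (m + n) * Real.exp (-(b * y)) : ℝ) : ℂ)
  have hF : ∀ n, IntegrableOn (F n) (Ioi 0) := fun n =>
    ((integrableOn_rpow_mul_pow_mul_exp hν (m + n) hb).ofReal).const_mul _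
  have hFint : ∀ (n : ℕ) (d : ℝ), ∫ y in Ioi (0 : ℝ), besselCoeff ν n * d ^ n *
      (y ^ ν * y ^ (m + n) * Real.exp (-(b * y))) = (1 / b) ^ (ν + 1) * (1 / b) ^ m *
      (besselCoeff ν n * Real.Gamma (ν + m + n + 1) * (d / b) ^ n) := by
    intro n d
    rw [integral_const_mul, integral_rpow_mul_pow_mul_exp hν (m + n) hb]
    push_cast
    rw [pow_add, div_pow, one_div, inv_pow b n, show ν + ((m : ℝ) + n) = ν + m + n by ring]
    ring
  -- Taking norms replaces `c` by `‖c‖` in the same formula, so absolute convergence is the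
  -- convergence of the series at `‖c‖ / b`.
  have hsum : Summable fun n => ∫ y in Ioi (0 : ℝ), ‖F n y‖ := by
    have h1 : ∀ n, ∫ y in Ioi (0 : ℝ), ‖F n y‖ = (1 / b) ^ (ν + 1) * (1 / b) ^ m *
        (besselCoeff ν n * Real.Gamma (ν + m + n + 1) * (‖c‖ / b) ^ n) := by
      intro n
      rw [← hFint n ‖c‖]
      refine setIntegral_congr_fun measurableSet_Ioi fun y hy => ?_
      have hy : 0 < y := hy
      have := besselCoeff_pos hν n
      simp only [F]
      rw [norm_mul, norm_mul, norm_pow, Complex.norm_of_nonneg this.le,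
        Complex.norm_of_nonneg (by positivity)]
    simp_rw [h1]
    refine Summable.mul_left _ ?_
    have h2 := (hasSum_laguerreSum hν m ((‖c‖ / b : ℝ) : ℂ)).summable
    rw [← Complex.summable_ofReal]
    refine h2.congr fun n => ?_
    push_cast
    rfl
  have h := hasSum_integral_of_summable_integral_norm (fun n => (hF n)) hsum
  have h1 : ∫ y in Ioi (0 : ℝ), ((y ^ ν * y ^ m * Real.exp (-(b * y)) : ℝ) : ℂ) *
      besselE ν (c * y) = ∫ y in Ioi (0 : ℝ), ∑' n, F n y := by
    refine integral_congr_ae (Eventually.of_forall fun y => ?_)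
    simp only [besselE, F]
    rw [← tsum_mul_left]
    refine tsum_congr fun n => ?_
    push_cast
    rw [mul_pow, pow_add]
    ring
  rw [h1]
  refine h.unique ?_
  have h2 := (hasSum_laguerreSum hν m (c / b)).mul_left
    (((1 / b) ^ (ν + 1) * (1 / b) ^ m : ℝ) : ℂ)
  refine h2.congr_fun fun n => ?_
  have h3 : ∫ y in Ioi (0 : ℝ), F n y = ((besselCoeff ν n : ℝ) : ℂ) * c ^ n *
      ((∫ y in Ioi (0 : ℝ), y ^ ν * y ^ (m + n) * Real.exp (-(b * y)) : ℝ) : ℂ) := by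
    simp only [F]
    rw [integral_const_mul, integral_complex_ofReal]
  rw [h3, integral_rpow_mul_pow_mul_exp hν (m + n) hb]
  push_cast
  rw [pow_add, div_pow c, one_div_pow (b : ℂ) n,
    show (ν : ℝ) + ((m : ℝ) + n) = ν + m + n by ring]
  ring

/-- It exhibits the `m`-th term of Weber's integral as a Cauchy product coefficient, so that the sum
over `m` factors into `besselE ν (α γ)` and `exp α`. -/
lemma besselCoeff_mul_laguerreSum {ν : ℝ} (hν : -1 < ν) (m : ℕ) (α γ : ℂ) :
    ((besselCoeff ν m : ℝ) : ℂ) * α ^ m * laguerreSum ν m γ =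
      ∑ p ∈ Finset.HasAntidiagonal.antidiagonal m,
        ((besselCoeff ν p.1 : ℝ) : ℂ) * (α * γ) ^ p.1 * (α ^ p.2 / p.2 !) := by
  rw [Finset.Nat.sum_antidiagonal_eq_sum_range_succ
    (fun i j => ((besselCoeff ν i : ℝ) : ℂ) * (α * γ) ^ i * (α ^ j / j !)), laguerreSum,
    Finset.mul_sum]
  refine Finset.sum_congr rfl fun k hk => ?_
  have hkm : k ≤ m := Nat.lt_succ_iff.1 (Finset.mem_range.1 hk)
  have hc : besselCoeff ν m * (m.choose k * (Real.Gamma (ν + m + 1) / Real.Gamma (ν + k + 1))) =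
      besselCoeff ν k * (1 / (m - k)!) := by
    have h1 := gamma_pos_of_index hν m
    have h2 := gamma_pos_of_index hν k
    unfold besselCoeff
    rw [show (m : ℝ) + 1 + ν = ν + m + 1 by ring] at *
    rw [show (k : ℝ) + 1 + ν = ν + k + 1 by ring] at *
    rw [Nat.cast_choose ℝ hkm]
    have := h1.ne'
    have := h2.ne'
    field_simp
  have hc' := congrArg (fun x : ℝ => (x : ℂ)) hc
  simp only [Complex.ofReal_mul (besselCoeff ν m), Complex.ofReal_mul (besselCoeff ν k)] at hc'
  calc ((besselCoeff ν m : ℝ) : ℂ) * α ^ m *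
        (((m.choose k * (Real.Gamma (ν + m + 1) / Real.Gamma (ν + k + 1)) : ℝ) : ℂ) * γ ^ k)
      = (((besselCoeff ν m : ℝ) : ℂ) *
        ((m.choose k * (Real.Gamma (ν + m + 1) / Real.Gamma (ν + k + 1)) : ℝ) : ℂ)) *
          (α ^ m * γ ^ k) := by ring
    _ = _ := by
      rw [hc', mul_pow, show α ^ m = α ^ k * α ^ (m - k) by rw [← pow_add, Nat.add_sub_cancel' hkm]]
      push_cast
      ring

lemma summable_antidiagonal_besselE_exp {ν : ℝ} (hν : -1 < ν) (α δ : ℂ) :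
    HasSum (fun m => ∑ p ∈ Finset.HasAntidiagonal.antidiagonal m,
      ((besselCoeff ν p.1 : ℝ) : ℂ) * δ ^ p.1 * (α ^ p.2 / p.2 !))
      (besselE ν δ * Complex.exp α) := by
  have h1 := summable_norm_besselE hν δ
  have h2 : Summable fun n : ℕ => ‖α ^ n / (n ! : ℂ)‖ := NormedSpace.norm_expSeries_div_summable α
  have h3 := (summable_norm_sum_mul_antidiagonal_of_summable_norm h1 h2).of_norm.hasSum
  rw [← tsum_mul_tsum_eq_tsum_sum_antidiagonal_of_summable_norm h1 h2] at h3
  have h4 : ∑' n : ℕ, α ^ n / (n ! : ℂ) = Complex.exp α := by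
    rw [Complex.exp_eq_exp_ℂ]
    exact (NormedSpace.expSeries_div_hasSum_exp α).tsum_eq
  rw [h4] at h3
  exact h3

/-- Weber's integral. -/
lemma integral_besselE_mul_besselE {ν : ℝ} (hν : -1 < ν) {b : ℝ} (hb : 0 < b) (a c : ℂ) :
    ∫ y in Ioi (0 : ℝ), ((y ^ ν * Real.exp (-(b * y)) : ℝ) : ℂ) *
      (besselE ν (a * y) * besselE ν (c * y)) = (((1 / b) ^ (ν + 1) : ℝ) : ℂ) *
        (Complex.exp ((a + c) / b) * besselE ν (a * c / b ^ 2)) := by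
  have hb0 : (b : ℂ) ≠ 0 := by exact_mod_cast hb.ne'
  let F : ℕ → ℝ → ℂ := fun m y => ((besselCoeff ν m : ℝ) : ℂ) * a ^ m *
    (((y ^ ν * y ^ m * Real.exp (-(b * y)) : ℝ) : ℂ) * besselE ν (c * y))
  have hF : ∀ n, IntegrableOn (F n) (Ioi 0) := fun n =>
    (integrableOn_mul_besselE hν n hb c).const_mul _
  have hval : ∀ (m : ℕ) (a c : ℂ), ((besselCoeff ν m : ℝ) : ℂ) * a ^ m *
      ((((1 / b) ^ (ν + 1) * (1 / b) ^ m : ℝ) : ℂ) *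
        (Complex.exp (c / b) * laguerreSum ν m (c / b))) =
      (((1 / b) ^ (ν + 1) : ℝ) : ℂ) * Complex.exp (c / b) * ∑ p ∈ Finset.HasAntidiagonal.antidiagonal m,
        ((besselCoeff ν p.1 : ℝ) : ℂ) * ((a / b) * (c / b)) ^ p.1 * ((a / b) ^ p.2 / p.2 !) := by
    intro m a c
    rw [← besselCoeff_mul_laguerreSum hν, div_pow a]
    push_cast
    rw [one_div_pow]
    field_simp
  have hE : ∀ (y : ℝ), 0 < y → ‖besselE ν (c * y)‖ ≤ (besselE ν ((‖c‖ : ℝ) * y)).re := by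
    intro y hy
    have h1 := hasSum_besselE hν ((‖c‖ : ℝ) * (y : ℂ))
    have h2 := Complex.hasSum_re h1
    refine tsum_of_norm_bounded h2 fun n => le_of_eq ?_
    rw [norm_besselCoeff_mul hν, norm_mul, Complex.norm_of_nonneg hy.le, ← Complex.ofReal_mul,
      ← Complex.ofReal_pow, ← Complex.ofReal_mul, Complex.ofReal_re]
  -- The norms are dominated by the same integrands with `a`, `c` replaced by `‖a‖`, `‖c‖`. Their
  -- integrals are already known and form a convergent Cauchy product, so the termwise formula
  -- supplies its own justification.
  have hsum : Summable fun n => ∫ y in Ioi (0 : ℝ), ‖F n y‖ := by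
    have hS := ((summable_antidiagonal_besselE_exp hν (((‖a‖ : ℝ) : ℂ) / b)
      ((((‖a‖ : ℝ) : ℂ) / b) * (((‖c‖ : ℝ) : ℂ) / b))).mul_left
      ((((1 / b) ^ (ν + 1) : ℝ) : ℂ) * Complex.exp (((‖c‖ : ℝ) : ℂ) / b))).summable
    simp_rw [← hval _ ((‖a‖ : ℝ) : ℂ) ((‖c‖ : ℝ) : ℂ),
      ← integral_mul_besselE hν _ hb ((‖c‖ : ℝ) : ℂ)] at hS
    refine Summable.of_nonneg_of_le (fun n => integral_nonneg fun y => norm_nonneg _)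
      (fun n => ?_) (Complex.reCLM.summable hS)
    have hintg := (integrableOn_mul_besselE hν n hb ((‖c‖ : ℝ) : ℂ)).const_mul
      (((besselCoeff ν n : ℝ) : ℂ) * ((‖a‖ : ℝ) : ℂ) ^ n)
    simp only [Complex.reCLM_apply]
    rw [← integral_const_mul, ← RCLike.re_to_complex, ← integral_re hintg]
    refine setIntegral_mono_on (hF n).norm hintg.re measurableSet_Ioi fun y hy => ?_
    have hy : 0 < y := hy
    have hcf := besselCoeff_pos hν n
    simp only [F, RCLike.re_to_complex]
    rw [← Complex.ofReal_pow, ← Complex.ofReal_mul, Complex.re_ofReal_mul, Complex.re_ofReal_mul,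
      norm_mul, norm_mul, norm_mul, norm_pow, Complex.norm_of_nonneg hcf.le,
      Complex.norm_of_nonneg (by positivity)]
    have := hE y hy
    gcongr
  have h := hasSum_integral_of_summable_integral_norm (fun n => (hF n)) hsum
  have h1 : ∫ y in Ioi (0 : ℝ), ((y ^ ν * Real.exp (-(b * y)) : ℝ) : ℂ) *
      (besselE ν (a * y) * besselE ν (c * y)) = ∫ y in Ioi (0 : ℝ), ∑' n, F n y := by
    refine integral_congr_ae (Eventually.of_forall fun y => ?_)
    simp only [F]
    rw [show besselE ν (a * y) = ∑' n : ℕ, (besselCoeff ν n : ℂ) * (a * y) ^ n from rfl,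
      ← tsum_mul_right, ← tsum_mul_left]
    refine tsum_congr fun n => ?_
    push_cast
    rw [mul_pow]
    ring
  rw [h1]
  refine h.unique ?_
  have h2 := (summable_antidiagonal_besselE_exp hν (a / b) ((a / b) * (c / b))).mul_left
    ((((1 / b) ^ (ν + 1) : ℝ) : ℂ) * Complex.exp (c / b))
  simp_rw [← hval] at h2
  have h3 : ∀ n, ∫ y in Ioi (0 : ℝ), F n y = ((besselCoeff ν n : ℝ) : ℂ) * a ^ n *
      ((((1 / b) ^ (ν + 1) * (1 / b) ^ n : ℝ) : ℂ) *
        (Complex.exp (c / b) * laguerreSum ν n (c / b))) := by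
    intro n
    simp only [F]
    rw [integral_const_mul, integral_mul_besselE hν n hb c]
  simp_rw [h3]
  convert! h2 using 1
  rw [add_div, Complex.exp_add, show a * c / (b : ℂ) ^ 2 = a / b * (c / b) by ring]
  ring

/-! ### The squared Bessel semigroup on polynomials -/

open Polynomial in
/-- The image of `X ^ m` under the squared Bessel semigroup at time `t`. -/
def besqMonomial (ν t : ℝ) (m : ℕ) : ℂ[X] :=
  ∑ k ∈ Finset.range (m + 1), monomial k
    ((m.choose k * (Real.Gamma (ν + m + 1) / Real.Gamma (ν + k + 1)) * (2 * t) ^ (m - k) : ℝ) : ℂ)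

open Polynomial in
/-- The action of the squared Bessel semigroup on polynomials. -/
def besqPoly (ν t : ℝ) : ℂ[X] →ₗ[ℂ] ℂ[X] :=
  Polynomial.lsum fun m => LinearMap.toSpanSingleton ℂ ℂ[X] (besqMonomial ν t m)

lemma besqPoly_monomial (ν t : ℝ) (m : ℕ) (c : ℂ) :
    besqPoly ν t (Polynomial.monomial m c) = c • besqMonomial ν t m := by
  simp [besqPoly, Polynomial.lsum_apply]

lemma coeff_besqMonomial (ν t : ℝ) (m l : ℕ) : (besqMonomial ν t m).coeff l =
    ((m.choose l * (Real.Gamma (ν + m + 1) / Real.Gamma (ν + l + 1)) * (2 * t) ^ (m - l) : ℝ) :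
      ℂ) := by
  simp only [besqMonomial, Polynomial.finsetSum_coeff, Polynomial.coeff_monomial]
  rw [Finset.sum_ite_eq' (Finset.range (m + 1)) l]
  split_ifs with h
  · rfl
  · rw [Finset.mem_range, not_lt] at h
    rw [Nat.choose_eq_zero_of_lt (by omega)]
    simp

lemma gamma_pos_of_index' {ν : ℝ} (hν : -1 < ν) (n : ℕ) : 0 < Real.Gamma (ν + n + 1) :=
  Real.Gamma_pos_of_pos (by have : (0 : ℝ) ≤ n := n.cast_nonneg; linarith)

/-- The Gamma ratios telescope and the binomial coefficients regroup as `C(m, l) C(m - l, j)`, which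
leaves the binomial theorem for `(2 s + 2 t) ^ (m - l)`. No sign is imposed on the times, so
backward evolution is covered. -/
lemma besqPoly_besqMonomial {ν : ℝ} (hν : -1 < ν) (s t : ℝ) (m : ℕ) :
    besqPoly ν s (besqMonomial ν t m) = besqMonomial ν (s + t) m := by
  ext l
  rw [coeff_besqMonomial]
  simp only [besqMonomial, map_sum, besqPoly_monomial, Polynomial.finsetSum_coeff,
    Polynomial.coeff_smul, smul_eq_mul]
  have hc2 : ∀ (j : ℕ), (∑ k ∈ Finset.range (j + 1), (Polynomial.monomial k
    ((j.choose k * (Real.Gamma (ν + j + 1) / Real.Gamma (ν + k + 1)) * (2 * s) ^ (j - k) : ℝ) :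
      ℂ)).coeff l) =
      ((j.choose l * (Real.Gamma (ν + j + 1) / Real.Gamma (ν + l + 1)) * (2 * s) ^ (j - l) : ℝ) :
        ℂ) := by
    intro j
    rw [← coeff_besqMonomial ν s j, besqMonomial, Polynomial.finsetSum_coeff]
  simp_rw [hc2]
  norm_cast
  rcases lt_or_ge m l with hml | hml
  · rw [Nat.choose_eq_zero_of_lt hml]
    simp only [Nat.cast_zero, zero_mul]
    refine Finset.sum_eq_zero fun k hk => ?_
    rw [Nat.choose_eq_zero_of_lt (show k < l from (Nat.lt_succ_iff.1
      (Finset.mem_range.1 hk)).trans_lt hml)]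
    simp
  · have hb := add_pow (2 * s) (2 * t) (m - l)
    rw [mul_add 2 s t, hb, Finset.mul_sum]
    rw [show m + 1 = l + (m - l + 1) by omega, Finset.sum_range_add]
    rw [Finset.sum_eq_zero, zero_add]
    · refine Finset.sum_congr rfl fun j hj => ?_
      have hj' : j ≤ m - l := Nat.lt_succ_iff.1 (Finset.mem_range.1 hj)
      have hch : (m.choose (l + j) : ℝ) * ((l + j).choose l) = m.choose l * (m - l).choose j := by
        have := Nat.choose_mul (n := m) (k := l + j) (s := l) (by omega)
        rw [Nat.add_sub_cancel_left] at this
        exact_mod_cast this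
      have h1 := (gamma_pos_of_index' hν (l + j)).ne'
      rw [show m - (l + j) = m - l - j by omega, Nat.add_sub_cancel_left]
      field_simp
      linear_combination Real.Gamma (ν + m + 1) * (2 * t) ^ (m - l - j) * (2 * s) ^ j /
        Real.Gamma (ν + l + 1) * hch
    · intro k hk
      rw [Nat.choose_eq_zero_of_lt (Finset.mem_range.1 hk)]
      simp

/-- The semigroup law on polynomials. -/
lemma besqPoly_besqPoly {ν : ℝ} (hν : -1 < ν) (s t : ℝ) (p : Polynomial ℂ) :
    besqPoly ν s (besqPoly ν t p) = besqPoly ν (s + t) p := by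
  induction p using Polynomial.induction_on' with
  | add p q hp hq => simp only [map_add, hp, hq]
  | monomial m c => simp only [besqPoly_monomial, map_smul, besqPoly_besqMonomial hν]

lemma besqPoly_zero {ν : ℝ} (hν : -1 < ν) (p : Polynomial ℂ) : besqPoly ν 0 p = p := by
  induction p using Polynomial.induction_on' with
  | add p q hp hq => simp only [map_add, hp, hq]
  | monomial m c =>
    rw [besqPoly_monomial, besqMonomial, Finset.sum_range_succ, Finset.sum_eq_zero, zero_add,
      Polynomial.smul_monomial]
    · have := (gamma_pos_of_index' hν m).ne'
      simp [this]
    · intro k hk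
      have : m - k ≠ 0 := by have := Finset.mem_range.1 hk; omega
      simp [this]

/-- The diagonal coefficients of `besqMonomial` are `1` and everything else has lower degree.
Evolved Newton polynomials therefore remain monic and can still compute Vandermonde determinants. -/
lemma coeff_besqPoly_of_natDegree_le {ν : ℝ} (hν : -1 < ν) (t : ℝ) {p : Polynomial ℂ} {l : ℕ}
    (hl : p.natDegree ≤ l) : (besqPoly ν t p).coeff l = p.coeff l := by
  conv_lhs => rw [p.as_sum_range' (l + 1) (Nat.lt_succ_of_le hl)]
  simp only [map_sum, besqPoly_monomial, Polynomial.finsetSum_coeff, Polynomial.coeff_smul,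
    coeff_besqMonomial, smul_eq_mul]
  rw [Finset.sum_range_succ, Finset.sum_eq_zero, zero_add]
  · have := (gamma_pos_of_index' hν l).ne'
    simp [this]
  · intro k hk
    rw [Nat.choose_eq_zero_of_lt (Finset.mem_range.1 hk)]
    simp

lemma monic_besqPoly {ν : ℝ} (hν : -1 < ν) (t : ℝ) {p : Polynomial ℂ} (hp : p.Monic) :
    (besqPoly ν t p).Monic :=
  Polynomial.monic_of_natDegree_le_of_coeff_eq_one p.natDegree
    (Polynomial.natDegree_le_iff_coeff_eq_zero.2 fun l hl => by
      rw [coeff_besqPoly_of_natDegree_le hν t hl.le, Polynomial.coeff_eq_zero_of_natDegree_lt hl])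
    (by rw [coeff_besqPoly_of_natDegree_le hν t le_rfl]; exact hp)

lemma natDegree_besqPoly {ν : ℝ} (hν : -1 < ν) (t : ℝ) {p : Polynomial ℂ} (hp : p.Monic) :
    (besqPoly ν t p).natDegree = p.natDegree :=
  Polynomial.natDegree_eq_of_le_of_coeff_ne_zero
    (Polynomial.natDegree_le_iff_coeff_eq_zero.2 fun l hl => by
      rw [coeff_besqPoly_of_natDegree_le hν t hl.le, Polynomial.coeff_eq_zero_of_natDegree_lt hl])
    (by rw [coeff_besqPoly_of_natDegree_le hν t le_rfl]; exact hp.coeff_natDegree ▸ one_ne_zero)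

lemma besqEntire_eq {ν t y : ℝ} (z : ℂ) :
    besqEntire ν t y z = (((2 * t) ^ (-(ν + 1)) : ℝ) : ℂ) * Complex.exp (-(z / (2 * t))) *
      (((y ^ ν * y ^ 0 * Real.exp (-(1 / (2 * t) * y)) : ℝ) : ℂ) *
        besselE ν (z / (4 * t ^ 2) * y)) := by
  unfold besqEntire
  rw [show -((y : ℂ) + z) / (2 * t) = -(z / (2 * t)) + -(1 / (2 * t) * y) by ring,
    Complex.exp_add, show (y : ℂ) * z / (4 * t ^ 2) = z / (4 * t ^ 2) * y by ring]
  push_cast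
  ring

lemma integrableOn_poly_mul_besqEntire {ν t : ℝ} (hν : -1 < ν) (ht : 0 < t) (p : Polynomial ℂ)
    (z : ℂ) : IntegrableOn (fun y : ℝ => p.eval (y : ℂ) * besqEntire ν t y z) (Ioi 0) := by
  induction p using Polynomial.induction_on' with
  | add p q hp hq =>
    simp only [Polynomial.eval_add, add_mul]
    exact hp.add hq
  | monomial m c =>
    refine ((integrableOn_mul_besselE hν m (b := 1 / (2 * t)) (by positivity)
      (z / (4 * t ^ 2))).const_mul (c * ((((2 * t) ^ (-(ν + 1)) : ℝ) : ℂ) *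
        Complex.exp (-(z / (2 * t)))))).congr (Eventually.of_forall fun y => ?_)
    simp only [besqEntire_eq, Polynomial.eval_monomial]
    push_cast
    ring

/-- The polynomial moments of the transition density. -/
lemma integral_poly_mul_besqEntire {ν t : ℝ} (hν : -1 < ν) (ht : 0 < t) (p : Polynomial ℂ)
    (z : ℂ) : ∫ y in Ioi (0 : ℝ), p.eval (y : ℂ) * besqEntire ν t y z =
      (besqPoly ν t p).eval z := by
  induction p using Polynomial.induction_on' with
  | add p q hp hq =>
    simp only [Polynomial.eval_add, add_mul, map_add]
    rw [integral_add (integrableOn_poly_mul_besqEntire hν ht p z)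
      (integrableOn_poly_mul_besqEntire hν ht q z), hp, hq]
  | monomial m c =>
    have h := integral_mul_besselE hν m (b := 1 / (2 * t)) (by positivity) (z / (4 * t ^ 2))
    have ht0 : (t : ℂ) ≠ 0 := by exact_mod_cast ht.ne'
    have hintg : ∫ y in Ioi (0 : ℝ), (Polynomial.monomial m c).eval (y : ℂ) * besqEntire ν t y z =
        c * ((((2 * t) ^ (-(ν + 1)) : ℝ) : ℂ) * Complex.exp (-(z / (2 * t)))) *
        ∫ y in Ioi (0 : ℝ), ((y ^ ν * y ^ m * Real.exp (-(1 / (2 * t) * y)) : ℝ) : ℂ) *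
          besselE ν (z / (4 * t ^ 2) * y) := by
      rw [← integral_const_mul]
      refine integral_congr_ae (Eventually.of_forall fun y => ?_)
      simp only [besqEntire_eq, Polynomial.eval_monomial]
      push_cast
      ring
    rw [hintg, h, besqPoly_monomial, Polynomial.eval_smul, smul_eq_mul]
    have hcb : z / (4 * (t : ℂ) ^ 2) / ((1 / (2 * t) : ℝ) : ℂ) = z / (2 * t) := by
      push_cast
      field_simp
      ring
    have hpow : ((2 * t) ^ (-(ν + 1)) : ℝ) * ((1 / (1 / (2 * t))) ^ (ν + 1)) = 1 := by
      rw [one_div_one_div, ← Real.rpow_add (by positivity)]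
      simp
    have hlag : (((2 * t) ^ m : ℝ) : ℂ) * laguerreSum ν m (z / (2 * t)) =
        (besqMonomial ν t m).eval z := by
      rw [laguerreSum, besqMonomial, Polynomial.eval_finsetSum, Finset.mul_sum]
      refine Finset.sum_congr rfl fun k hk => ?_
      have hkm : k ≤ m := Nat.lt_succ_iff.1 (Finset.mem_range.1 hk)
      rw [Polynomial.eval_monomial, div_pow, ← Nat.sub_add_cancel hkm, pow_add,
        Nat.sub_add_cancel hkm]
      push_cast
      field_simp
    rw [hcb, ← hlag, one_div_one_div, Complex.ofReal_mul]
    rw [one_div_one_div] at hpow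
    have hpow' : (((2 * t) ^ (-(ν + 1)) : ℝ) : ℂ) * (((2 * t) ^ (ν + 1) : ℝ) : ℂ) = 1 := by
      rw [← Complex.ofReal_mul, hpow, Complex.ofReal_one]
    have hexp : Complex.exp (-(z / (2 * t))) * Complex.exp (z / (2 * t)) = 1 := by
      rw [← Complex.exp_add]
      simp
    linear_combination (c * (((2 * t) ^ m : ℝ) : ℂ) * laguerreSum ν m (z / (2 * t))) *
      (Complex.exp (-(z / (2 * t))) * Complex.exp (z / (2 * t)) * hpow' + hexp)

/-- The Chapman–Kolmogorov equation. -/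
lemma integral_besqEntire_mul_besqEntire {ν s t w : ℝ} (hν : -1 < ν) (hs : 0 < s) (ht : 0 < t)
    (z : ℂ) : ∫ y in Ioi (0 : ℝ), besqEntire ν t w y * besqEntire ν s y z =
      besqEntire ν (s + t) w z := by
  have hst : 0 < s + t := by positivity
  have hs0 : (s : ℂ) ≠ 0 := by exact_mod_cast hs.ne'
  have ht0 : (t : ℂ) ≠ 0 := by exact_mod_cast ht.ne'
  have hst0 : (s : ℂ) + t ≠ 0 := by exact_mod_cast hst.ne'
  -- `b = 1 / (2 s) + 1 / (2 t)` is the joint exponential rate in the intermediate variable, and the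
  -- product becomes Weber's integral.
  set b : ℝ := (s + t) / (2 * s * t) with hbdef
  have hb : 0 < b := by positivity
  have h := integral_besselE_mul_besselE hν hb (w / (4 * t ^ 2)) (z / (4 * s ^ 2))
  have hintg : ∫ y in Ioi (0 : ℝ), besqEntire ν t w y * besqEntire ν s y z =
      ((w ^ ν * (2 * t) ^ (-(ν + 1)) * (2 * s) ^ (-(ν + 1)) : ℝ) : ℂ) *
        Complex.exp (-(w / (2 * t)) + -(z / (2 * s))) *
      ∫ y in Ioi (0 : ℝ), ((y ^ ν * Real.exp (-(b * y)) : ℝ) : ℂ) *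
        (besselE ν (w / (4 * t ^ 2) * y) * besselE ν (z / (4 * s ^ 2) * y)) := by
    rw [← integral_const_mul]
    refine integral_congr_ae (Eventually.of_forall fun y => ?_)
    simp only [besqEntire]
    have e1 : Complex.exp (-((w : ℂ) + y) / (2 * t)) * Complex.exp (-((y : ℂ) + z) / (2 * s)) =
        Complex.exp (-(w / (2 * t)) + -(z / (2 * s))) * Complex.exp (-(b * y)) := by
      rw [← Complex.exp_add, ← Complex.exp_add, hbdef]
      congr 1
      push_cast
      field_simp
      ring
    rw [show (w : ℂ) * y / (4 * t ^ 2) = w / (4 * t ^ 2) * y by ring,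
      show (y : ℂ) * z / (4 * s ^ 2) = z / (4 * s ^ 2) * y by ring]
    push_cast
    linear_combination ((w ^ ν : ℝ) : ℂ) * (((2 * t) ^ (-(ν + 1)) : ℝ) : ℂ) *
      (((2 * s) ^ (-(ν + 1)) : ℝ) : ℂ) * ((y ^ ν : ℝ) : ℂ) *
      besselE ν (w / (4 * t ^ 2) * y) * besselE ν (z / (4 * s ^ 2) * y) * e1
  rw [hintg, h, besqEntire]
  have hpow : (2 * t) ^ (-(ν + 1)) * (2 * s) ^ (-(ν + 1)) * (1 / b) ^ (ν + 1) =
      (2 * (s + t)) ^ (-(ν + 1)) := by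
    rw [← Real.mul_rpow (by positivity) (by positivity), one_div, Real.inv_rpow hb.le,
      ← Real.rpow_neg hb.le, ← Real.mul_rpow (by positivity) hb.le]
    congr 1
    rw [hbdef]
    field_simp
  have harg : (w / (4 * (t : ℂ) ^ 2)) * (z / (4 * s ^ 2)) / (b : ℂ) ^ 2 =
      w * z / (4 * ((s + t : ℝ) : ℂ) ^ 2) := by
    rw [hbdef]
    push_cast
    field_simp
    ring
  have hexp : Complex.exp (-(w / (2 * t)) + -(z / (2 * s))) *
      Complex.exp ((w / (4 * (t : ℂ) ^ 2) + z / (4 * s ^ 2)) / b) =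
      Complex.exp (-((w : ℂ) + z) / (2 * ((s + t : ℝ) : ℂ))) := by
    rw [← Complex.exp_add, hbdef]
    congr 1
    push_cast
    field_simp
    ring
  rw [harg, ← hexp, ← hpow]
  push_cast
  ring

/-! ## Contour integrals of functions with finitely many poles -/

lemma IsClosedCurve.intervalIntegrable {γ : ℝ → ℂ} (hγ : IsClosedCurve γ) {g : ℂ → ℂ}
    (hg : ContinuousOn (fun u => g (γ u)) (Icc 0 (2 * Real.pi))) :
    IntervalIntegrable (fun u => deriv γ u * g (γ u)) volume 0 (2 * Real.pi) :=
  hγ.integrable.mul_continuousOn (by rwa [uIcc_of_le (by positivity)])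

lemma contourIntegral_congr {γ : ℝ → ℂ} {g h : ℂ → ℂ}
    (hgh : ∀ u ∈ Icc 0 (2 * Real.pi), g (γ u) = h (γ u)) :
    contourIntegral γ g = contourIntegral γ h :=
  intervalIntegral.integral_congr fun u hu => by
    rw [uIcc_of_le (by positivity)] at hu
    simp only [hgh u hu]

lemma contourIntegral_const_mul (γ : ℝ → ℂ) (c : ℂ) (g : ℂ → ℂ) :
    contourIntegral γ (fun z => c * g z) = c * contourIntegral γ g := by
  unfold contourIntegral
  rw [← intervalIntegral.integral_const_mul]
  refine intervalIntegral.integral_congr fun u _ => ?_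
  simp only
  ring

lemma IsClosedCurve.contourIntegral_add {γ : ℝ → ℂ} (hγ : IsClosedCurve γ) {g h : ℂ → ℂ}
    (hg : ContinuousOn (fun u => g (γ u)) (Icc 0 (2 * Real.pi)))
    (hh : ContinuousOn (fun u => h (γ u)) (Icc 0 (2 * Real.pi))) :
    contourIntegral γ (fun z => g z + h z) = contourIntegral γ g + contourIntegral γ h := by
  unfold contourIntegral
  rw [← intervalIntegral.integral_add (hγ.intervalIntegrable hg) (hγ.intervalIntegrable hh)]
  refine intervalIntegral.integral_congr fun u _ => ?_
  simp only
  ring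

lemma IsClosedCurve.contourIntegral_mul_add_mul {γ : ℝ → ℂ} (hγ : IsClosedCurve γ) (c d : ℂ)
    {g h : ℂ → ℂ} (hg : ContinuousOn (fun u => g (γ u)) (Icc 0 (2 * Real.pi)))
    (hh : ContinuousOn (fun u => h (γ u)) (Icc 0 (2 * Real.pi))) :
    contourIntegral γ (fun z => c * g z + d * h z) =
      c * contourIntegral γ g + d * contourIntegral γ h := by
  rw [hγ.contourIntegral_add (g := fun z => c * g z) (h := fun z => d * h z)
    (continuousOn_const.mul hg) (continuousOn_const.mul hh), contourIntegral_const_mul,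
    contourIntegral_const_mul]

lemma IsClosedCurve.contourIntegral_sum {γ : ℝ → ℂ} (hγ : IsClosedCurve γ) {ι : Type*}
    (s : Finset ι) {g : ι → ℂ → ℂ}
    (hg : ∀ i ∈ s, ContinuousOn (fun u => g i (γ u)) (Icc 0 (2 * Real.pi))) :
    contourIntegral γ (fun z => ∑ i ∈ s, g i z) = ∑ i ∈ s, contourIntegral γ (g i) := by
  unfold contourIntegral
  rw [← intervalIntegral.integral_finsetSum fun i hi => hγ.intervalIntegrable (hg i hi)]
  refine intervalIntegral.integral_congr fun u _ => ?_
  simp only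
  rw [Finset.mul_sum]

lemma IsClosedCurve.contourIntegral_eq_zero {γ : ℝ → ℂ} (hγ : IsClosedCurve γ) {g G : ℂ → ℂ}
    (hg : ContinuousOn (fun u => g (γ u)) (Icc 0 (2 * Real.pi)))
    (hG : ∀ u ∈ Icc 0 (2 * Real.pi), HasDerivAt G (g (γ u)) (γ u)) :
    contourIntegral γ g = 0 := by
  obtain ⟨S, hS⟩ := hγ.piecewise
  have h := integral_eq_of_hasDerivAt_off_countable_of_le (fun u => G (γ u))
    (fun u => deriv γ u * g (γ u)) (a := 0) (b := 2 * Real.pi) (by positivity)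
    (s := (S : Set ℝ)) S.countable_toSet ?_ ?_ (hγ.intervalIntegrable hg)
  · rw [contourIntegral, h, ← hγ.closed, sub_self]
  · intro u hu
    exact ContinuousAt.comp_continuousWithinAt (hG u hu).continuousAt (hγ.continuousOn u hu)
  · rintro u ⟨hu, huS⟩
    have h1 := (hS u hu huS).1.hasDerivAt
    have h2 := (hG u (Ioo_subset_Icc_self hu)).comp u h1
    rwa [mul_comm] at h2

lemma IsClosedCurve.contourIntegral_entire {γ : ℝ → ℂ} (hγ : IsClosedCurve γ) {g : ℂ → ℂ}
    (hg : Differentiable ℂ g) : contourIntegral γ g = 0 := by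
  obtain ⟨G, hG⟩ := Complex.IsConservativeOn.isExactOn_univ hg.continuous
    hg.differentiableOn.isConservativeOn
  exact hγ.contourIntegral_eq_zero (hg.continuous.comp_continuousOn hγ.continuousOn)
    fun u _ => hG _ (mem_univ _)

lemma differentiable_dslope {F : ℂ → ℂ} (hF : Differentiable ℂ F) (c : ℂ) :
    Differentiable ℂ (dslope F c) := by
  rw [← differentiableOn_univ] at hF ⊢
  exact (Complex.differentiableOn_dslope univ_mem).2 hF

/-- Subtracting the polar part leaves `dslope F w`, which is entire and has a primitive. This is
Cauchy's formula with the winding number left unevaluated. -/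
lemma IsClosedCurve.contourIntegral_mul_inv_sub {γ : ℝ → ℂ} (hγ : IsClosedCurve γ) {F : ℂ → ℂ}
    (hF : Differentiable ℂ F) {w : ℂ} (hw : ∀ u ∈ Icc 0 (2 * Real.pi), γ u ≠ w) :
    contourIntegral γ (fun z => F z * (z - w)⁻¹) =
      F w * contourIntegral γ (fun z => (z - w)⁻¹) := by
  have hcont : ContinuousOn (fun u => (γ u - w)⁻¹) (Icc 0 (2 * Real.pi)) :=
    (hγ.continuousOn.sub continuousOn_const).inv₀ fun u hu => sub_ne_zero.2 (hw u hu)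
  have h1 : contourIntegral γ (fun z => F z * (z - w)⁻¹) =
      contourIntegral γ (fun z => F w * (z - w)⁻¹ + dslope F w z) := by
    refine contourIntegral_congr fun u hu => ?_
    have h := sub_smul_dslope F w (γ u)
    rw [smul_eq_mul] at h
    have h0 : γ u - w ≠ 0 := sub_ne_zero.2 (hw u hu)
    field_simp
    linear_combination -h
  rw [h1, hγ.contourIntegral_add (g := fun z => F w * (z - w)⁻¹) (continuousOn_const.mul hcont)
    ((differentiable_dslope hF w).continuous.comp_continuousOn hγ.continuousOn),
    contourIntegral_const_mul, hγ.contourIntegral_entire (differentiable_dslope hF w), add_zero]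

/-! ### Residues at several, possibly coincident, poles -/

section Poles

variable {γ : ℝ → ℂ} {ι : Type*} {b : ι → ℂ}

lemma continuousOn_prod_inv (hγ : IsClosedCurve γ) {S : Finset ι}
    (hb : ∀ u ∈ Icc 0 (2 * Real.pi), ∀ i ∈ S, γ u ≠ b i) :
    ContinuousOn (fun u => ∏ i ∈ S, (γ u - b i)⁻¹) (Icc 0 (2 * Real.pi)) :=
  continuousOn_finsetProd _ fun i hi =>
    (hγ.continuousOn.sub continuousOn_const).inv₀ fun u hu => sub_ne_zero.2 (hb u hu i hi)

/-- With at least two factors the integrand decays like `z⁻²` at infinity and all its poles are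
encircled once, so the residues add up to zero. The proof avoids residues: two distinct poles are
separated by partial fractions, which lowers the number of factors, and if all poles coincide there
is a primitive. -/
lemma contourIntegral_prod_inv_eq_zero [DecidableEq ι] (hγ : IsClosedCurve γ) (n : ℕ) :
    ∀ S : Finset ι, S.card = n + 2 → (∀ u ∈ Icc 0 (2 * Real.pi), ∀ i ∈ S, γ u ≠ b i) →
    (∀ i ∈ S, windingNumber γ (b i) = 1) →
    contourIntegral γ (fun z => ∏ i ∈ S, (z - b i)⁻¹) = 0 := by
  have hpi : (2 * Real.pi * Complex.I : ℂ) ≠ 0 := by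
    simp [Real.pi_ne_zero]
  induction n with
  | zero | succ n ih =>
    all_goals
    intro S hS hb hw
    by_cases hall : ∀ i ∈ S, ∀ j ∈ S, b i = b j
    · obtain ⟨i₀, hi₀⟩ : S.Nonempty := Finset.card_pos.1 (by omega)
      have h1 : contourIntegral γ (fun z => ∏ i ∈ S, (z - b i)⁻¹) =
          contourIntegral γ (fun z => (z - b i₀) ^ (-(S.card : ℤ))) := by
        refine contourIntegral_congr fun u _ => ?_
        rw [Finset.prod_congr rfl fun i hi => by rw [hall i hi i₀ hi₀], Finset.prod_const,
          zpow_neg, zpow_natCast, inv_pow]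
      rw [h1]
      have hne : (-(S.card : ℤ) + 1 : ℂ) ≠ 0 := by
        rw [hS]
        push_cast
        intro h
        have := congrArg Complex.re h
        simp at this
        linarith
      refine hγ.contourIntegral_eq_zero
        (G := fun z => (-(S.card : ℤ) + 1 : ℂ)⁻¹ * (z - b i₀) ^ (-(S.card : ℤ) + 1)) ?_ ?_
      · refine ContinuousOn.zpow₀ (hγ.continuousOn.sub continuousOn_const) _ fun u hu =>
          Or.inl (sub_ne_zero.2 (hb u hu i₀ hi₀))
      · intro u hu
        have h0 : γ u - b i₀ ≠ 0 := sub_ne_zero.2 (hb u hu i₀ hi₀)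
        have h2 := (((hasDerivAt_zpow (-(S.card : ℤ) + 1) _ (Or.inl h0)).comp (γ u)
          ((hasDerivAt_id (γ u)).sub_const (b i₀)))).const_mul (-(S.card : ℤ) + 1 : ℂ)⁻¹
        convert! h2 using 1
        push_cast at hne ⊢
        rw [add_sub_cancel_right, mul_one, ← mul_assoc, inv_mul_cancel₀ hne, one_mul]
    · push Not at hall
      obtain ⟨i, hi, j, hj, hij⟩ := hall
      have hij' : i ≠ j := fun h => hij (by rw [h])
      have hsub : b i - b j ≠ 0 := sub_ne_zero.2 hij
      set Ti := S.erase j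
      set Tj := S.erase i
      have hTi : ∀ u ∈ Icc 0 (2 * Real.pi), ∀ k ∈ Ti, γ u ≠ b k :=
        fun u hu k hk => hb u hu k (Finset.mem_of_mem_erase hk)
      have hTj : ∀ u ∈ Icc 0 (2 * Real.pi), ∀ k ∈ Tj, γ u ≠ b k :=
        fun u hu k hk => hb u hu k (Finset.mem_of_mem_erase hk)
      have h1 : contourIntegral γ (fun z => ∏ k ∈ S, (z - b k)⁻¹) = contourIntegral γ
          (fun z => (b i - b j)⁻¹ * ∏ k ∈ Ti, (z - b k)⁻¹ +
            (-(b i - b j)⁻¹) * ∏ k ∈ Tj, (z - b k)⁻¹) := by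
        refine contourIntegral_congr fun u hu => ?_
        have hui : γ u - b i ≠ 0 := sub_ne_zero.2 (hb u hu i hi)
        have huj : γ u - b j ≠ 0 := sub_ne_zero.2 (hb u hu j hj)
        rw [← Finset.mul_prod_erase S _ hi,
          ← Finset.mul_prod_erase Tj _ (Finset.mem_erase.2 ⟨hij'.symm, hj⟩),
          ← Finset.mul_prod_erase Ti _ (Finset.mem_erase.2 ⟨hij', hi⟩),
          show Ti.erase i = Tj.erase j from Finset.erase_right_comm]
        field_simp
        ring
      rw [h1, hγ.contourIntegral_mul_add_mul _ _ (continuousOn_prod_inv hγ hTi)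
        (continuousOn_prod_inv hγ hTj)]
      have hci : Ti.card = S.card - 1 := Finset.card_erase_of_mem hj
      have hcj : Tj.card = S.card - 1 := Finset.card_erase_of_mem hi
      -- The first alternative is the inductive step. The second is the case of two poles, where the
      -- two integrals with one pole equal `2 π i` and cancel.
      first
        | rw [ih Ti (by omega) hTi fun k hk => hw k (Finset.mem_of_mem_erase hk),
            ih Tj (by omega) hTj fun k hk => hw k (Finset.mem_of_mem_erase hk)]
          simp
        | have e1 : ∀ T ⊆ S, T.card = 1 →
              contourIntegral γ (fun z => ∏ k ∈ T, (z - b k)⁻¹) = 2 * Real.pi * Complex.I := by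
            intro T hTS hT
            obtain ⟨k, rfl⟩ := Finset.card_eq_one.1 hT
            have hk := hw k (hTS (Finset.mem_singleton_self k))
            rw [windingNumber, inv_mul_eq_iff_eq_mul₀ hpi, mul_one] at hk
            rw [← hk]
            simp
          rw [e1 Ti (Finset.erase_subset _ _) (by omega), e1 Tj (Finset.erase_subset _ _) (by omega)]
          ring

/-- The residues at the encircled points sum to minus the residue at the outer point `w`.
Algebraically, `(w - z)⁻¹ (z - b)⁻¹ = (w - b)⁻¹ ((w - z)⁻¹ + (z - b)⁻¹)` strips one factor at a
time, and the term without `w` vanishes as soon as it has two poles. -/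
lemma contourIntegral_inv_sub_mul_prod_inv [DecidableEq ι] (hγ : IsClosedCurve γ) {w : ℂ}
    (hwo : ∀ u ∈ Icc 0 (2 * Real.pi), γ u ≠ w) (hw0 : windingNumber γ w = 0) (S : Finset ι)
    (hS : S.Nonempty) (hb : ∀ u ∈ Icc 0 (2 * Real.pi), ∀ i ∈ S, γ u ≠ b i)
    (hw : ∀ i ∈ S, windingNumber γ (b i) = 1) :
    contourIntegral γ (fun z => (w - z)⁻¹ * ∏ i ∈ S, (z - b i)⁻¹) =
      2 * Real.pi * Complex.I * ∏ i ∈ S, (w - b i)⁻¹ := by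
  have hpi : (2 * Real.pi * Complex.I : ℂ) ≠ 0 := by
    simp [Real.pi_ne_zero]
  have hcw : ContinuousOn (fun u => (w - γ u)⁻¹) (Icc 0 (2 * Real.pi)) :=
    (continuousOn_const.sub hγ.continuousOn).inv₀ fun u hu => sub_ne_zero.2 (hwo u hu).symm
  have hone : ∀ k ∈ S, contourIntegral γ (fun z => (z - b k)⁻¹) = 2 * Real.pi * Complex.I := by
    intro k hk
    have h := hw k hk
    rwa [windingNumber, inv_mul_eq_iff_eq_mul₀ hpi, mul_one] at h
  have hzero : contourIntegral γ (fun z => (w - z)⁻¹) = 0 := by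
    rw [windingNumber, mul_eq_zero, or_iff_right (inv_ne_zero hpi)] at hw0
    rw [← neg_eq_zero, ← hw0, ← neg_one_mul, ← contourIntegral_const_mul]
    refine contourIntegral_congr fun u _ => ?_
    rw [neg_one_mul, ← inv_neg, neg_sub]
  induction hS using Finset.Nonempty.cons_induction with
  | singleton i =>
    simp only [Finset.prod_singleton]
    -- The winding numbers about `w` and `b i` are `0` and `1`, so the points differ.
    have hwi : w - b i ≠ 0 := by
      intro h
      rw [sub_eq_zero.1 h, hw i (by simp)] at hw0
      exact one_ne_zero hw0
    have h1 : contourIntegral γ (fun z => (w - z)⁻¹ * (z - b i)⁻¹) = contourIntegral γ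
        (fun z => (w - b i)⁻¹ * (w - z)⁻¹ + (w - b i)⁻¹ * (z - b i)⁻¹) := by
      refine contourIntegral_congr fun u hu => ?_
      have hui : γ u - b i ≠ 0 := sub_ne_zero.2 (hb u hu i (by simp))
      have huw : w - γ u ≠ 0 := sub_ne_zero.2 (hwo u hu).symm
      field_simp
      ring
    have hci : ContinuousOn (fun u => (γ u - b i)⁻¹) (Icc 0 (2 * Real.pi)) :=
      (hγ.continuousOn.sub continuousOn_const).inv₀
        fun u hu => sub_ne_zero.2 (hb u hu i (by simp))
    rw [h1, hγ.contourIntegral_mul_add_mul _ _ hcw hci, hzero, hone i (by simp)]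
    ring
  | cons i S hi hS ih =>
    have hwi : w - b i ≠ 0 := by
      intro h
      rw [sub_eq_zero.1 h, hw i (by simp)] at hw0
      exact one_ne_zero hw0
    have hbS : ∀ u ∈ Icc 0 (2 * Real.pi), ∀ k ∈ S, γ u ≠ b k :=
      fun u hu k hk => hb u hu k (Finset.mem_cons_of_mem hk)
    have h1 : contourIntegral γ (fun z => (w - z)⁻¹ * ∏ k ∈ Finset.cons i S hi, (z - b k)⁻¹) =
        contourIntegral γ (fun z => (w - b i)⁻¹ * ((w - z)⁻¹ * ∏ k ∈ S, (z - b k)⁻¹) +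
          (w - b i)⁻¹ * ∏ k ∈ Finset.cons i S hi, (z - b k)⁻¹) := by
      refine contourIntegral_congr fun u hu => ?_
      have hui : γ u - b i ≠ 0 := sub_ne_zero.2 (hb u hu i (by simp))
      have huw : w - γ u ≠ 0 := sub_ne_zero.2 (hwo u hu).symm
      rw [Finset.prod_cons]
      field_simp
      ring
    have hcard : (Finset.cons i S hi).card = (S.card - 1) + 2 := by
      have := Finset.card_pos.2 hS
      rw [Finset.card_cons]
      omega
    rw [h1, hγ.contourIntegral_mul_add_mul _ _ (g := fun z => (w - z)⁻¹ * ∏ k ∈ S, (z - b k)⁻¹)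
      (hcw.mul (continuousOn_prod_inv hγ hbS)) (continuousOn_prod_inv hγ hb),
      ih hbS (fun k hk => hw k (Finset.mem_cons_of_mem hk))
        (fun k hk => hone k (Finset.mem_cons_of_mem hk)),
      contourIntegral_prod_inv_eq_zero hγ _ _ hcard hb hw, Finset.prod_cons]
    ring

end Poles

/-! ## Divided differences and Newton interpolation -/

/-- The remainder factors of Newton interpolation at the nodes `b 0, b 1, …`. -/
def newtonRem (F : ℂ → ℂ) (b : ℕ → ℂ) : ℕ → ℂ → ℂ
  | 0 => F
  | k + 1 => dslope (newtonRem F b k) (b k)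

/-- The divided difference of `F` at `b 0, …, b k`, with confluent nodes allowed. -/
def dividedDiff (F : ℂ → ℂ) (b : ℕ → ℂ) (k : ℕ) : ℂ := newtonRem F b k (b k)

lemma differentiable_newtonRem {F : ℂ → ℂ} (hF : Differentiable ℂ F) (b : ℕ → ℂ) (k : ℕ) :
    Differentiable ℂ (newtonRem F b k) := by
  induction k with
  | zero => exact hF
  | succ k ih => exact differentiable_dslope ih _

/-- Repeated use of `F z = F c + (z - c) dslope F c z`. The identity is exact, remainder included,
and needs no distinctness of the nodes. -/
lemma newton_expansion (F : ℂ → ℂ) (b : ℕ → ℂ) (n : ℕ) (z : ℂ) :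
    F z = ∑ k ∈ Finset.range n, dividedDiff F b k * ∏ j ∈ Finset.range k, (z - b j) +
      newtonRem F b n z * ∏ j ∈ Finset.range n, (z - b j) := by
  induction n with
  | zero => simp [newtonRem]
  | succ n ih =>
    have h := sub_smul_dslope (newtonRem F b n) (b n) z
    rw [smul_eq_mul] at h
    rw [Finset.sum_range_succ, Finset.prod_range_succ, add_assoc, dividedDiff,
      show newtonRem F b (n + 1) z = dslope (newtonRem F b n) (b n) z from rfl]
    conv_lhs => rw [ih]
    linear_combination (-∏ j ∈ Finset.range n, (z - b j)) * h

lemma prod_range_mul_prod_inv {b : ℕ → ℂ} {k n : ℕ} (hkn : k ≤ n) {z : ℂ}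
    (hz : ∀ j < n, z ≠ b j) :
    (∏ j ∈ Finset.range k, (z - b j)) * ∏ j ∈ Finset.range n, (z - b j)⁻¹ =
      ∏ j ∈ Finset.Ico k n, (z - b j)⁻¹ := by
  rw [← Finset.prod_range_mul_prod_Ico _ hkn, ← mul_assoc, ← Finset.prod_mul_distrib,
    Finset.prod_congr rfl fun j hj => mul_inv_cancel₀ (sub_ne_zero.2
      (hz j ((Finset.mem_range.1 hj).trans_le hkn))), Finset.prod_const_one, one_mul]

/-- Cauchy's formula for divided differences. -/
lemma contourIntegral_eq_dividedDiff {γ : ℝ → ℂ} (hγ : IsClosedCurve γ) {F : ℂ → ℂ}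
    (hF : Differentiable ℂ F) {b : ℕ → ℂ} (n : ℕ)
    (hb : ∀ u ∈ Icc 0 (2 * Real.pi), ∀ j < n + 1, γ u ≠ b j)
    (hw : ∀ j < n + 1, windingNumber γ (b j) = 1) :
    contourIntegral γ (fun z => F z * ∏ j ∈ Finset.range (n + 1), (z - b j)⁻¹) =
      2 * Real.pi * Complex.I * dividedDiff F b n := by
  have hpi : (2 * Real.pi * Complex.I : ℂ) ≠ 0 := by
    simp [Real.pi_ne_zero]
  have hIco : ∀ k, ∀ u ∈ Icc 0 (2 * Real.pi), ∀ j ∈ Finset.Ico k (n + 1), γ u ≠ b j :=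
    fun k u hu j hj => hb u hu j (Finset.mem_Ico.1 hj).2
  -- After division by the nodal product every term with `k < n` keeps at least two poles and
  -- integrates to zero; only the simple pole under the remainder at the last node survives.
  have h1 : contourIntegral γ (fun z => F z * ∏ j ∈ Finset.range (n + 1), (z - b j)⁻¹) =
      contourIntegral γ (fun z => ∑ k ∈ Finset.range n, dividedDiff F b k *
        ∏ j ∈ Finset.Ico k (n + 1), (z - b j)⁻¹ + newtonRem F b n z * (z - b n)⁻¹) := by
    refine contourIntegral_congr fun u hu => ?_
    rw [newton_expansion F b n (γ u), add_mul, Finset.sum_mul]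
    congr 1
    · refine Finset.sum_congr rfl fun k hk => ?_
      rw [mul_assoc, prod_range_mul_prod_inv
        ((Finset.mem_range.1 hk).le.trans n.le_succ) (hb u hu)]
    · rw [mul_assoc, prod_range_mul_prod_inv n.le_succ (hb u hu)]
      simp
  have hcn : ContinuousOn (fun u => newtonRem F b n (γ u) * (γ u - b n)⁻¹)
      (Icc 0 (2 * Real.pi)) :=
    ((differentiable_newtonRem hF b n).continuous.comp_continuousOn hγ.continuousOn).mul
      ((hγ.continuousOn.sub continuousOn_const).inv₀
        fun u hu => sub_ne_zero.2 (hb u hu n n.lt_succ_self))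
  have hck : ∀ k ∈ Finset.range n, ContinuousOn (fun u => dividedDiff F b k *
      ∏ j ∈ Finset.Ico k (n + 1), (γ u - b j)⁻¹) (Icc 0 (2 * Real.pi)) :=
    fun k _ => continuousOn_const.mul (continuousOn_prod_inv hγ (hIco k))
  rw [h1, hγ.contourIntegral_add (continuousOn_finsetSum _ hck) hcn,
    hγ.contourIntegral_sum _ hck, Finset.sum_eq_zero, zero_add,
    hγ.contourIntegral_mul_inv_sub (differentiable_newtonRem hF b n)
      fun u hu => hb u hu n n.lt_succ_self]
  · have h := hw n n.lt_succ_self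
    rw [windingNumber, inv_mul_eq_iff_eq_mul₀ hpi, mul_one] at h
    rw [h, dividedDiff]
    ring
  · intro k hk
    have hk' := Finset.mem_range.1 hk
    rw [contourIntegral_const_mul, contourIntegral_prod_inv_eq_zero hγ (n - 1 - k) _ ?_ (hIco k)
      fun j hj => hw j (Finset.mem_Ico.1 hj).2, mul_zero]
    rw [Nat.card_Ico]
    omega

/-- The contour integral of the Hermite interpolation formula. -/
lemma contourIntegral_eq_newton {γ : ℝ → ℂ} (hγ : IsClosedCurve γ) {F : ℂ → ℂ}
    (hF : Differentiable ℂ F) {b : ℕ → ℂ} (n : ℕ) {w : ℂ}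
    (hb : ∀ u ∈ Icc 0 (2 * Real.pi), ∀ j < n, γ u ≠ b j)
    (hw : ∀ j < n, windingNumber γ (b j) = 1)
    (hwo : ∀ u ∈ Icc 0 (2 * Real.pi), γ u ≠ w) (hw0 : windingNumber γ w = 0) :
    contourIntegral γ (fun z => F z * (w - z)⁻¹ * ∏ j ∈ Finset.range n, (z - b j)⁻¹) *
      ∏ j ∈ Finset.range n, (w - b j) = 2 * Real.pi * Complex.I *
        ∑ k ∈ Finset.range n, dividedDiff F b k * ∏ j ∈ Finset.range k, (w - b j) := by
  have hIco : ∀ k, ∀ u ∈ Icc 0 (2 * Real.pi), ∀ j ∈ Finset.Ico k n, γ u ≠ b j :=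
    fun k u hu j hj => hb u hu j (Finset.mem_Ico.1 hj).2
  have hwb : ∀ j < n, w - b j ≠ 0 := by
    intro j hj h
    rw [sub_eq_zero.1 h, hw j hj] at hw0
    exact one_ne_zero hw0
  -- The remainder term cancels all nodes and keeps a single pole at `w`, which is not encircled;
  -- the other terms are evaluated by the residue at `w`.
  have h1 : contourIntegral γ (fun z => F z * (w - z)⁻¹ * ∏ j ∈ Finset.range n, (z - b j)⁻¹) =
      contourIntegral γ (fun z => ∑ k ∈ Finset.range n, dividedDiff F b k *
        ((w - z)⁻¹ * ∏ j ∈ Finset.Ico k n, (z - b j)⁻¹) +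
          (-1) * (newtonRem F b n z * (z - w)⁻¹)) := by
    refine contourIntegral_congr fun u hu => ?_
    rw [newton_expansion F b n (γ u), add_mul, add_mul, Finset.sum_mul, Finset.sum_mul]
    congr 1
    · refine Finset.sum_congr rfl fun k hk => ?_
      rw [← prod_range_mul_prod_inv (Finset.mem_range.1 hk).le (hb u hu)]
      ring
    · have h := prod_range_mul_prod_inv le_rfl (hb u hu)
      rw [Finset.Ico_self, Finset.prod_empty] at h
      rw [← neg_sub (γ u) w, inv_neg]
      linear_combination (-newtonRem F b n (γ u) * (γ u - w)⁻¹) * h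
  have hcw : ContinuousOn (fun u => (w - γ u)⁻¹) (Icc 0 (2 * Real.pi)) :=
    (continuousOn_const.sub hγ.continuousOn).inv₀ fun u hu => sub_ne_zero.2 (hwo u hu).symm
  have hcn : ContinuousOn (fun u => (-1) * (newtonRem F b n (γ u) * (γ u - w)⁻¹))
      (Icc 0 (2 * Real.pi)) :=
    continuousOn_const.mul
      (((differentiable_newtonRem hF b n).continuous.comp_continuousOn hγ.continuousOn).mul
      ((hγ.continuousOn.sub continuousOn_const).inv₀ fun u hu => sub_ne_zero.2 (hwo u hu)))
  have hck : ∀ k ∈ Finset.range n, ContinuousOn (fun u => dividedDiff F b k *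
      ((w - γ u)⁻¹ * ∏ j ∈ Finset.Ico k n, (γ u - b j)⁻¹)) (Icc 0 (2 * Real.pi)) :=
    fun k _ => continuousOn_const.mul (hcw.mul (continuousOn_prod_inv hγ (hIco k)))
  have hpi : (2 * Real.pi * Complex.I : ℂ) ≠ 0 := by
    simp [Real.pi_ne_zero]
  have hz : contourIntegral γ (fun z => (z - w)⁻¹) = 0 := by
    rwa [windingNumber, mul_eq_zero, or_iff_right (inv_ne_zero hpi)] at hw0
  rw [h1, hγ.contourIntegral_add (continuousOn_finsetSum _ hck) hcn,
    hγ.contourIntegral_sum _ hck, contourIntegral_const_mul,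
    hγ.contourIntegral_mul_inv_sub (differentiable_newtonRem hF b n) hwo, hz, mul_zero, mul_zero,
    add_zero, Finset.sum_mul, Finset.mul_sum]
  refine Finset.sum_congr rfl fun k hk => ?_
  have hk' := Finset.mem_range.1 hk
  rw [contourIntegral_const_mul, contourIntegral_inv_sub_mul_prod_inv hγ hwo hw0 _
    (Finset.nonempty_Ico.2 hk') (hIco k) fun j hj => hw j (Finset.mem_Ico.1 hj).2,
    ← Finset.prod_range_mul_prod_Ico (fun j => w - b j) hk'.le]
  have h3 : (∏ j ∈ Finset.Ico k n, (w - b j)⁻¹) * ∏ j ∈ Finset.Ico k n, (w - b j) = 1 := by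
    rw [← Finset.prod_mul_distrib]
    exact Finset.prod_eq_one fun j hj => inv_mul_cancel₀ (hwb j (Finset.mem_Ico.1 hj).2)
  linear_combination (dividedDiff F b k * (2 * Real.pi * Complex.I) *
    ∏ j ∈ Finset.range k, (w - b j)) * h3

/-! ## Circles -/

lemma isClosedCurve_circleMap (c : ℂ) (R : ℝ) : IsClosedCurve (circleMap c R) where
  continuousOn := (continuous_circleMap c R).continuousOn
  closed := by simp [circleMap]
  piecewise := ⟨∅, fun u _ _ => ⟨differentiable_circleMap c R u, by
    have : deriv (circleMap c R) = fun u => circleMap 0 R u * Complex.I :=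
      funext fun u => deriv_circleMap c R u
    rw [this]
    exact ((continuous_circleMap 0 R).mul continuous_const).continuousAt⟩⟩
  integrable := by
    have : deriv (circleMap c R) = fun u => circleMap 0 R u * Complex.I :=
      funext fun u => deriv_circleMap c R u
    rw [this]
    exact ((continuous_circleMap 0 R).mul continuous_const).intervalIntegrable _ _

lemma windingNumber_circleMap_of_mem_ball {c w : ℂ} {R : ℝ} (hw : w ∈ Metric.ball c R) :
    windingNumber (circleMap c R) w = 1 := by
  have h := circleIntegral.integral_sub_inv_of_mem_ball hw
  have hpi : (2 * Real.pi * Complex.I : ℂ) ≠ 0 := by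
    simp [Real.pi_ne_zero]
  rw [windingNumber, inv_mul_eq_iff_eq_mul₀ hpi, mul_one, ← h]
  rfl

lemma windingNumber_circleMap_of_notMem {c w : ℂ} {R : ℝ} (hR : 0 ≤ R)
    (hw : w ∉ Metric.closedBall c R) : windingNumber (circleMap c R) w = 0 := by
  have h : (∮ z in C(c, R), (z - w)⁻¹) = 0 := by
    refine Complex.circleIntegral_eq_zero_of_differentiable_on_off_countable hR
      countable_empty ?_ ?_
    · refine (continuousOn_id.sub continuousOn_const).inv₀ fun z hz => ?_
      refine sub_ne_zero.2 fun h => hw ?_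
      rwa [← show z = w from h]
    · intro z hz
      have : z - w ≠ 0 := sub_ne_zero.2 fun h => hw (h ▸ Metric.ball_subset_closedBall hz.1)
      fun_prop (disch := assumption)
  rw [windingNumber, show contourIntegral (circleMap c R) (fun z => (z - w)⁻¹) =
    ∮ z in C(c, R), (z - w)⁻¹ from rfl, h, mul_zero]

/-- Divided differences as integrals over a large circle. -/
lemma dividedDiff_eq_integral {F : ℂ → ℂ} (hF : Differentiable ℂ F) {b : ℕ → ℂ} {n : ℕ} {R : ℝ}
    (hR : 0 < R) (hb : ∀ j < n + 1, ‖b j‖ < R) :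
    dividedDiff F b n = (2 * Real.pi * Complex.I)⁻¹ * ∫ u in (0 : ℝ)..2 * Real.pi,
      deriv (circleMap 0 R) u *
        (F (circleMap 0 R u) * ∏ j ∈ Finset.range (n + 1), (circleMap 0 R u - b j)⁻¹) := by
  have hpi : (2 * Real.pi * Complex.I : ℂ) ≠ 0 := by
    simp [Real.pi_ne_zero]
  have h := contourIntegral_eq_dividedDiff (isClosedCurve_circleMap 0 R) hF n (b := b) ?_ ?_
  · rw [contourIntegral] at h
    rw [h, inv_mul_cancel_left₀ hpi]
  · intro u _ j hj h
    have h1 := hb j hj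
    rw [← h] at h1
    simp [abs_of_pos hR] at h1
  · intro j hj
    exact windingNumber_circleMap_of_mem_ball (by simpa using hb j hj)

lemma exists_encircles {N : ℕ} (a : Fin N → ℝ) (ha0 : ∀ i, 0 ≤ a i) :
    ∃ Γ : ℝ → ℝ → ℂ, ∀ y' < 0, Encircles (Γ y') a y' := by
  obtain ⟨A, hA⟩ := (Set.finite_range a).bddAbove
  set B := max A 1
  have hB : 0 < B := by positivity
  have haB : ∀ i, a i ≤ B := fun i => (hA ⟨i, rfl⟩).trans (le_max_left _ _)
  -- The disc is centred at a bound `B` for the points, and its leftmost point is `y' / 2`; it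
  -- therefore contains `[0, B]` and misses `y'`.
  refine ⟨fun y' => circleMap (B : ℂ) (B + -y' / 2), fun y' hy' => ?_⟩
  have hR : 0 < B + -y' / 2 := by linarith
  have hmem : ∀ i, (a i : ℂ) ∈ Metric.ball (B : ℂ) (B + -y' / 2) := by
    intro i
    rw [Metric.mem_ball, Complex.dist_of_im_eq (by simp), Complex.ofReal_re, Complex.ofReal_re,
      Real.dist_eq, abs_lt]
    constructor <;> linarith [haB i, ha0 i]
  have hnot : (y' : ℂ) ∉ Metric.closedBall (B : ℂ) (B + -y' / 2) := by
    rw [Metric.mem_closedBall, Complex.dist_of_im_eq (by simp), Complex.ofReal_re,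
      Complex.ofReal_re, Real.dist_eq, abs_le]
    rintro ⟨h1, _⟩
    linarith
  have hs : ∀ u, circleMap (B : ℂ) (B + -y' / 2) u ∈ Metric.sphere (B : ℂ) (B + -y' / 2) :=
    fun u => circleMap_mem_sphere _ hR.le u
  refine ⟨isClosedCurve_circleMap _ _, fun u _ i h => ?_, fun u _ h => ?_,
    fun i => windingNumber_circleMap_of_mem_ball (hmem i),
    windingNumber_circleMap_of_notMem hR.le hnot⟩
  · have h1 := hmem i
    rw [← h, Metric.mem_ball] at h1
    exact h1.ne (hs u)
  · rw [← h] at hnot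
    exact hnot (Metric.sphere_subset_closedBall (hs u))

/-! ## Bounds for the transition density -/

lemma norm_besqEntire {ν t y : ℝ} (ht : 0 < t) (hy : 0 < y) (z : ℂ) :
    ‖besqEntire ν t y z‖ = y ^ ν * (2 * t) ^ (-(ν + 1)) * Real.exp (-(y + z.re) / (2 * t)) *
      ‖besselE ν (y * z / (4 * t ^ 2))‖ := by
  rw [besqEntire, norm_mul, norm_mul, Complex.norm_of_nonneg (by positivity), Complex.norm_exp]
  congr 3
  rw [show -((y : ℂ) + z) / (2 * t) = ((1 / (2 * t) : ℝ) : ℂ) * (-((y : ℂ) + z)) by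
    push_cast; ring, Complex.re_ofReal_mul]
  simp
  ring

/-- The transition density for `z` in a bounded set. -/
lemma exists_norm_besqEntire_le {ν : ℝ} (hν : -1 < ν) {t : ℝ} (ht : 0 < t) {R : ℝ} (hR : 0 < R)
    {δ : ℝ} (hδ : 0 < δ) : ∃ C > 0, ∀ y > 0, ∀ z : ℂ, ‖z‖ ≤ R →
      ‖besqEntire ν t y z‖ ≤ C * (y ^ ν * Real.exp (-((1 / (2 * t) - δ) * y))) := by
  obtain ⟨C, hC0, hC⟩ := exists_norm_besselE_le hν (one_lt_two)
  refine ⟨(2 * t) ^ (-(ν + 1)) * Real.exp (R / (2 * t)) * (C * Real.exp (2 * (R / (4 * t ^ 2 * δ)))),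
    by positivity, fun y hy z hz => ?_⟩
  -- Putting the small factor `δ` with `y` makes the loss of decay in `y` as small as desired, at
  -- the cost of a constant depending on `R`.
  have hE := hC (δ * y) (R / (4 * t ^ 2 * δ)) (y * z / (4 * t ^ 2)) (by positivity) (by positivity)
    (by
      rw [norm_div, norm_mul, Complex.norm_of_nonneg hy.le, norm_mul, norm_pow,
        Complex.norm_of_nonneg ht.le]
      simp only [Complex.norm_ofNat]
      rw [show δ * y * (R / (4 * t ^ 2 * δ)) = y * R / (4 * t ^ 2) by field_simp]
      gcongr)
  rw [norm_besqEntire ht hy]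
  have h1 : Real.exp (-(y + z.re) / (2 * t)) ≤ Real.exp (-(1 / (2 * t) * y)) *
      Real.exp (R / (2 * t)) := by
    rw [← Real.exp_add, Real.exp_le_exp, show -(1 / (2 * t) * y) + R / (2 * t) =
      (-y + R) / (2 * t) by field_simp; try ring]
    have := (abs_le.1 (Complex.abs_re_le_norm z)).1
    gcongr
    linarith
  calc y ^ ν * (2 * t) ^ (-(ν + 1)) * Real.exp (-(y + z.re) / (2 * t)) *
        ‖besselE ν (y * z / (4 * t ^ 2))‖
      ≤ y ^ ν * (2 * t) ^ (-(ν + 1)) * (Real.exp (-(1 / (2 * t) * y)) * Real.exp (R / (2 * t))) *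
        (C * Real.exp (δ * y + 2 * (R / (4 * t ^ 2 * δ)))) := by gcongr
    _ = _ := by
      rw [show -((1 / (2 * t) - δ) * y) = -(1 / (2 * t) * y) + δ * y by ring, Real.exp_add,
        Real.exp_add (-(1 / (2 * t) * y))]
      ring

/-- The transition density with exponential weights depending on the two times. -/
lemma exists_norm_besqEntire_sub_le {ν : ℝ} (hν : -1 < ν) {s t : ℝ} (ht : 0 < t) (hst : t < s) :
    ∃ ε > 0, ∃ C > 0, ∀ x > 0, ∀ y > 0, ‖besqEntire ν (s - t) x (y : ℝ)‖ ≤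
      C * (x ^ ν * Real.exp (-((1 / (4 * s + 2) + ε) * x)) * Real.exp (1 / (4 * t + 2) * y)) := by
  set τ := s - t with hτ
  have hτ0 : 0 < τ := sub_pos.2 hst
  set u := 2 * t + 1 with hu
  have hu0 : 0 < u := by positivity
  -- With `u = 2 t + 1` one has `u + 2 τ = 2 s + 1`. The comparison constant must exceed `1`, and
  -- must stay below `(u + τ)² / (u (u + 2 τ))` for any decay in `x` to be left over; `κ` is the
  -- midpoint of this interval.
  set κ := (1 + (u + τ) ^ 2 / (u * (u + 2 * τ))) / 2 with hκdef
  have hκ0 : 1 < (u + τ) ^ 2 / (u * (u + 2 * τ)) := by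
    rw [one_lt_div (by positivity)]
    nlinarith
  have hκ : 1 < κ := by linarith
  have hκ' : κ < (u + τ) ^ 2 / (u * (u + 2 * τ)) := by linarith
  obtain ⟨C, hC0, hC⟩ := exists_norm_besselE_le hν hκ
  -- `η` is chosen to make the rate in `y` exactly `1 / (2 u) = 1 / (4 t + 2)`. The upper bound on
  -- `κ` then says that the decay in `x` strictly exceeds `1 / (4 s + 2)`, with margin `ε`.
  set η := κ * u / (u + τ) with hη
  have hη0 : 0 < η := by positivity
  have hη1 : η < (u + τ) / (u + 2 * τ) := by
    rw [lt_div_iff₀ (by positivity)] at hκ'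
    rw [hη, div_lt_div_iff₀ (by positivity) (by positivity)]
    nlinarith
  set ε := ((u + τ) / (u + 2 * τ) - η) / (2 * τ) with hε
  refine ⟨ε, div_pos (sub_pos.2 hη1) (by positivity), (2 * τ) ^ (-(ν + 1)) * C, by positivity,
    fun x hx y hy => ?_⟩
  have hE := hC (η * x / (2 * τ)) (y / (2 * τ * η)) (x * (y : ℝ) / (4 * τ ^ 2)) (by positivity)
    (by positivity) (by
      rw [norm_div, norm_mul, Complex.norm_of_nonneg hx.le, Complex.norm_of_nonneg hy.le, norm_mul,
        norm_pow, Complex.norm_of_nonneg hτ0.le]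
      simp only [Complex.norm_ofNat]
      refine le_of_eq ?_
      field_simp
      ring)
  rw [norm_besqEntire hτ0 hx, Complex.ofReal_re]
  have hexp : -(x + y) / (2 * τ) + (η * x / (2 * τ) + κ * (y / (2 * τ * η))) =
      -((1 / (4 * s + 2) + ε) * x) + 1 / (4 * t + 2) * y := by
    have h1 : 4 * s + 2 = 2 * (u + 2 * τ) := by rw [hu, hτ]; ring
    have h2 : 4 * t + 2 = 2 * u := by rw [hu]; ring
    have h3 : κ / η = (u + τ) / u := by
      have hκpos : κ ≠ 0 := by linarith
      rw [hη]
      field_simp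
    have h4 : κ * (y / (2 * τ * η)) = κ / η * (y / (2 * τ)) := by field_simp
    rw [h4, h3, h1, h2, hε]
    field_simp
    ring
  calc x ^ ν * (2 * τ) ^ (-(ν + 1)) * Real.exp (-(x + y) / (2 * τ)) *
        ‖besselE ν (x * (y : ℝ) / (4 * τ ^ 2))‖
      ≤ x ^ ν * (2 * τ) ^ (-(ν + 1)) * Real.exp (-(x + y) / (2 * τ)) *
        (C * Real.exp (η * x / (2 * τ) + κ * (y / (2 * τ * η)))) := by gcongr
    _ = x ^ ν * (2 * τ) ^ (-(ν + 1)) * C *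
        (Real.exp (-(x + y) / (2 * τ) + (η * x / (2 * τ) + κ * (y / (2 * τ * η))))) := by
      rw [Real.exp_add (-(x + y) / (2 * τ))]
      ring
    _ = _ := by
      rw [hexp, Real.exp_add]
      ring

lemma exists_norm_eval_le (p : Polynomial ℂ) {δ : ℝ} (hδ : 0 < δ) :
    ∃ C > 0, ∀ y > 0, ‖p.eval ((y : ℝ) : ℂ)‖ ≤ C * Real.exp (δ * y) := by
  induction p using Polynomial.induction_on' with
  | add p q hp hq =>
    obtain ⟨C, hC0, hC⟩ := hp
    obtain ⟨D, hD0, hD⟩ := hq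
    refine ⟨C + D, by positivity, fun y hy => ?_⟩
    rw [Polynomial.eval_add, add_mul]
    exact (norm_add_le _ _).trans (add_le_add (hC y hy) (hD y hy))
  | monomial m c =>
    refine ⟨(‖c‖ + 1) * (m ! / δ ^ m), by positivity, fun y hy => ?_⟩
    rw [Polynomial.eval_monomial, norm_mul, norm_pow, Complex.norm_of_nonneg hy.le, mul_assoc]
    have h := Real.pow_div_factorial_le_exp (δ * y) (by positivity) m
    have h2 : y ^ m ≤ m ! / δ ^ m * Real.exp (δ * y) := by
      rw [div_le_iff₀ (by positivity), mul_pow] at h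
      rw [div_mul_eq_mul_div, le_div_iff₀ (by positivity)]
      linarith
    gcongr
    linarith

/-! ## The biorthogonal functions -/

/-- The points of the configuration as a sequence of interpolation nodes. -/
def nodes {N : ℕ} (a : Fin N → ℝ) (k : ℕ) : ℂ := if h : k < N then (a ⟨k, h⟩ : ℂ) else 0

lemma exists_norm_nodes_lt {N : ℕ} (a : Fin N → ℝ) : ∃ R > 0, ∀ k, ‖nodes a k‖ < R := by
  obtain ⟨A, hA⟩ := (Set.finite_range fun i => |a i|).bddAbove
  refine ⟨max A 0 + 1, by positivity, fun k => ?_⟩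
  unfold nodes
  split_ifs with h
  · have : |a ⟨k, h⟩| ≤ A := hA ⟨⟨k, h⟩, rfl⟩
    rw [Complex.norm_real, Real.norm_eq_abs]
    linarith [le_max_left A 0]
  · simp only [norm_zero]
    positivity

open Polynomial in
/-- The Newton polynomials of a sequence of nodes. -/
def newtonPoly (b : ℕ → ℂ) (k : ℕ) : ℂ[X] := ∏ j ∈ Finset.range k, (X - C (b j))

lemma eval_newtonPoly (b : ℕ → ℂ) (k : ℕ) (z : ℂ) :
    (newtonPoly b k).eval z = ∏ j ∈ Finset.range k, (z - b j) := by
  simp [newtonPoly, Polynomial.eval_prod]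

lemma monic_newtonPoly (b : ℕ → ℂ) (k : ℕ) : (newtonPoly b k).Monic :=
  Polynomial.monic_prod_of_monic _ _ fun j _ => Polynomial.monic_X_sub_C (b j)

lemma natDegree_newtonPoly (b : ℕ → ℂ) (k : ℕ) : (newtonPoly b k).natDegree = k := by
  simp [newtonPoly, Polynomial.natDegree_prod_of_monic _ _
    fun j _ => Polynomial.monic_X_sub_C (b j)]

/-- Divided differences of the transition density in the starting point. -/
def besqDivDiff {N : ℕ} (ν : ℝ) (a : Fin N → ℝ) (k : ℕ) (s x : ℝ) : ℂ :=
  dividedDiff (besqEntire ν s x) (nodes a) k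

/-- The Newton polynomials, evolved backwards by time `t`. -/
def besqNewton {N : ℕ} (ν : ℝ) (a : Fin N → ℝ) (k : ℕ) (t : ℝ) : Polynomial ℂ :=
  besqPoly ν (-t) (newtonPoly (nodes a) k)

/-- The correlation kernel in biorthogonal form. -/
def coreKernel {N : ℕ} (ν : ℝ) (a : Fin N → ℝ) (s x t y : ℝ) : ℂ :=
  ∑ k ∈ Finset.range N, besqDivDiff ν a k s x * (besqNewton ν a k t).eval (y : ℂ) -
    if t < s then besqEntire ν (s - t) x y else 0

/-! ### Duality of Newton polynomials and divided differences -/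

lemma dslope_sub_mul {Q : ℂ → ℂ} (hQ : Differentiable ℂ Q) (c : ℂ) :
    dslope (fun z => (z - c) * Q z) c = Q := by
  ext z
  rcases eq_or_ne z c with rfl | hz
  · rw [dslope_same]
    have h := ((hasDerivAt_id z).sub_const z).mul (hQ z).hasDerivAt
    rw [show (fun w => (w - z) * Q w) = (fun w => id w - z) * Q from rfl, h.deriv]
    simp
  · rw [dslope_of_ne _ hz, slope_def_field]
    have : z - c ≠ 0 := sub_ne_zero.2 hz
    simp only [sub_self, zero_mul, sub_zero]
    field_simp

/-- Each Newton step divides out exactly one linear factor, because the polynomial still vanishes at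
the current node. -/
lemma newtonRem_newtonPoly (b : ℕ → ℂ) (j : ℕ) : ∀ k ≤ j,
    newtonRem (fun z => (newtonPoly b j).eval z) b k =
      fun z => ∏ i ∈ Finset.Ico k j, (z - b i) := by
  intro k
  induction k with
  | zero =>
    intro _
    funext z
    simp [newtonRem, eval_newtonPoly]
  | succ k ih =>
    intro hk
    rw [newtonRem, ih (by omega)]
    have : (fun z => ∏ i ∈ Finset.Ico k j, (z - b i)) =
        fun z => (z - b k) * ∏ i ∈ Finset.Ico (k + 1) j, (z - b i) := by
      funext z
      rw [Finset.prod_eq_prod_Ico_succ_bot (by omega)]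
    rw [this, dslope_sub_mul (by fun_prop)]

/-- Before step `j` a factor vanishing at the node remains, at step `j` the constant `1` is left,
and afterwards all slopes are zero. This duality is the source of the biorthogonality. -/
lemma dividedDiff_newtonPoly (b : ℕ → ℂ) (j k : ℕ) :
    dividedDiff (fun z => (newtonPoly b j).eval z) b k = if k = j then 1 else 0 := by
  rcases lt_trichotomy k j with h | h | h
  · rw [dividedDiff, newtonRem_newtonPoly b j k h.le, if_neg h.ne]
    simp only
    exact Finset.prod_eq_zero (Finset.mem_Ico.2 ⟨le_rfl, h⟩) (sub_self _)
  · subst h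
    rw [dividedDiff, newtonRem_newtonPoly b k k le_rfl]
    simp
  · rw [if_neg h.ne', dividedDiff]
    have hz : ∀ l, newtonRem (fun z => (newtonPoly b j).eval z) b (j + 1 + l) = fun _ => 0 := by
      intro l
      induction l with
      | zero =>
        rw [add_zero, newtonRem, newtonRem_newtonPoly b j j le_rfl]
        funext z
        rcases eq_or_ne z (b j) with rfl | hz
        · simp [dslope_same]
        · simp [dslope_of_ne _ hz, slope_def_field]
      | succ l ih =>
        rw [← add_assoc, newtonRem, ih]
        funext z
        rcases eq_or_ne z (b (j + 1 + l)) with h | hz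
        · rw [h]; simp [dslope_same]
        · simp [dslope_of_ne _ hz, slope_def_field]
    obtain ⟨l, rfl⟩ := Nat.exists_eq_add_of_le (show j + 1 ≤ k from h)
    rw [hz]

lemma measurable_besqEntire {Ω : Type*} [MeasurableSpace Ω] {ν : ℝ} (hν : -1 < ν) (t : ℝ)
    {f : Ω → ℝ} {g : Ω → ℂ} (hf : Measurable f) (hg : Measurable g) :
    Measurable fun ω => besqEntire ν t (f ω) (g ω) := by
  have := (continuous_besselE hν).measurable
  unfold besqEntire
  fun_prop

lemma norm_circleMap_zero' {R : ℝ} (hR : 0 < R) (u : ℝ) : ‖circleMap 0 R u‖ = R := by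
  simp [abs_of_pos hR]

lemma continuous_prod_inv_circleMap {R : ℝ} (hR : 0 < R) {b : ℕ → ℂ} (hb : ∀ j, ‖b j‖ < R)
    (n : ℕ) : Continuous fun u => deriv (circleMap 0 R) u *
      ∏ j ∈ Finset.range n, (circleMap 0 R u - b j)⁻¹ := by
  have hd : deriv (circleMap 0 R) = fun u => circleMap 0 R u * Complex.I :=
    funext fun u => deriv_circleMap 0 R u
  rw [hd]
  refine ((continuous_circleMap 0 R).mul continuous_const).mul (continuous_finsetProd _ fun j _ => ?_)
  refine ((continuous_circleMap 0 R).sub continuous_const).inv₀ fun u => sub_ne_zero.2 fun h => ?_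
  have := hb j
  rw [← show circleMap 0 R u = b j from h, norm_circleMap_zero' hR] at this
  exact lt_irrefl _ this

lemma exists_norm_prod_inv_circleMap_le {R : ℝ} (hR : 0 < R) {b : ℕ → ℂ} (hb : ∀ j, ‖b j‖ < R)
    (n : ℕ) : ∃ D > 0, ∀ u ∈ Icc 0 (2 * Real.pi), ‖deriv (circleMap 0 R) u *
      ∏ j ∈ Finset.range n, (circleMap 0 R u - b j)⁻¹‖ ≤ D := by
  obtain ⟨D, hD⟩ := isCompact_Icc.exists_bound_of_continuousOn
    (continuous_prod_inv_circleMap hR hb n).continuousOn (s := Icc 0 (2 * Real.pi))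
  exact ⟨max D 1, by positivity, fun u hu => (hD u hu).trans (le_max_left _ _)⟩

/-- It writes a divided difference as an average of the density itself over a fixed circle. Bounds,
continuity and integral identities pass from `besqEntire` to divided differences through this
formula, also when nodes coincide. -/
lemma besqDivDiff_eq_integral {N : ℕ} {ν : ℝ} (hν : -1 < ν) (a : Fin N → ℝ) (k : ℕ) {R : ℝ}
    (hR : 0 < R) (hb : ∀ j, ‖nodes a j‖ < R) (s x : ℝ) :
    besqDivDiff ν a k s x = (2 * Real.pi * Complex.I)⁻¹ * ∫ u in (0 : ℝ)..2 * Real.pi,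
      (deriv (circleMap 0 R) u * ∏ j ∈ Finset.range (k + 1), (circleMap 0 R u - nodes a j)⁻¹) *
        besqEntire ν s x (circleMap 0 R u) := by
  rw [besqDivDiff, dividedDiff_eq_integral (differentiable_besqEntire hν s x) hR fun j _ => hb j]
  congr 1
  refine intervalIntegral.integral_congr fun u _ => ?_
  ring

lemma exists_norm_besqDivDiff_le {N : ℕ} {ν : ℝ} (hν : -1 < ν) (a : Fin N → ℝ) (k : ℕ) {s : ℝ}
    (hs : 0 < s) {δ : ℝ} (hδ : 0 < δ) : ∃ C > 0, ∀ x > 0, ‖besqDivDiff ν a k s x‖ ≤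
      C * (x ^ ν * Real.exp (-((1 / (2 * s) - δ) * x))) := by
  obtain ⟨R, hR, hb⟩ := exists_norm_nodes_lt a
  obtain ⟨D, hD0, hD⟩ := exists_norm_prod_inv_circleMap_le hR hb (k + 1)
  obtain ⟨C, hC0, hC⟩ := exists_norm_besqEntire_le hν hs hR hδ
  refine ⟨‖(2 * Real.pi * Complex.I : ℂ)⁻¹‖ * (D * C * (2 * Real.pi)), ?_, fun x hx => ?_⟩
  · have : (2 * Real.pi * Complex.I : ℂ) ≠ 0 := by simp [Real.pi_ne_zero]
    have := Real.pi_pos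
    exact mul_pos (norm_pos_iff.2 (inv_ne_zero ‹_›)) (by positivity)
  · rw [besqDivDiff_eq_integral hν a k hR hb, norm_mul, mul_assoc ‖_‖]
    refine mul_le_mul_of_nonneg_left ?_ (norm_nonneg _)
    have h := intervalIntegral.norm_integral_le_of_norm_le_const (a := 0) (b := 2 * Real.pi)
      (C := D * (C * (x ^ ν * Real.exp (-((1 / (2 * s) - δ) * x))))) (f := fun u =>
        (deriv (circleMap 0 R) u * ∏ j ∈ Finset.range (k + 1), (circleMap 0 R u - nodes a j)⁻¹) *
          besqEntire ν s x (circleMap 0 R u)) (fun u hu => by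
        rw [uIoc_of_le (by positivity)] at hu
        rw [norm_mul]
        exact mul_le_mul (hD u (Ioc_subset_Icc_self hu))
          (hC x hx _ (norm_circleMap_zero' hR u).le) (norm_nonneg _) hD0.le)
    refine h.trans (le_of_eq ?_)
    rw [sub_zero, abs_of_pos (by positivity)]
    ring

lemma continuousOn_besqDivDiff {N : ℕ} {ν : ℝ} (hν : -1 < ν) (a : Fin N → ℝ) (k : ℕ) (s : ℝ) :
    ContinuousOn (besqDivDiff ν a k s) (Ioi 0) := by
  obtain ⟨R, hR, hb⟩ := exists_norm_nodes_lt a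
  have hE := continuous_besselE hν
  have hc := continuous_prod_inv_circleMap hR hb (k + 1)
  -- The factor `x ^ ν` is taken out because it alone may fail to be continuous at `0`; the
  -- remaining integral is continuous in every real `x`.
  have h1 : besqDivDiff ν a k s = fun x => ((x ^ ν : ℝ) : ℂ) * ((2 * Real.pi * Complex.I)⁻¹ *
      ∫ u in (0 : ℝ)..2 * Real.pi, (deriv (circleMap 0 R) u *
        ∏ j ∈ Finset.range (k + 1), (circleMap 0 R u - nodes a j)⁻¹) *
        ((((2 * s) ^ (-(ν + 1)) : ℝ) : ℂ) *
        (Complex.exp (-(x + circleMap 0 R u) / (2 * s)) *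
          besselE ν (x * circleMap 0 R u / (4 * s ^ 2))))) := by
    funext x
    rw [besqDivDiff_eq_integral hν a k hR hb, mul_left_comm,
      ← intervalIntegral.integral_const_mul ((x ^ ν : ℝ) : ℂ)]
    congr 1
    refine intervalIntegral.integral_congr fun u _ => ?_
    simp only [besqEntire]
    push_cast
    ring
  rw [h1]
  refine ContinuousOn.mul ?_ (Continuous.continuousOn ?_)
  · exact Complex.continuous_ofReal.comp_continuousOn
      (continuousOn_id.rpow_const fun x hx => Or.inl (ne_of_gt hx))
  · refine continuous_const.mul (intervalIntegral.continuous_parametric_intervalIntegral_of_continuous'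
      ?_ _ _)
    have hcm := continuous_circleMap (0 : ℂ) R
    refine (hc.comp continuous_snd).mul (continuous_const.mul (Continuous.mul ?_ ?_))
    · fun_prop
    · exact hE.comp (by fun_prop)

/-- Integration against divided differences. -/
lemma integral_mul_besqDivDiff {N : ℕ} {ν : ℝ} (hν : -1 < ν) (a : Fin N → ℝ) (k : ℕ) {s : ℝ}
    (hs : 0 < s) {g : ℝ → ℂ} (hg : Measurable g) {C : ℝ}
    (hgC : ∀ y > 0, ‖g y‖ ≤ C * Real.exp (1 / (8 * s) * y))
    {H : ℂ → ℂ} (hH : Differentiable ℂ H)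
    (hgH : ∀ z, ∫ y in Ioi (0 : ℝ), g y * besqEntire ν s y z = H z) :
    ∫ y in Ioi (0 : ℝ), g y * besqDivDiff ν a k s y = dividedDiff H (nodes a) k := by
  obtain ⟨R, hR, hb⟩ := exists_norm_nodes_lt a
  obtain ⟨D, hD0, hD⟩ := exists_norm_prod_inv_circleMap_le hR hb (k + 1)
  obtain ⟨B, hB0, hB⟩ := exists_norm_besqEntire_le hν hs hR (δ := 1 / (8 * s)) (by positivity)
  have hc := continuous_prod_inv_circleMap hR hb (k + 1)
  set c : ℝ → ℂ := fun u => deriv (circleMap 0 R) u *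
    ∏ j ∈ Finset.range (k + 1), (circleMap 0 R u - nodes a j)⁻¹ with hcdef
  have h2pi : (0 : ℝ) ≤ 2 * Real.pi := by positivity
  -- Domination for Fubini: the density decays at rate `1 / (2 s)`, of which `1 / (8 s)` is lost to
  -- the circle and `1 / (8 s)` to the growth of `g`, leaving `1 / (4 s)`.
  have hintg : Integrable (Function.uncurry fun (y u : ℝ) =>
      g y * (c u * besqEntire ν s y (circleMap 0 R u)))
      ((volume.restrict (Ioi 0)).prod (volume.restrict (Ioc 0 (2 * Real.pi)))) := by
    have hconst : Integrable (fun _ : ℝ => C * D * B) (volume.restrict (Ioc 0 (2 * Real.pi))) :=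
      integrableOn_const measure_Ioc_lt_top.ne
    have hdom : Integrable (fun p : ℝ × ℝ =>
        (p.1 ^ ν * p.1 ^ 0 * Real.exp (-(1 / (4 * s) * p.1))) * (C * D * B))
        ((volume.restrict (Ioi 0)).prod (volume.restrict (Ioc 0 (2 * Real.pi)))) :=
      Integrable.mul_prod (f := fun y : ℝ => y ^ ν * y ^ 0 * Real.exp (-(1 / (4 * s) * y)))
        (g := fun _ : ℝ => C * D * B)
        (integrableOn_rpow_mul_pow_mul_exp hν 0 (b := 1 / (4 * s)) (by positivity)) hconst
    refine hdom.mono' ?_ ?_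
    · have h2 := (continuous_circleMap 0 R).measurable
      have h3 : Measurable fun p : ℝ × ℝ => besqEntire ν s p.1 (circleMap 0 R p.2) :=
        measurable_besqEntire hν s measurable_fst (h2.comp measurable_snd)
      exact ((hg.comp measurable_fst).mul
        ((hc.measurable.comp measurable_snd).mul h3)).aestronglyMeasurable
    · rw [Measure.prod_restrict, ae_restrict_iff' (measurableSet_Ioi.prod measurableSet_Ioc)]
      refine Eventually.of_forall fun ⟨y, u⟩ ⟨hy, hu⟩ => ?_
      have hy : 0 < y := hy
      simp only [Function.uncurry_apply_pair]
      have e1 := hgC y hy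
      have e2 := hD u (Ioc_subset_Icc_self hu)
      have e3 := hB y hy _ (norm_circleMap_zero' hR u).le
      have hC0 : 0 ≤ C := by
        have := (norm_nonneg _).trans e1
        exact nonneg_of_mul_nonneg_left this (Real.exp_pos _)
      calc ‖g y * (c u * besqEntire ν s y (circleMap 0 R u))‖
          ≤ (C * Real.exp (1 / (8 * s) * y)) * (D * (B * (y ^ ν *
            Real.exp (-((1 / (2 * s) - 1 / (8 * s)) * y))))) := by
            rw [norm_mul, norm_mul]
            gcongr
        _ = (y ^ ν * (Real.exp (1 / (8 * s) * y) *
            Real.exp (-((1 / (2 * s) - 1 / (8 * s)) * y)))) * (C * D * B) := by ring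
        _ = _ := by
          rw [← Real.exp_add, pow_zero, mul_one]
          congr 3
          field_simp
          ring
  have h1 : ∫ y in Ioi (0 : ℝ), g y * besqDivDiff ν a k s y = (2 * Real.pi * Complex.I)⁻¹ *
      ∫ y in Ioi (0 : ℝ), ∫ u in Ioc 0 (2 * Real.pi),
        g y * (c u * besqEntire ν s y (circleMap 0 R u)) := by
    rw [← integral_const_mul]
    refine integral_congr_ae (Eventually.of_forall fun y => ?_)
    simp only
    rw [besqDivDiff_eq_integral hν a k hR hb, integral_const_mul,
      intervalIntegral.integral_of_le h2pi]
    ring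
  rw [h1, integral_integral_swap hintg, dividedDiff_eq_integral hH hR fun j _ => hb j,
    intervalIntegral.integral_of_le h2pi]
  congr 1
  refine integral_congr_ae (Eventually.of_forall fun u => ?_)
  simp only
  rw [← hgH, mul_comm (∫ y in Ioi (0 : ℝ), _), ← mul_assoc, ← integral_const_mul]
  refine integral_congr_ae (Eventually.of_forall fun y => ?_)
  simp only [hcdef]
  ring

/-! ## Reproducing properties of the kernel -/

/-- Splitting the Bessel argument as `(y / (2 t)) (w / (2 t))` costs exactly `exp (y / (2 t))`,
which the Gaussian-type factor in `y` cancels. -/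
lemma exists_norm_besqEntire_le_const {ν : ℝ} (hν : -1 < ν) {t w : ℝ} (ht : 0 < t) (hw : 0 < w) :
    ∃ C > 0, ∀ y > 0, ‖besqEntire ν t w (y : ℝ)‖ ≤ C := by
  obtain ⟨C, hC0, hC⟩ := exists_norm_besselE_le hν (one_lt_two)
  refine ⟨w ^ ν * (2 * t) ^ (-(ν + 1)) * (C * Real.exp (w / (2 * t))), by positivity,
    fun y hy => ?_⟩
  have hE := hC (y / (2 * t)) (w / (2 * t)) (w * (y : ℝ) / (4 * t ^ 2)) (by positivity)
    (by positivity) (by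
      rw [norm_div, norm_mul, Complex.norm_of_nonneg hw.le, Complex.norm_of_nonneg hy.le, norm_mul,
        norm_pow, Complex.norm_of_nonneg ht.le]
      simp only [Complex.norm_ofNat]
      refine le_of_eq ?_
      field_simp
      ring)
  rw [norm_besqEntire ht hw, Complex.ofReal_re]
  calc w ^ ν * (2 * t) ^ (-(ν + 1)) * Real.exp (-(w + y) / (2 * t)) *
        ‖besselE ν (w * (y : ℝ) / (4 * t ^ 2))‖
      ≤ w ^ ν * (2 * t) ^ (-(ν + 1)) * Real.exp (-(w + y) / (2 * t)) *
        (C * Real.exp (y / (2 * t) + 2 * (w / (2 * t)))) := by gcongr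
    _ = w ^ ν * (2 * t) ^ (-(ν + 1)) * (C * (Real.exp (-(w + y) / (2 * t)) *
        Real.exp (y / (2 * t) + 2 * (w / (2 * t))))) := by ring
    _ = _ := by
      rw [← Real.exp_add]
      congr 4
      field_simp
      ring

lemma one_le_exp_mul {δ y : ℝ} (hδ : 0 < δ) (hy : 0 < y) : 1 ≤ Real.exp (δ * y) :=
  Real.one_le_exp (by positivity)

lemma integrableOn_mul_of_exp_bounds {ν : ℝ} (hν : -1 < ν) {g h : ℝ → ℂ} {δ δ' C D : ℝ}
    (hδ : δ < δ') (hg : Measurable g) (hh : AEStronglyMeasurable h (volume.restrict (Ioi 0)))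
    (hgC : ∀ y > 0, ‖g y‖ ≤ C * Real.exp (δ * y))
    (hhD : ∀ y > 0, ‖h y‖ ≤ D * (y ^ ν * Real.exp (-(δ' * y)))) :
    IntegrableOn (fun y => g y * h y) (Ioi 0) := by
  refine Integrable.mono' ((integrableOn_rpow_mul_pow_mul_exp hν 0 (b := δ' - δ)
    (sub_pos.2 hδ)).const_mul (C * D)) (hg.aestronglyMeasurable.mul hh) ?_
  refine (ae_restrict_iff' measurableSet_Ioi).2 (Eventually.of_forall fun y hy => ?_)
  have hy : 0 < y := hy
  rw [norm_mul]
  have h1 := hgC y hy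
  refine (mul_le_mul h1 (hhD y hy) (norm_nonneg _) ((norm_nonneg _).trans h1)).trans (le_of_eq ?_)
  rw [show -((δ' - δ) * y) = δ * y + -(δ' * y) by ring, Real.exp_add, pow_zero]
  ring

section Kernel

variable {N : ℕ} {ν : ℝ} (a : Fin N → ℝ)

lemma integrableOn_eval_mul_besqDivDiff (hν : -1 < ν) (p : Polynomial ℂ) (k : ℕ) {s : ℝ}
    (hs : 0 < s) :
    IntegrableOn (fun y : ℝ => p.eval (y : ℂ) * besqDivDiff ν a k s y) (Ioi 0) := by
  obtain ⟨C, hC0, hC⟩ := exists_norm_eval_le p (δ := 1 / (8 * s)) (by positivity)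
  obtain ⟨D, hD0, hD⟩ := exists_norm_besqDivDiff_le hν a k hs (δ := 1 / (4 * s)) (by positivity)
  refine integrableOn_mul_of_exp_bounds hν (δ := 1 / (8 * s)) (δ' := 1 / (2 * s) - 1 / (4 * s)) ?_
    (by fun_prop) ((continuousOn_besqDivDiff hν a k s).aestronglyMeasurable measurableSet_Ioi)
    hC hD
  rw [show 1 / (2 * s) - 1 / (4 * s) = 1 / (4 * s) by field_simp; norm_num]
  exact one_div_lt_one_div_of_lt (by positivity) (by linarith)

lemma integral_eval_mul_besqDivDiff (hν : -1 < ν) (p : Polynomial ℂ) (k : ℕ) {s : ℝ}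
    (hs : 0 < s) :
    ∫ y in Ioi (0 : ℝ), p.eval (y : ℂ) * besqDivDiff ν a k s y =
      dividedDiff (fun z => (besqPoly ν s p).eval z) (nodes a) k := by
  obtain ⟨C, hC0, hC⟩ := exists_norm_eval_le p (δ := 1 / (8 * s)) (by positivity)
  exact integral_mul_besqDivDiff hν a k hs (g := fun y : ℝ => p.eval (y : ℂ)) (by fun_prop) hC
    (by fun_prop) fun z => integral_poly_mul_besqEntire hν hs p z

/-- Integrating against the density evolves the polynomial forward by `t` and undoes its backward
evolution; what remains is a divided difference of a Newton polynomial. -/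
lemma integral_besqNewton_mul_besqDivDiff (hν : -1 < ν) (k l : ℕ) {t : ℝ} (ht : 0 < t) :
    ∫ y in Ioi (0 : ℝ), (besqNewton ν a k t).eval (y : ℂ) * besqDivDiff ν a l t y =
      if l = k then 1 else 0 := by
  rw [integral_eval_mul_besqDivDiff a hν _ l ht, besqNewton]
  simp_rw [besqPoly_besqPoly hν, add_neg_cancel, besqPoly_zero hν]
  exact dividedDiff_newtonPoly _ _ _

lemma integral_besqNewton_mul_besqEntire (hν : -1 < ν) (k : ℕ) {r t : ℝ} (htr : t < r) (z : ℂ) :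
    ∫ u in Ioi (0 : ℝ), (besqNewton ν a k r).eval (u : ℂ) * besqEntire ν (r - t) u z =
      (besqNewton ν a k t).eval z := by
  rw [integral_poly_mul_besqEntire hν (sub_pos.2 htr), besqNewton, besqPoly_besqPoly hν, besqNewton]
  congr 3
  ring

lemma integrableOn_besqEntire_mul_besqDivDiff (hν : -1 < ν) (k : ℕ) {s t x : ℝ} (hs : 0 < s)
    (ht : 0 < t) (hx : 0 < x) :
    IntegrableOn (fun y : ℝ => besqEntire ν t x y * besqDivDiff ν a k s y) (Ioi 0) := by
  obtain ⟨C, hC0, hC⟩ := exists_norm_besqEntire_le_const hν ht hx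
  obtain ⟨D, hD0, hD⟩ := exists_norm_besqDivDiff_le hν a k hs (δ := 1 / (4 * s)) (by positivity)
  refine integrableOn_mul_of_exp_bounds hν (δ := 0) (C := C) (δ' := 1 / (2 * s) - 1 / (4 * s)) ?_
    (measurable_besqEntire hν t measurable_const (by fun_prop))
    ((continuousOn_besqDivDiff hν a k s).aestronglyMeasurable measurableSet_Ioi)
    (fun y hy => by simpa using hC y hy) hD
  rw [show 1 / (2 * s) - 1 / (4 * s) = 1 / (4 * s) by field_simp; norm_num]
  positivity

/-- Chapman–Kolmogorov passes through the divided difference, which acts only on the starting point.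
-/
lemma integral_besqEntire_mul_besqDivDiff (hν : -1 < ν) (k : ℕ) {r s x : ℝ} (hr : 0 < r)
    (hrs : r < s) (hx : 0 < x) :
    ∫ u in Ioi (0 : ℝ), besqEntire ν (s - r) x u * besqDivDiff ν a k r u =
      besqDivDiff ν a k s x := by
  have hsr := sub_pos.2 hrs
  obtain ⟨C, hC0, hC⟩ := exists_norm_besqEntire_le_const hν hsr hx
  have h := integral_mul_besqDivDiff hν a k hr (g := fun u : ℝ => besqEntire ν (s - r) x u)
    (measurable_besqEntire hν _ measurable_const (by fun_prop)) (C := C)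
    (fun y hy => (hC y hy).trans
      (le_mul_of_one_le_right hC0.le (one_le_exp_mul (by positivity) hy)))
    (H := besqEntire ν s x) (differentiable_besqEntire hν s x) fun z => by
      rw [integral_besqEntire_mul_besqEntire hν hr hsr, add_sub_cancel]
  rw [h, besqDivDiff]

lemma integrableOn_besqEntire_mul_besqEntire (hν : -1 < ν) {s t x : ℝ} (hs : 0 < s)
    (ht : 0 < t) (hx : 0 < x) (z : ℂ) :
    IntegrableOn (fun y : ℝ => besqEntire ν t x y * besqEntire ν s y z) (Ioi 0) := by
  obtain ⟨C, hC0, hC⟩ := exists_norm_besqEntire_le_const hν ht hx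
  obtain ⟨D, hD0, hD⟩ := exists_norm_besqEntire_le hν hs (R := ‖z‖ + 1) (by positivity)
    (δ := 1 / (4 * s)) (by positivity)
  refine integrableOn_mul_of_exp_bounds hν (δ := 0) (C := C) (δ' := 1 / (2 * s) - 1 / (4 * s)) ?_
    (measurable_besqEntire hν t measurable_const (by fun_prop))
    (measurable_besqEntire hν s measurable_id measurable_const).aestronglyMeasurable
    (fun y hy => by simpa using hC y hy) fun y hy => hD y hy z (by linarith)
  rw [show 1 / (2 * s) - 1 / (4 * s) = 1 / (4 * s) by field_simp; norm_num]
  positivity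

/-- Composition of the kernel with itself at an intermediate time. -/
lemma integral_coreKernel_mul_coreKernel (hν : -1 < ν) {s r t x y : ℝ} (hr : 0 < r)
    (hx : 0 < x) :
    ∫ u in Ioi (0 : ℝ), coreKernel ν a s x r u * coreKernel ν a r u t y =
      (1 - (if r < s then 1 else 0) - (if t < r then 1 else 0)) * coreKernel ν a s x t y := by
  set P : ℝ → ℂ := fun u => if r < s then besqEntire ν (s - r) x u else 0 with hP
  set Q : ℝ → ℂ := fun u => if t < r then besqEntire ν (r - t) u y else 0 with hQ
  set Φ : ℕ → ℝ → ℂ := fun k u => besqDivDiff ν a k r u with hΦ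
  set Ψ : ℕ → ℝ → ℂ := fun k u => (besqNewton ν a k r).eval (u : ℂ) with hΨ
  set Φs : ℕ → ℂ := fun k => besqDivDiff ν a k s x with hΦs
  set Ψt : ℕ → ℂ := fun k => (besqNewton ν a k t).eval (y : ℂ) with hΨt
  have i1 : ∀ k l, IntegrableOn (fun u => Ψ k u * Φ l u) (Ioi 0) :=
    fun k l => integrableOn_eval_mul_besqDivDiff a hν _ l hr
  have v1 : ∀ k l, ∫ u in Ioi (0 : ℝ), Ψ k u * Φ l u = if l = k then 1 else 0 :=
    fun k l => integral_besqNewton_mul_besqDivDiff a hν k l hr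
  have i2 : ∀ k, IntegrableOn (fun u => Ψ k u * Q u) (Ioi 0) := by
    intro k
    simp only [hQ]
    split_ifs with h
    · exact integrableOn_poly_mul_besqEntire hν (sub_pos.2 h) _ _
    · simp
  have v2 : ∀ k, ∫ u in Ioi (0 : ℝ), Ψ k u * Q u = if t < r then Ψt k else 0 := by
    intro k
    simp only [hQ]
    split_ifs with h
    · exact integral_besqNewton_mul_besqEntire a hν k h _
    · simp
  have i3 : ∀ l, IntegrableOn (fun u => P u * Φ l u) (Ioi 0) := by
    intro l
    simp only [hP]
    split_ifs with h
    · exact integrableOn_besqEntire_mul_besqDivDiff a hν l hr (sub_pos.2 h) hx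
    · simp
  have v3 : ∀ l, ∫ u in Ioi (0 : ℝ), P u * Φ l u = if r < s then Φs l else 0 := by
    intro l
    simp only [hP]
    split_ifs with h
    · exact integral_besqEntire_mul_besqDivDiff a hν l hr h hx
    · simp
  have i4 : IntegrableOn (fun u => P u * Q u) (Ioi 0) := by
    simp only [hP, hQ]
    split_ifs with h h'
    · exact integrableOn_besqEntire_mul_besqEntire hν (sub_pos.2 h') (sub_pos.2 h) hx _
    all_goals simp
  have v4 : ∫ u in Ioi (0 : ℝ), P u * Q u =
      if r < s then (if t < r then besqEntire ν (s - t) x y else 0) else 0 := by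
    simp only [hP, hQ]
    split_ifs with h h'
    · rw [integral_besqEntire_mul_besqEntire hν (sub_pos.2 h') (sub_pos.2 h)]
      congr 1
      ring
    all_goals simp
  -- The four products integrate, in turn, by biorthogonality, backward evolution, forward evolution
  -- and Chapman–Kolmogorov.
  have hexp : ∀ u, coreKernel ν a s x r u * coreKernel ν a r u t y =
      (∑ k ∈ Finset.range N, ∑ l ∈ Finset.range N, Φs k * Ψt l * (Ψ k u * Φ l u)) -
        (∑ k ∈ Finset.range N, Φs k * (Ψ k u * Q u)) -
        (∑ l ∈ Finset.range N, Ψt l * (P u * Φ l u)) + P u * Q u := by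
    intro u
    have e1 : coreKernel ν a s x r u = ∑ k ∈ Finset.range N, Φs k * Ψ k u - P u := rfl
    have e2 : coreKernel ν a r u t y = ∑ l ∈ Finset.range N, Φ l u * Ψt l - Q u := rfl
    rw [e1, e2, sub_mul, mul_sub, mul_sub, Finset.sum_mul_sum, Finset.sum_mul, Finset.mul_sum]
    have e3 : ∑ k ∈ Finset.range N, ∑ l ∈ Finset.range N, Φs k * Ψ k u * (Φ l u * Ψt l) =
        ∑ k ∈ Finset.range N, ∑ l ∈ Finset.range N, Φs k * Ψt l * (Ψ k u * Φ l u) :=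
      Finset.sum_congr rfl fun k _ => Finset.sum_congr rfl fun l _ => by ring
    have e4 : ∑ k ∈ Finset.range N, Φs k * Ψ k u * Q u =
        ∑ k ∈ Finset.range N, Φs k * (Ψ k u * Q u) :=
      Finset.sum_congr rfl fun k _ => by ring
    have e5 : ∑ l ∈ Finset.range N, P u * (Φ l u * Ψt l) =
        ∑ l ∈ Finset.range N, Ψt l * (P u * Φ l u) :=
      Finset.sum_congr rfl fun k _ => by ring
    rw [e3, e4, e5]
    ring
  have I1 : IntegrableOn (fun u => ∑ k ∈ Finset.range N, ∑ l ∈ Finset.range N,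
      Φs k * Ψt l * (Ψ k u * Φ l u)) (Ioi 0) :=
    integrable_finsetSum _ fun k _ => integrable_finsetSum _ fun l _ => (i1 k l).const_mul _
  have I2 : IntegrableOn (fun u => ∑ k ∈ Finset.range N, Φs k * (Ψ k u * Q u)) (Ioi 0) :=
    integrable_finsetSum _ fun k _ => (i2 k).const_mul _
  have I3 : IntegrableOn (fun u => ∑ l ∈ Finset.range N, Ψt l * (P u * Φ l u)) (Ioi 0) :=
    integrable_finsetSum _ fun k _ => (i3 k).const_mul _
  have I12 : IntegrableOn (fun u => (∑ k ∈ Finset.range N, ∑ l ∈ Finset.range N,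
      Φs k * Ψt l * (Ψ k u * Φ l u)) - ∑ k ∈ Finset.range N, Φs k * (Ψ k u * Q u)) (Ioi 0) :=
    I1.sub I2
  have I123 : IntegrableOn (fun u => (∑ k ∈ Finset.range N, ∑ l ∈ Finset.range N,
      Φs k * Ψt l * (Ψ k u * Φ l u)) - (∑ k ∈ Finset.range N, Φs k * (Ψ k u * Q u)) -
      ∑ l ∈ Finset.range N, Ψt l * (P u * Φ l u)) (Ioi 0) :=
    I12.sub I3
  simp_rw [hexp]
  rw [integral_add I123 i4, integral_sub I12 I3, integral_sub I1 I2, v4,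
    integral_finsetSum _ fun k _ => integrable_finsetSum _ fun l _ => (i1 k l).const_mul _,
    integral_finsetSum _ fun k _ => (i2 k).const_mul _,
    integral_finsetSum _ fun k _ => (i3 k).const_mul _]
  have s1 : ∑ k ∈ Finset.range N, ∫ u in Ioi (0 : ℝ), ∑ l ∈ Finset.range N,
      Φs k * Ψt l * (Ψ k u * Φ l u) = ∑ k ∈ Finset.range N, Φs k * Ψt k := by
    refine Finset.sum_congr rfl fun k hk => ?_
    rw [integral_finsetSum _ fun l _ => (i1 k l).const_mul _]
    simp_rw [integral_const_mul, v1]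
    simp only [mul_ite, mul_one, mul_zero, Finset.sum_ite_eq', hk, if_true]
  have s2 : ∑ k ∈ Finset.range N, ∫ u in Ioi (0 : ℝ), Φs k * (Ψ k u * Q u) =
      if t < r then ∑ k ∈ Finset.range N, Φs k * Ψt k else 0 := by
    simp_rw [integral_const_mul, v2]
    split_ifs <;> simp
  have s3 : ∑ k ∈ Finset.range N, ∫ u in Ioi (0 : ℝ), Ψt k * (P u * Φ k u) =
      if r < s then ∑ k ∈ Finset.range N, Φs k * Ψt k else 0 := by
    simp_rw [integral_const_mul, v3]
    split_ifs
    · exact Finset.sum_congr rfl fun k _ => mul_comm _ _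
    · simp
  rw [s1, s2, s3, show coreKernel ν a s x t y = ∑ k ∈ Finset.range N, Φs k * Ψt k -
    if t < s then besqEntire ν (s - t) x y else 0 from rfl]
  -- For `t < r < s` the sum is counted with weight `1 - 1 - 1` and the propagator with weight `1`,
  -- giving minus the kernel; with exactly one of the inequalities everything cancels; with neither,
  -- `s ≤ t` and no propagator occurs.
  by_cases h1 : r < s <;> by_cases h2 : t < r
  · rw [if_pos h1, if_pos h2, if_pos h1, if_pos h2, if_pos (h2.trans h1), if_pos h1, if_pos h2]
    ring
  · simp [h1, h2]
  · simp [h1, h2]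
  · have h3 : ¬ t < s := by linarith
    simp [h1, h2, h3]

lemma integral_coreKernel_diag (hν : -1 < ν) {r : ℝ} (hr : 0 < r) :
    ∫ u in Ioi (0 : ℝ), coreKernel ν a r u r u = N := by
  have h : ∀ u : ℝ, coreKernel ν a r u r u = ∑ k ∈ Finset.range N,
      (besqNewton ν a k r).eval (u : ℂ) * besqDivDiff ν a k r u := by
    intro u
    simp only [coreKernel, lt_irrefl, if_false, sub_zero]
    exact Finset.sum_congr rfl fun k _ => mul_comm _ _
  simp_rw [h]
  rw [integral_finsetSum _ fun k _ => integrableOn_eval_mul_besqDivDiff a hν _ k hr]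
  simp_rw [integral_besqNewton_mul_besqDivDiff a hν _ _ hr]
  simp

/-- The weight `exp (x / (4 s + 2))` is a gauge. Its rate is strictly decreasing in time, which
controls the propagator, and lies below the decay rate `1 / (4 s)` available for divided
differences. Along a permutation the gauges cancel, and only an integrable factor with the spare `ε`
remains. -/
lemma exists_norm_coreKernel_le (hν : -1 < ν) {s t : ℝ} (hs : 0 < s) (ht : 0 < t) :
    ∃ ε > 0, ∃ C > 0, ∀ x > 0, ∀ y > 0, ‖coreKernel ν a s x t y‖ ≤
      C * (x ^ ν * Real.exp (-((1 / (4 * s + 2) + ε) * x)) * Real.exp (1 / (4 * t + 2) * y)) := by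
  have hA : ∀ k, ∃ C > 0, ∀ x > 0, ‖besqDivDiff ν a k s x‖ ≤
      C * (x ^ ν * Real.exp (-(1 / (4 * s) * x))) := by
    intro k
    obtain ⟨C, hC0, hC⟩ := exists_norm_besqDivDiff_le hν a k hs (δ := 1 / (4 * s)) (by positivity)
    refine ⟨C, hC0, fun x hx => (hC x hx).trans (le_of_eq ?_)⟩
    rw [show 1 / (2 * s) - 1 / (4 * s) = 1 / (4 * s) by field_simp; norm_num]
  choose A hA0 hA using hA
  have hB : ∀ k, ∃ C > 0, ∀ y > 0, ‖(besqNewton ν a k t).eval ((y : ℝ) : ℂ)‖ ≤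
      C * Real.exp (1 / (4 * t + 2) * y) :=
    fun k => exists_norm_eval_le _ (by positivity)
  choose B hB0 hB using hB
  have hε₁ : 0 < 1 / (4 * s) - 1 / (4 * s + 2) :=
    sub_pos.2 (one_div_lt_one_div_of_lt (by positivity) (by linarith))
  have hP : ∃ ε > 0, ∃ C > 0, ∀ x > 0, ∀ y > 0,
      ‖(if t < s then besqEntire ν (s - t) x (y : ℝ) else 0 : ℂ)‖ ≤ C * (x ^ ν *
        Real.exp (-((1 / (4 * s + 2) + ε) * x)) * Real.exp (1 / (4 * t + 2) * y)) := by
    split_ifs with h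
    · exact exists_norm_besqEntire_sub_le hν ht h
    · refine ⟨1, one_pos, 1, one_pos, fun x hx y hy => ?_⟩
      rw [norm_zero]
      positivity
  obtain ⟨ε₂, hε₂, C, hC0, hC⟩ := hP
  refine ⟨min (1 / (4 * s) - 1 / (4 * s + 2)) ε₂, lt_min hε₁ hε₂,
    ∑ k ∈ Finset.range N, A k * B k + C, ?_, fun x hx y hy => ?_⟩
  · have : 0 ≤ ∑ k ∈ Finset.range N, A k * B k :=
      Finset.sum_nonneg fun k _ => (mul_pos (hA0 k) (hB0 k)).le
    linarith
  · set ε := min (1 / (4 * s) - 1 / (4 * s + 2)) ε₂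
    have h1 : Real.exp (-(1 / (4 * s) * x)) ≤ Real.exp (-((1 / (4 * s + 2) + ε) * x)) := by
      rw [Real.exp_le_exp, neg_le_neg_iff]
      have : ε ≤ 1 / (4 * s) - 1 / (4 * s + 2) := min_le_left _ _
      gcongr
      linarith
    have h2 : Real.exp (-((1 / (4 * s + 2) + ε₂) * x)) ≤
        Real.exp (-((1 / (4 * s + 2) + ε) * x)) := by
      rw [Real.exp_le_exp, neg_le_neg_iff]
      have : ε ≤ ε₂ := min_le_right _ _
      gcongr
    rw [coreKernel, add_mul]
    refine (norm_sub_le _ _).trans (add_le_add ?_ ?_)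
    · refine (norm_sum_le _ _).trans ?_
      rw [Finset.sum_mul]
      refine Finset.sum_le_sum fun k _ => ?_
      rw [norm_mul]
      have e1 := hA k x hx
      have e2 := hB k y hy
      have := hA0 k
      have := hB0 k
      calc ‖besqDivDiff ν a k s x‖ * ‖(besqNewton ν a k t).eval ((y : ℝ) : ℂ)‖
          ≤ (A k * (x ^ ν * Real.exp (-((1 / (4 * s + 2) + ε) * x)))) *
            (B k * Real.exp (1 / (4 * t + 2) * y)) := by
            gcongr
            exact e1.trans (by gcongr)
        _ = _ := by ring
    · refine (hC x hx y hy).trans ?_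
      gcongr

lemma continuousOn_besqEntire (hν : -1 < ν) (t : ℝ) :
    ContinuousOn (fun p : ℝ × ℝ => besqEntire ν t p.1 (p.2 : ℂ)) (Ioi 0 ×ˢ Ioi 0) := by
  have hE := continuous_besselE hν
  unfold besqEntire
  refine ContinuousOn.mul (ContinuousOn.mul ?_ (by fun_prop))
    (hE.comp_continuousOn (by fun_prop))
  refine Complex.continuous_ofReal.comp_continuousOn (ContinuousOn.mul ?_ continuousOn_const)
  exact continuousOn_fst.rpow_const fun p hp => Or.inl (ne_of_gt hp.1)

lemma continuousOn_coreKernel (hν : -1 < ν) (s t : ℝ) :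
    ContinuousOn (fun p : ℝ × ℝ => coreKernel ν a s p.1 t p.2) (Ioi 0 ×ˢ Ioi 0) := by
  unfold coreKernel
  refine ContinuousOn.sub (continuousOn_finsetSum _ fun k _ => ContinuousOn.mul ?_ ?_) ?_
  · exact (continuousOn_besqDivDiff hν a k s).comp continuousOn_fst fun p hp => hp.1
  · fun_prop
  · split_ifs
    · exact continuousOn_besqEntire hν _
    · exact continuousOn_const

end Kernel

/-! ## Determinants of bordered and block matrices -/

section DetAlgebra

variable {R : Type*} [CommRing R] {ι : Type*} [Fintype ι] [DecidableEq ι]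

/-- Expansion of a bordered determinant. -/
lemma det_fromBlocks_border (A : Matrix ι ι R) (b c : ι → R) (d : R) :
    (Matrix.fromBlocks A (Matrix.of fun i (_ : Unit) => b i) (Matrix.of fun (_ : Unit) j => c j)
      (Matrix.of fun (_ _ : Unit) => d)).det =
      d * A.det - ∑ i, ∑ j, A.adjugate j i * (b i * c j) := by
  set B := Matrix.fromBlocks A (Matrix.of fun i (_ : Unit) => b i)
    (Matrix.of fun (_ : Unit) j => c j) (Matrix.of fun (_ _ : Unit) => d) with hB
  rw [Matrix.det_eq_sum_mul_adjugate_row B (Sum.inr ()), Fintype.sum_sum_type]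
  have h1 : B.adjugate (Sum.inr ()) (Sum.inr ()) = A.det := by
    rw [Matrix.adjugate_apply]
    have : B.updateRow (Sum.inr ()) (Pi.single (Sum.inr ()) 1) =
        Matrix.fromBlocks A (Matrix.of fun i (_ : Unit) => b i) 0 1 := by
      ext (i | i) (j | j) <;> simp [hB, Matrix.updateRow_apply]
    rw [this, Matrix.det_fromBlocks_zero₂₁, Matrix.det_one, mul_one]
  have h2 : ∀ j, B.adjugate (Sum.inl j) (Sum.inr ()) = -∑ i, A.adjugate j i * b i := by
    intro j
    rw [Matrix.adjugate_apply]
    -- Swapping column `j` with the border column makes the cofactor block triangular, at the price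
    -- of a sign; Cramer's rule then identifies it.
    have hperm := Matrix.det_permute' (Equiv.swap (Sum.inl j) (Sum.inr ()))
      (B.updateRow (Sum.inr ()) (Pi.single (Sum.inl j) 1))
    have hsub : (B.updateRow (Sum.inr ()) (Pi.single (Sum.inl j) 1)).submatrix id
        (Equiv.swap (Sum.inl j) (Sum.inr ())) =
        Matrix.fromBlocks (A.updateCol j b) (Matrix.of fun i (_ : Unit) => A i j) 0 1 := by
      ext (i | i) (k | k)
      · by_cases hk : k = j
        · subst hk
          simp [hB, Matrix.updateRow_apply]
        · rw [Matrix.submatrix_apply, Equiv.swap_apply_of_ne_of_ne (by simpa using hk) (by simp)]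
          simp [hB, Matrix.updateRow_apply, hk]
      · simp [hB, Matrix.updateRow_apply]
      · by_cases hk : k = j
        · subst hk
          simp [Matrix.updateRow_apply]
        · rw [Matrix.submatrix_apply, Equiv.swap_apply_of_ne_of_ne (by simpa using hk) (by simp)]
          simp [Matrix.updateRow_apply, hk]
      · simp [Matrix.updateRow_apply]
    rw [hsub, Matrix.det_fromBlocks_zero₂₁, Matrix.det_one, mul_one,
      Equiv.Perm.sign_swap (by simp), ← Matrix.cramer_apply, Matrix.cramer_eq_adjugate_mulVec,
      Matrix.mulVec, dotProduct] at hperm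
    rw [hperm]
    simp
  simp only [Finset.univ_unique, PUnit.default_eq_unit, Finset.sum_singleton, h1, h2]
  rw [add_comm, Finset.sum_comm, sub_eq_add_neg, ← Finset.sum_neg_distrib]
  congr 1
  refine Finset.sum_congr rfl fun j _ => ?_
  simp only [hB, Matrix.fromBlocks_apply₂₁, Matrix.of_apply]
  rw [mul_neg, Finset.mul_sum]
  congr 1
  exact Finset.sum_congr rfl fun i _ => by ring

/-- The `(r, c)` block of the auxiliary block triangular matrix. -/
def chainBlock {M : ℕ} (Φ Ψ : Fin (M + 1) → Matrix ι ι R)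
    (P : Fin (M + 1) → Fin (M + 1) → Matrix ι ι R) (r c : Fin (M + 2)) : Matrix ι ι R :=
  Fin.lastCases (motive := fun _ => Matrix ι ι R)
    (Fin.cases (motive := fun _ => Matrix ι ι R) 1 (fun t => -Ψ t) c)
    (fun m => Fin.cases (motive := fun _ => Matrix ι ι R) (Φ m)
      (fun t => if t < m then -P m t else 0) c) r

lemma det_chainBlock {M : ℕ} (Φ Ψ : Fin (M + 1) → Matrix ι ι R)
    (P : Fin (M + 1) → Fin (M + 1) → Matrix ι ι R) :
    (Matrix.of fun p q : Fin (M + 2) × ι => chainBlock Φ Ψ P p.1 q.1 p.2 q.2).det =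
      ((-1) ^ Fintype.card ι) ^ (M + 1) * ((Φ 0).det *
        (∏ m : Fin M, (P m.succ m.castSucc).det) * (Ψ (Fin.last M)).det) := by
  set S := Matrix.of fun p q : Fin (M + 2) × ι => chainBlock Φ Ψ P p.1 q.1 p.2 q.2 with hS
  -- Block row `m` contains `P m t` only for `t < m`, and its column is shifted by one, so nothing
  -- lies to the right of the diagonal. The dual order records that the matrix is lower triangular.
  have htri : S.BlockTriangular fun p => OrderDual.toDual p.1 := by
    rintro ⟨r, i⟩ ⟨c, j⟩ h
    have h : r < c := h
    simp only [hS, Matrix.of_apply]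
    induction r using Fin.lastCases with
    | last => exact absurd h (Fin.le_last c).not_gt
    | cast m =>
      induction c using Fin.cases with
      | zero => exact absurd h (Fin.zero_le _).not_gt
      | succ t =>
        have hmt : ¬ t < m := by
          rw [not_lt]
          exact Fin.castSucc_lt_succ_iff.1 h
        simp [chainBlock, hmt]
  rw [htri.det_fintype]
  have hblock : ∀ k : (Fin (M + 2))ᵒᵈ,
      (S.toSquareBlock (fun p => OrderDual.toDual p.1) k).det =
        (chainBlock Φ Ψ P (OrderDual.ofDual k) (OrderDual.ofDual k)).det := by
    intro k
    let e : ι ≃ {p : Fin (M + 2) × ι // OrderDual.toDual p.1 = k} :=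
      { toFun := fun i => ⟨(OrderDual.ofDual k, i), rfl⟩
        invFun := fun p => p.1.2
        left_inv := fun i => rfl
        right_inv := by
          rintro ⟨⟨r, i⟩, h⟩
          subst h
          rfl }
    rw [← Matrix.det_submatrix_equiv_self e]
    rfl
  simp_rw [hblock]
  rw [OrderDual.ofDual.prod_comp (fun k => (chainBlock Φ Ψ P k k).det), Fin.prod_univ_succ,
    Fin.prod_univ_castSucc]
  have e0 : chainBlock Φ Ψ P 0 0 = Φ 0 := by
    rw [← Fin.castSucc_zero]
    simp only [chainBlock, Fin.lastCases_castSucc]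
    rfl
  have e1 : ∀ m : Fin M, chainBlock Φ Ψ P m.castSucc.succ m.castSucc.succ =
      -P m.succ m.castSucc := by
    intro m
    have : chainBlock Φ Ψ P m.castSucc.succ m.castSucc.succ =
        chainBlock Φ Ψ P m.succ.castSucc m.castSucc.succ := by
      rw [Fin.succ_castSucc]
    rw [this]
    simp only [chainBlock, Fin.lastCases_castSucc, Fin.cases_succ]
    exact if_pos (Fin.castSucc_lt_succ)
  have e2 : chainBlock Φ Ψ P (Fin.last M).succ (Fin.last M).succ = -Ψ (Fin.last M) := by
    have : chainBlock Φ Ψ P (Fin.last M).succ (Fin.last M).succ =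
        chainBlock Φ Ψ P (Fin.last (M + 1)) (Fin.last M).succ := by
      rw [Fin.succ_last]
    rw [this]
    simp only [chainBlock, Fin.lastCases_last, Fin.cases_succ]
  simp_rw [e1]
  rw [e0, e2]
  simp_rw [Matrix.det_neg]
  rw [Finset.prod_mul_distrib, Finset.prod_const, Finset.card_univ, Fintype.card_fin]
  ring

/-- The determinant of a matrix with blocks `Φₘ Ψₙ - 1(m > n) Pₘₙ`. -/
lemma det_chain {M : ℕ} (Φ Ψ : Fin (M + 1) → Matrix ι ι R)
    (P : Fin (M + 1) → Fin (M + 1) → Matrix ι ι R) :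
    (Matrix.of fun p q : Fin (M + 1) × ι =>
      (Φ p.1 * Ψ q.1) p.2 q.2 - if q.1 < p.1 then P p.1 q.1 p.2 q.2 else 0).det =
      (Φ 0).det * (∏ m : Fin M, (P m.succ m.castSucc).det) * (Ψ (Fin.last M)).det := by
  set S := Matrix.of fun p q : Fin (M + 2) × ι => chainBlock Φ Ψ P p.1 q.1 p.2 q.2 with hS
  let B : Matrix ι (Fin (M + 1) × ι) R := Matrix.of fun i q => -Ψ q.1 i q.2
  let C : Matrix (Fin (M + 1) × ι) ι R := Matrix.of fun p j => Φ p.1 p.2 j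
  let D : Matrix (Fin (M + 1) × ι) (Fin (M + 1) × ι) R :=
    Matrix.of fun p q => -if q.1 < p.1 then P p.1 q.1 p.2 q.2 else 0
  -- The matrix is a Schur complement: it is what remains after eliminating an identity block
  -- bordered by the `Φ m` and the `-Ψ n`.
  have h1 : (Matrix.of fun p q : Fin (M + 1) × ι =>
      (Φ p.1 * Ψ q.1) p.2 q.2 - if q.1 < p.1 then P p.1 q.1 p.2 q.2 else 0) = D - C * B := by
    ext p q
    simp [B, C, D, Matrix.mul_apply]
    ring
  rw [h1, ← Matrix.det_fromBlocks_one₁₁]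
  let ec : ι ⊕ (Fin (M + 1) × ι) ≃ Fin (M + 2) × ι :=
    { toFun := Sum.elim (fun i => (0, i)) (fun p => (p.1.succ, p.2))
      invFun := fun p => Fin.cases (motive := fun _ => ι ⊕ (Fin (M + 1) × ι)) (Sum.inl p.2)
        (fun t => Sum.inr (t, p.2)) p.1
      left_inv := by rintro (i | ⟨t, i⟩) <;> simp
      right_inv := by
        rintro ⟨r, i⟩
        induction r using Fin.cases <;> simp }
  -- Rotating the block rows cyclically moves the identity row to the bottom. The diagonal blocks
  -- become `Φ 0`, then `-P m.succ m.castSucc`, then `-Ψ (Fin.last M)`.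
  let ρ : Equiv.Perm (Fin (M + 2) × ι) := Equiv.prodCongrLeft fun _ => (finRotate (M + 2))⁻¹
  have hrot : ∀ t : Fin (M + 1), (finRotate (M + 2))⁻¹ t.succ = t.castSucc := by
    intro t
    rw [Equiv.Perm.inv_eq_iff_eq, finRotate_apply]
    exact (Fin.coeSucc_eq_succ).symm
  have hrot0 : (finRotate (M + 2))⁻¹ 0 = Fin.last (M + 1) := by
    rw [Equiv.Perm.inv_eq_iff_eq, finRotate_last]
  have h2 : Matrix.fromBlocks 1 B C D = (S.submatrix ρ id).submatrix ec ec := by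
    ext (i | ⟨m, i⟩) (j | ⟨t, j⟩)
    · simp [S, ec, ρ, hrot0, chainBlock]
    · simp [S, ec, ρ, hrot0, chainBlock, B]
    · simp [S, ec, ρ, hrot, chainBlock, C]
    · simp only [Matrix.fromBlocks_apply₂₂, S, ec, ρ, hrot, chainBlock, D, Matrix.of_apply,
        Matrix.submatrix_apply, Equiv.coe_fn_mk, Sum.elim_inr, Equiv.prodCongrLeft_apply, id,
        Fin.lastCases_castSucc, Fin.cases_succ]
      split_ifs <;> simp
  rw [h2, Matrix.det_submatrix_equiv_self, Matrix.det_permute, det_chainBlock,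
    Equiv.Perm.sign_prodCongrLeft]
  simp only [Finset.prod_const, Finset.card_univ, Equiv.Perm.sign_inv, sign_finRotate]
  -- The sign of a cycle of length `M + 2`, once for each element of `ι`, cancels the signs of the
  -- `M + 1` negated diagonal blocks.
  have : (((((-1 : ℤˣ) ^ (M + 2 - 1)) ^ Fintype.card ι : ℤˣ) : ℤ) : R) *
      (((-1 : R) ^ Fintype.card ι) ^ (M + 1)) = 1 := by
    push_cast
    rw [← pow_mul, ← pow_mul, ← pow_add, mul_comm (M + 1),
      ← two_mul, pow_mul]
    simp
  rw [← mul_assoc, this, one_mul]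

end DetAlgebra

/-! ## Integrating out particles -/

/-- `det [K(τᵢ, xᵢ; τⱼ, xⱼ)]` for particles with time labels `τ` and positions `x`. -/
def labelledDet {α T ι : Type*} [Fintype ι] [DecidableEq ι] (K : T → α → T → α → ℂ)
    (τ : ι → T) (x : ι → α) : ℂ :=
  (Matrix.of fun i j => K (τ i) (x i) (τ j) (x j)).det

lemma labelledDet_comp_equiv {α T ι κ : Type*} [Fintype ι] [DecidableEq ι] [Fintype κ]
    [DecidableEq κ] (K : T → α → T → α → ℂ) (e : κ ≃ ι) (τ : ι → T) (x : ι → α) :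
    labelledDet K (τ ∘ e) (x ∘ e) = labelledDet K τ x :=
  Matrix.det_submatrix_equiv_self e (Matrix.of fun i j => K (τ i) (x i) (τ j) (x j))

/-- The properties of an extended kernel for `N` particles that make successive integration
possible. -/
structure IsExtendedKernel {α T : Type*} [MeasurableSpace α] [LinearOrder T] (μ : Measure α)
    (N : ℕ) (K : T → α → T → α → ℂ) : Prop where
  measurable : ∀ i j, Measurable fun p : α × α => K i p.1 j p.2
  bound : ∃ (C : ℝ) (w : α → ℝ) (g : T → α → ℝ), 0 ≤ C ∧ (∀ x, 0 ≤ w x) ∧ Integrable w μ ∧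
    (∀ i x, 0 < g i x) ∧ ∀ i j x y, ‖K i x j y‖ ≤ C * (w x * (g i x)⁻¹ * g j y)
  comp : ∀ i r j x y, ∫ u, K i x r u * K r u j y ∂μ =
    (1 - (if r < i then 1 else 0) - (if j < r then 1 else 0)) * K i x j y
  trace : ∀ r, ∫ u, K r u r u ∂μ = N

namespace IsExtendedKernel

variable {α T : Type*} [MeasurableSpace α] [LinearOrder T] {μ : Measure α} {N : ℕ}
  {K : T → α → T → α → ℂ}

lemma measurable_labelledDet (hK : IsExtendedKernel μ N K) {ι Ω : Type*} [Fintype ι]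
    [DecidableEq ι] [MeasurableSpace Ω] (τ : ι → T) {x : Ω → ι → α} (hx : Measurable x) :
    Measurable fun ω => labelledDet K τ (x ω) := by
  unfold labelledDet
  simp_rw [Matrix.det_apply]
  refine Finset.measurable_sum _ fun σ _ => Measurable.const_smul (Finset.measurable_prod _
    fun i _ => ?_) _
  simp only [Matrix.of_apply]
  exact (hK.measurable _ _).comp
    (((measurable_pi_apply _).comp hx).prodMk ((measurable_pi_apply _).comp hx))

/-- A product bound for the determinants. -/
lemma exists_norm_labelledDet_le (hK : IsExtendedKernel μ N K) :
    ∃ w : α → ℝ, (∀ x, 0 ≤ w x) ∧ Integrable w μ ∧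
      ∀ {ι : Type} [Fintype ι] [DecidableEq ι] (τ : ι → T) (x : ι → α),
        ‖labelledDet K τ x‖ ≤ (Fintype.card ι)! * ∏ i, w (x i) := by
  obtain ⟨C, w, g, hC, hw, hwi, hg, hb⟩ := hK.bound
  refine ⟨fun x => C * w x, fun x => mul_nonneg hC (hw x), hwi.const_mul C, ?_⟩
  intro ι _ _ τ x
  rw [labelledDet, Matrix.det_apply, ← Fintype.card_perm, ← nsmul_eq_mul, ← Finset.card_univ]
  refine norm_sum_le_of_le _ (fun σ _ => ?_) |>.trans_eq (Finset.sum_const _)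
  rw [Units.smul_def, zsmul_eq_mul, norm_mul]
  have hs : ‖(((Equiv.Perm.sign σ : ℤˣ) : ℤ) : ℂ)‖ = 1 := by
    rcases Int.units_eq_one_or (Equiv.Perm.sign σ) with h | h <;> rw [h] <;> simp
  rw [hs, one_mul, norm_prod]
  have h1 : ∏ i, ‖(Matrix.of fun i j => K (τ i) (x i) (τ j) (x j)) (σ i) i‖ ≤
      ∏ i, C * (w (x (σ i)) * (g (τ (σ i)) (x (σ i)))⁻¹ * g (τ i) (x i)) :=
    Finset.prod_le_prod (fun i _ => norm_nonneg _) fun i _ => hb _ _ _ _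
  refine h1.trans (le_of_eq ?_)
  -- Every particle occurs once as a row and once as a column, so the gauges `g` and `g⁻¹` cancel
  -- along the permutation.
  have h2 : ∏ i, C * (w (x (σ i)) * (g (τ (σ i)) (x (σ i)))⁻¹ * g (τ i) (x i)) =
      (∏ i, C * w (x (σ i)) * (g (τ (σ i)) (x (σ i)))⁻¹) * ∏ i, g (τ i) (x i) := by
    rw [← Finset.prod_mul_distrib]
    exact Finset.prod_congr rfl fun i _ => by ring
  rw [h2, Equiv.prod_comp σ (fun i => C * w (x i) * (g (τ i) (x i))⁻¹), ← Finset.prod_mul_distrib]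
  exact Finset.prod_congr rfl fun i _ => inv_mul_cancel_right₀ (hg _ _).ne' _

lemma integrable_labelledDet_elim [SigmaFinite μ] (hK : IsExtendedKernel μ N K) {ι κ : Type}
    [Fintype ι]
    [DecidableEq ι] [Fintype κ] [DecidableEq κ] (τ : ι → T) (σ : κ → T) (x : ι → α) :
    Integrable (fun y : κ → α => labelledDet K (Sum.elim τ σ) (Sum.elim x y))
      (Measure.pi fun _ => μ) := by
  obtain ⟨w, hw, hwi, hb⟩ := hK.exists_norm_labelledDet_le
  have hdom := (Integrable.fintype_prod (μ := fun _ : κ => μ) (f := fun _ : κ => w)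
    fun _ => hwi).const_mul ((Fintype.card (ι ⊕ κ))! * ∏ i, w (x i))
  refine hdom.mono' ?_ (Eventually.of_forall fun y => ?_)
  · refine (hK.measurable_labelledDet _ ?_).aestronglyMeasurable
    refine measurable_pi_iff.2 fun i => ?_
    rcases i with i | i
    · exact measurable_const
    · exact measurable_pi_apply i
  · refine (hb _ _).trans (le_of_eq ?_)
    rw [Fintype.prod_sum_type]
    simp only [Sum.elim_inl, Sum.elim_inr]
    ring

/-- Integrating out one particle. -/
lemma integral_labelledDet_one (hK : IsExtendedKernel μ N K) {ι : Type} [Fintype ι]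
    [DecidableEq ι] (τ : ι → T) (x : ι → α) (r : T) :
    ∫ u, labelledDet K (Sum.elim τ fun _ : Unit => r) (Sum.elim x fun _ : Unit => u) ∂μ =
      (N - (Finset.univ.filter fun i => τ i = r).card) * labelledDet K τ x := by
  obtain ⟨C, w, g, hC, hw, hwi, hg, hb⟩ := hK.bound
  set A : Matrix ι ι ℂ := Matrix.of fun i j => K (τ i) (x i) (τ j) (x j) with hA
  have hexp : ∀ u, labelledDet K (Sum.elim τ fun _ : Unit => r) (Sum.elim x fun _ : Unit => u) =
      K r u r u * A.det - ∑ i, ∑ j, A.adjugate j i *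
        (K (τ i) (x i) r u * K r u (τ j) (x j)) := by
    intro u
    rw [← det_fromBlocks_border A (fun i => K (τ i) (x i) r u) (fun j => K r u (τ j) (x j))]
    unfold labelledDet
    congr 1
    ext (i | i) (j | j) <;> simp [hA]
  have hmeas1 : ∀ i z, Measurable fun u => K i z r u := fun i z =>
    (hK.measurable i r).comp (measurable_const.prodMk measurable_id)
  have hmeas2 : ∀ j z, Measurable fun u => K r u j z := fun j z =>
    (hK.measurable r j).comp (measurable_id.prodMk measurable_const)
  have hmeas3 : Measurable fun u => K r u r u :=
    (hK.measurable r r).comp (measurable_id.prodMk measurable_id)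
  have hi1 : Integrable (fun u => K r u r u) μ := by
    refine (hwi.const_mul C).mono' hmeas3.aestronglyMeasurable (Eventually.of_forall fun u => ?_)
    refine (hb r r u u).trans (le_of_eq ?_)
    rw [inv_mul_cancel_right₀ (hg _ _).ne']
  have hi2 : ∀ i j, Integrable (fun u => K (τ i) (x i) r u * K r u (τ j) (x j)) μ := by
    intro i j
    refine (hwi.const_mul (C * (w (x i) * (g (τ i) (x i))⁻¹) * (C * g (τ j) (x j)))).mono'
      ((hmeas1 _ _).mul (hmeas2 _ _)).aestronglyMeasurable (Eventually.of_forall fun u => ?_)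
    rw [norm_mul]
    have h0 : 0 ≤ C * (w (x i) * (g (τ i) (x i))⁻¹ * g r u) := (norm_nonneg _).trans (hb _ _ _ _)
    refine (mul_le_mul (hb _ _ _ _) (hb _ _ _ _) (norm_nonneg _) h0).trans (le_of_eq ?_)
    have := (hg r u).ne'
    field_simp
  simp_rw [hexp]
  rw [integral_sub (hi1.mul_const _) (integrable_finsetSum _ fun i _ => integrable_finsetSum _
    fun j _ => (hi2 i j).const_mul _), integral_mul_const, hK.trace,
    integral_finsetSum _ fun i _ => integrable_finsetSum _ fun j _ => (hi2 i j).const_mul _]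
  have hs : ∀ i, ∫ u, ∑ j, A.adjugate j i * (K (τ i) (x i) r u * K r u (τ j) (x j)) ∂μ =
      ∑ j, A.adjugate j i * ((1 - (if r < τ i then 1 else 0) - (if τ j < r then 1 else 0)) *
        A i j) := by
    intro i
    rw [integral_finsetSum _ fun j _ => (hi2 i j).const_mul _]
    refine Finset.sum_congr rfl fun j _ => ?_
    rw [integral_const_mul, hK.comp]
    rfl
  simp_rw [hs]
  have hrow : ∀ i, ∑ j, A.adjugate j i * A i j = A.det := by
    intro i
    have h := congrFun (congrFun (Matrix.mul_adjugate A) i) i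
    rw [Matrix.mul_apply] at h
    simp only [Matrix.smul_apply, Matrix.one_apply_eq, smul_eq_mul, mul_one] at h
    rw [← h]
    exact Finset.sum_congr rfl fun j _ => mul_comm _ _
  have hcol : ∀ j, ∑ i, A.adjugate j i * A i j = A.det := by
    intro j
    have h := congrFun (congrFun (Matrix.adjugate_mul A) j) j
    rw [Matrix.mul_apply] at h
    simpa using h
  -- One indicator depends on the row only and the other on the column only, so Laplace expansion
  -- collapses the adjugate sums to `A.det`. Since `1 - 1(r < τ i) - 1(τ i < r) = 1(τ i = r)`, the
  -- determinants removed are counted by the particles already present at time `r`.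
  have hsplit : ∑ i, ∑ j, A.adjugate j i *
      ((1 - (if r < τ i then 1 else 0) - (if τ j < r then 1 else 0)) * A i j) =
      ∑ i, (1 - (if r < τ i then 1 else 0)) * ∑ j, A.adjugate j i * A i j -
        ∑ j, (if τ j < r then 1 else 0) * ∑ i, A.adjugate j i * A i j := by
    simp_rw [Finset.mul_sum]
    rw [Finset.sum_comm (f := fun j i => (if τ j < r then (1 : ℂ) else 0) *
      (A.adjugate j i * A i j)), ← Finset.sum_sub_distrib]
    refine Finset.sum_congr rfl fun i _ => ?_
    rw [← Finset.sum_sub_distrib]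
    exact Finset.sum_congr rfl fun j _ => by ring
  rw [hsplit]
  simp_rw [hrow, hcol]
  rw [← Finset.sum_mul, ← Finset.sum_mul, ← sub_mul, ← sub_mul, ← Finset.sum_sub_distrib]
  congr 2
  rw [Finset.card_filter]
  push_cast
  refine Finset.sum_congr rfl fun i _ => ?_
  rcases lt_trichotomy (τ i) r with h | h | h
  · simp [h, h.not_gt, h.ne]
  · simp [h]
  · simp [h, h.not_gt, h.ne']

variable [SigmaFinite μ]

/-- Integrating out all but the observed particles. -/
lemma integral_labelledDet_fin (hK : IsExtendedKernel μ N K) [Fintype T] (n : ℕ) :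
    ∀ (σ : Fin n → T) {ι : Type} [Fintype ι] [DecidableEq ι] (τ : ι → T) (x : ι → α),
    (∀ r, (Finset.univ.filter fun i => τ i = r).card +
      (Finset.univ.filter fun j => σ j = r).card = N) →
    ∫ y : Fin n → α, labelledDet K (Sum.elim τ σ) (Sum.elim x y) ∂(Measure.pi fun _ => μ) =
      (∏ r, ((Finset.univ.filter fun j => σ j = r).card ! : ℂ)) * labelledDet K τ x := by
  induction n with
  | zero =>
    intro σ ι _ _ τ x _
    have h : ∀ y : Fin 0 → α, labelledDet K (Sum.elim τ σ) (Sum.elim x y) = labelledDet K τ x := by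
      intro y
      rw [← labelledDet_comp_equiv K (Equiv.sumEmpty ι (Fin 0)) τ x]
      congr 1
      · funext i
        rcases i with i | i
        · rfl
        · exact i.elim0
      · funext i
        rcases i with i | i
        · rfl
        · exact i.elim0
    simp_rw [h]
    rw [integral_const, measureReal_def, Measure.pi_univ]
    simp
  | succ n ih =>
    intro σ ι _ _ τ x hcard
    have hmp := (measurePreserving_piFinSuccAbove (fun _ : Fin (n + 1) => μ) 0)
    set σ' : Fin n → T := fun j => σ j.succ with hσ'
    have hcount : ∀ r, (Finset.univ.filter fun j => σ j = r).card =
        (if σ 0 = r then 1 else 0) + (Finset.univ.filter fun j => σ' j = r).card := by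
      intro r
      simp only [Finset.card_filter]
      rw [Fin.sum_univ_succ]
    have heq : ∀ y : Fin (n + 1) → α, labelledDet K (Sum.elim τ σ) (Sum.elim x y) =
        labelledDet K (Sum.elim (Sum.elim τ fun _ : Unit => σ 0) σ')
          (Sum.elim (Sum.elim x fun _ : Unit => y 0) fun j => y j.succ) := by
      intro y
      let e : (ι ⊕ Unit) ⊕ Fin n ≃ ι ⊕ Fin (n + 1) :=
        { toFun := Sum.elim (Sum.elim Sum.inl fun _ => Sum.inr 0) fun j => Sum.inr j.succ
          invFun := Sum.elim (fun i => Sum.inl (Sum.inl i)) (Fin.cases (motive := fun _ =>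
            (ι ⊕ Unit) ⊕ Fin n) (Sum.inl (Sum.inr ())) fun j => Sum.inr j)
          left_inv := by rintro ((i | i) | j) <;> simp
          right_inv := by
            rintro (i | j)
            · simp
            · induction j using Fin.cases <;> simp }
      rw [← labelledDet_comp_equiv K e]
      congr 1
      · funext i
        rcases i with (i | i) | i <;> rfl
      · funext i
        rcases i with (i | i) | i <;> rfl
    have hintg := hK.integrable_labelledDet_elim τ σ x
    rw [← hmp.symm.integrable_comp_emb
      (MeasurableEquiv.piFinSuccAbove (fun _ => α) 0).symm.measurableEmbedding] at hintg
    have hintg' : Integrable (fun z : α × (Fin n → α) => labelledDet K (Sum.elim τ σ) (Sum.elim x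
        ((MeasurableEquiv.piFinSuccAbove (fun _ : Fin (n + 1) => α) 0).symm z)))
        (μ.prod (Measure.pi fun _ => μ)) := hintg
    rw [← hmp.symm.integral_comp' (g := fun y => labelledDet K (Sum.elim τ σ) (Sum.elim x y))]
    refine (integral_prod _ hintg').trans ?_
    have hinner : ∀ u : α, ∫ y : Fin n → α, labelledDet K (Sum.elim τ σ) (Sum.elim x
        ((MeasurableEquiv.piFinSuccAbove (fun _ : Fin (n + 1) => α) 0).symm (u, y)))
        ∂(Measure.pi fun _ => μ) = (∏ r, ((Finset.univ.filter fun j => σ' j = r).card ! : ℂ)) *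
        labelledDet K (Sum.elim τ fun _ : Unit => σ 0) (Sum.elim x fun _ : Unit => u) := by
      intro u
      rw [← ih σ' (Sum.elim τ fun _ : Unit => σ 0) (Sum.elim x fun _ : Unit => u)]
      · refine integral_congr_ae (Eventually.of_forall fun y => ?_)
        simp only
        rw [heq]
        rfl
      · intro r
        rw [← hcard r, hcount]
        simp only [Finset.card_filter]
        rw [Fintype.sum_sum_type, Fintype.sum_unique (ι := Unit)]
        exact add_assoc _ _ _
    refine (integral_congr_ae (Eventually.of_forall hinner)).trans ?_
    rw [integral_const_mul, hK.integral_labelledDet_one, ← mul_assoc]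
    congr 1
    -- The factor from one integration is the number of particles at this time not yet fixed, the
    -- current one included. Successive factors build up the factorial.
    have hN : (N : ℂ) - (Finset.univ.filter fun i => τ i = σ 0).card =
        ((Finset.univ.filter fun j => σ' j = σ 0).card + 1 : ℕ) := by
      rw [← hcard (σ 0), hcount]
      push_cast
      simp
      ring
    rw [hN, ← Finset.prod_erase_mul _ _ (Finset.mem_univ (σ 0)),
      ← Finset.prod_erase_mul _ _ (Finset.mem_univ (σ 0)), mul_assoc]
    congr 1
    · refine Finset.prod_congr rfl fun r hr => ?_
      rw [hcount, if_neg (Finset.ne_of_mem_erase hr).symm, zero_add]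
    · rw [hcount, if_pos rfl, add_comm 1, Nat.factorial_succ]
      push_cast
      ring

lemma integral_labelledDet (hK : IsExtendedKernel μ N K) [Fintype T] {ι κ : Type} [Fintype ι]
    [DecidableEq ι] [Fintype κ] [DecidableEq κ] (τ : ι → T) (σ : κ → T) (x : ι → α)
    (hcard : ∀ r, (Finset.univ.filter fun i => τ i = r).card +
      (Finset.univ.filter fun j => σ j = r).card = N) :
    ∫ y : κ → α, labelledDet K (Sum.elim τ σ) (Sum.elim x y) ∂(Measure.pi fun _ => μ) =
      (∏ r, ((Finset.univ.filter fun j => σ j = r).card ! : ℂ)) * labelledDet K τ x := by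
  let e := (Fintype.equivFin κ).symm
  have hc : ∀ r, (Finset.univ.filter fun j => (σ ∘ e) j = r).card =
      (Finset.univ.filter fun j => σ j = r).card := by
    intro r
    simp only [Finset.card_filter]
    exact e.sum_comp fun j => if σ j = r then 1 else 0
  have h := hK.integral_labelledDet_fin _ (σ ∘ e) τ x (fun r => by rw [hc, hcard])
  simp_rw [hc] at h
  rw [← h]
  have hmp := measurePreserving_piCongrLeft (fun _ : κ => μ) e
  rw [← hmp.integral_comp' (g := fun y => labelledDet K (Sum.elim τ σ) (Sum.elim x y))]
  refine integral_congr_ae (Eventually.of_forall fun y => ?_)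
  simp only
  rw [← labelledDet_comp_equiv K (Equiv.sumCongr (Equiv.refl ι) e)]
  congr 1
  · funext i
    rcases i with i | i <;> rfl
  · funext i
    rcases i with i | i
    · rfl
    · exact Equiv.piCongrLeft_apply_apply (fun _ : κ => α) e y i

end IsExtendedKernel

/-! ## The multitime density as a determinant of the kernel -/

section Density

variable {N : ℕ} {ν : ℝ}

/-- The determinant of the divided differences of the transition density. -/
def divDiffDet (ν t : ℝ) (y a : Fin N → ℝ) : ℂ :=
  (Matrix.of fun i k : Fin N => besqDivDiff ν a k t (y i)).det

lemma nodes_fin (a : Fin N → ℝ) (i : Fin N) : nodes a i = a i := by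
  simp [nodes]

/-- At a node the Newton remainder disappears. As a matrix identity this factors the transition
matrix into divided differences and Newton polynomial values, so that the Vandermonde determinant
splits off exactly. -/
lemma besqEntire_eq_sum_divDiff (t y : ℝ) (a : Fin N → ℝ) (j : Fin N) :
    besqEntire ν t y (a j) = ∑ k : Fin N, besqDivDiff ν a k t y *
      (newtonPoly (nodes a) k).eval (a j : ℂ) := by
  rw [newton_expansion (besqEntire ν t y) (nodes a) N (a j),
    Finset.prod_eq_zero (Finset.mem_range.2 j.2) (by rw [nodes_fin, sub_self]), mul_zero, add_zero,
    Finset.sum_range]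
  exact Finset.sum_congr rfl fun k _ => by rw [eval_newtonPoly, besqDivDiff]

lemma ofReal_vand_eq_det_eval (x : Fin N → ℝ) (p : Fin N → Polynomial ℂ)
    (hdeg : ∀ i, (p i).natDegree = i) (hp : ∀ i, (p i).Monic) :
    (vand x : ℂ) = (Matrix.of fun k j : Fin N => (p k).eval (x j : ℂ)).det := by
  have h1 : (vand x : ℂ) = (Matrix.vandermonde fun i => (x i : ℂ)).det := by
    unfold vand
    rw [← Complex.ofRealHom_eq_coe, RingHom.map_det]
    congr 1
    ext i j
    simp [Matrix.vandermonde_apply]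
  rw [h1, Matrix.det_eval_matrixOfPolynomials_eq_det_vandermonde _ p hdeg hp,
    ← Matrix.det_transpose]
  rfl

lemma ofReal_karlinMcGregor {t : ℝ} (ht : 0 < t) {y x : Fin N → ℝ}
    (hy : ∀ i, 0 < y i) (hx : ∀ i, 0 ≤ x i) :
    (karlinMcGregor ν t y x : ℂ) = (Matrix.of fun i j => besqEntire ν t (y i) (x j)).det := by
  unfold karlinMcGregor
  rw [← Complex.ofRealHom_eq_coe, RingHom.map_det]
  congr 1
  ext i j
  simp [ofReal_besq ht (hy i) (hx j)]

lemma ofReal_karlinMcGregor_eq_mul_vand {t : ℝ} (ht : 0 < t) {y x : Fin N → ℝ}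
    (hy : ∀ i, 0 < y i) (hx : ∀ i, 0 ≤ x i) :
    (karlinMcGregor ν t y x : ℂ) = divDiffDet ν t y x * vand x := by
  rw [ofReal_karlinMcGregor ht hy hx, ofReal_vand_eq_det_eval x (fun k => newtonPoly (nodes x) k)
    (fun i => natDegree_newtonPoly _ _) (fun i => monic_newtonPoly _ _), divDiffDet,
    ← Matrix.det_mul]
  congr 1
  ext i j
  rw [Matrix.mul_apply]
  exact besqEntire_eq_sum_divDiff t (y i) x j

/-- One circle encloses the nodes of all nearby configurations, and its integrand depends
continuously on the nodes, with no singularity where they merge. -/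
lemma continuousAt_besqDivDiff (hν : -1 < ν) (k : ℕ) (t y : ℝ) (a : Fin N → ℝ) :
    ContinuousAt (fun x : Fin N → ℝ => besqDivDiff ν x k t y) a := by
  obtain ⟨R, hR, hb⟩ := exists_norm_nodes_lt a
  set U : Set (Fin N → ℝ) := {x | ∀ i, |x i| < R} with hU
  have hUo : IsOpen U := by
    rw [hU, Set.ofPred_forall]
    exact isOpen_iInter_of_finite fun i => isOpen_lt (by fun_prop) continuous_const
  have haU : a ∈ U := fun i => by
    have := hb i
    rwa [nodes_fin, Complex.norm_real, Real.norm_eq_abs] at this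
  have hnodes : ∀ x ∈ U, ∀ j, ‖nodes x j‖ < R := by
    intro x hx j
    unfold nodes
    split_ifs with h
    · rw [Complex.norm_real, Real.norm_eq_abs]
      exact hx _
    · simpa using hR
  refine ContinuousOn.continuousAt ?_ (hUo.mem_nhds haU)
  have hcn : ∀ j, Continuous fun x : Fin N → ℝ => nodes x j := by
    intro j
    unfold nodes
    split_ifs <;> fun_prop
  have hd : deriv (circleMap 0 R) = fun u => circleMap 0 R u * Complex.I :=
    funext fun u => deriv_circleMap 0 R u
  have hE := (differentiable_besqEntire hν t y).continuous
  have hcont : ContinuousOn (fun x : Fin N → ℝ => (2 * Real.pi * Complex.I : ℂ)⁻¹ *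
      ∫ u in (0 : ℝ)..2 * Real.pi,
      (deriv (circleMap 0 R) u * ∏ j ∈ Finset.range (k + 1), (circleMap 0 R u - nodes x j)⁻¹) *
        besqEntire ν t y (circleMap 0 R u)) U := by
    rw [continuousOn_iff_continuous_domRestrict]
    refine continuous_const.mul ?_
    refine intervalIntegral.continuous_parametric_intervalIntegral_of_continuous'
      (f := fun (x : U) u => (deriv (circleMap 0 R) u *
        ∏ j ∈ Finset.range (k + 1), (circleMap 0 R u - nodes x.1 j)⁻¹) *
        besqEntire ν t y (circleMap 0 R u)) ?_ _ _
    have hcm : Continuous fun q : U × ℝ => circleMap 0 R q.2 :=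
      (continuous_circleMap 0 R).comp continuous_snd
    rw [hd]
    refine ((hcm.mul continuous_const).mul (continuous_finsetProd _ fun j _ => ?_)).mul
      (hE.comp hcm)
    refine (hcm.sub ((hcn j).comp (continuous_subtype_val.comp continuous_fst))).inv₀
      fun q => sub_ne_zero.2 fun h => ?_
    have := hnodes q.1 q.1.2 j
    simp only [Function.comp_apply] at h
    rw [← h, norm_circleMap_zero' hR] at this
    exact lt_irrefl _ this
  exact hcont.congr fun x hx => besqDivDiff_eq_integral hν x k hR (hnodes x hx) t y

lemma continuousAt_divDiffDet (hν : -1 < ν) (t : ℝ) (y a : Fin N → ℝ) :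
    ContinuousAt (fun x : Fin N → ℝ => divDiffDet ν t y x) a := by
  unfold divDiffDet
  simp_rw [Matrix.det_apply]
  refine tendsto_finsetSum _ fun σ _ => Tendsto.const_smul (tendsto_finsetProd _ fun i _ => ?_) _
  exact continuousAt_besqDivDiff hν _ _ _ _

/-- The limit from inside the Weyl chamber determines a unique value only because the configuration
is approached from there, for instance by `a i + ε i`. -/
lemma neBot_nhdsWithin_weylChamber {a : Fin N → ℝ} (ha0 : ∀ i, 0 ≤ a i) (ha : Monotone a) :
    (𝓝[weylChamber N] a).NeBot := by
  rw [← mem_closure_iff_nhdsWithin_neBot]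
  have h : Tendsto (fun ε : ℝ => fun i : Fin N => a i + ε * (i : ℕ)) (𝓝[>] 0) (𝓝 a) := by
    have : ContinuousAt (fun ε : ℝ => fun i : Fin N => a i + ε * (i : ℕ)) 0 := by fun_prop
    have h := this.tendsto
    simp only [zero_mul, add_zero] at h
    exact h.mono_left nhdsWithin_le_nhds
  refine mem_closure_of_tendsto h ?_
  filter_upwards [self_mem_nhdsWithin] with ε hε
  have hε : 0 < ε := hε
  refine ⟨fun i => add_nonneg (ha0 i) (by positivity), fun i j hij => ?_⟩
  have h1 := ha hij.le
  have h2 : ε * (i : ℕ) < ε * (j : ℕ) := by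
    have : ((i : ℕ) : ℝ) < (j : ℕ) := by exact_mod_cast hij
    exact mul_lt_mul_of_pos_left this hε
  exact add_lt_add_of_le_of_lt h1 h2

lemma tendsto_ofReal_karlinMcGregor_div_vand (hν : -1 < ν) {t : ℝ} (ht : 0 < t) {y : Fin N → ℝ}
    (hy : ∀ i, 0 < y i) (a : Fin N → ℝ) :
    Tendsto (fun x => ((karlinMcGregor ν t y x / vand x : ℝ) : ℂ)) (𝓝[weylChamber N] a)
      (𝓝 (divDiffDet ν t y a)) := by
  refine ((continuousAt_divDiffDet hν t y a).tendsto.mono_left nhdsWithin_le_nhds).congr' ?_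
  filter_upwards [self_mem_nhdsWithin] with x hx
  have hv : (vand x : ℂ) ≠ 0 := by
    rw [Complex.ofReal_ne_zero]
    exact Matrix.det_vandermonde_ne_zero_iff.2 hx.2.injective
  rw [Complex.ofReal_div, ofReal_karlinMcGregor_eq_mul_vand ht hy hx.1, mul_div_cancel_right₀ _ hv]

/-- The limit defining `kmRatio` exists. -/
lemma tendsto_kmRatio (hν : -1 < ν) {t : ℝ} (ht : 0 < t) {y a : Fin N → ℝ} (hy : ∀ i, 0 < y i)
    (ha0 : ∀ i, 0 ≤ a i) (ha : Monotone a) :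
    Tendsto (fun x => karlinMcGregor ν t y x / vand x) (𝓝[weylChamber N] a)
      (𝓝 (kmRatio ν t y a)) := by
  have := neBot_nhdsWithin_weylChamber ha0 ha
  have h := (Complex.continuous_re.tendsto _).comp
    (tendsto_ofReal_karlinMcGregor_div_vand hν ht hy a)
  exact tendsto_nhds_limUnder ⟨_, h⟩

lemma ofReal_kmRatio (hν : -1 < ν) {t : ℝ} (ht : 0 < t) {y a : Fin N → ℝ} (hy : ∀ i, 0 < y i)
    (ha0 : ∀ i, 0 ≤ a i) (ha : Monotone a) :
    (kmRatio ν t y a : ℂ) = divDiffDet ν t y a := by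
  have := neBot_nhdsWithin_weylChamber ha0 ha
  exact tendsto_nhds_unique ((Complex.continuous_ofReal.tendsto _).comp
    (tendsto_kmRatio hν ht hy ha0 ha)) (tendsto_ofReal_karlinMcGregor_div_vand hν ht hy a)

/-- The multitime density is the determinant of the kernel over all particles. -/
lemma ofReal_multitimeDensity (hν : -1 < ν) {M : ℕ} {a : Fin N → ℝ} (ha0 : ∀ i, 0 ≤ a i)
    (ha : Monotone a) {t : Fin (M + 1) → ℝ} (ht0 : ∀ m, 0 < t m) (ht : StrictMono t)
    {X : Fin (M + 1) → Fin N → ℝ} (hX : ∀ m i, 0 < X m i) :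
    (multitimeDensity ν a t X : ℂ) =
      labelledDet (fun m x n y => coreKernel ν a (t m) x (t n) y)
        (Prod.fst : Fin (M + 1) × Fin N → Fin (M + 1)) (fun p => X p.1 p.2) := by
  -- In the chain, the left end is given by divided differences at the first time, the right end by
  -- backward evolved Newton polynomials at the last time, and the links are the transition
  -- matrices.
  have hdet := det_chain (M := M)
    (fun m => Matrix.of fun i k : Fin N => besqDivDiff ν a k (t m) (X m i))
    (fun n => Matrix.of fun k j : Fin N => (besqNewton ν a k (t n)).eval (X n j : ℂ))
    (fun m n => Matrix.of fun i j : Fin N => besqEntire ν (t m - t n) (X m i) (X n j))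
  have hmat := hdet.symm.trans (b := _) (c := labelledDet
      (fun m x n y => coreKernel ν a (t m) x (t n) y)
      (Prod.fst : Fin (M + 1) × Fin N → Fin (M + 1)) (fun p => X p.1 p.2)) <| by
    unfold labelledDet
    congr 1
    ext p q
    simp only [Matrix.of_apply, Matrix.mul_apply, coreKernel, Finset.sum_range, ht.lt_iff_lt]
  -- The backward evolved Newton polynomials are monic of degrees `0, …, N - 1`, so their
  -- determinant is the Vandermonde factor of the density.
  rw [← hmat, multitimeDensity, Complex.ofReal_mul, Complex.ofReal_mul, Complex.ofReal_prod,
    ofReal_kmRatio hν (ht0 0) (hX 0) ha0 ha,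
    ofReal_vand_eq_det_eval _ (fun k => besqNewton ν a k (t (Fin.last M)))
      (fun k => (natDegree_besqPoly hν _ (monic_newtonPoly _ _)).trans (natDegree_newtonPoly _ _))
      (fun k => monic_besqPoly hν _ (monic_newtonPoly _ _))]
  have hkm : ∀ m : Fin M, (karlinMcGregor ν (t m.succ - t m.castSucc) (X m.succ)
      (X m.castSucc) : ℂ) = (Matrix.of fun i j : Fin N => besqEntire ν (t m.succ - t m.castSucc)
        (X m.succ i) (X m.castSucc j)).det := fun m =>
    ofReal_karlinMcGregor (sub_pos.2 (ht m.castSucc_lt_succ)) (hX _) fun i => (hX _ i).le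
  simp_rw [hkm, divDiffDet]
  ring

/-! ### The kernel as an abstract extended kernel -/

/-- The kernel at the times `t`, extended by zero from the positive half line. -/
def posKernel {T : Type*} (ν : ℝ) (a : Fin N → ℝ) (t : T → ℝ) (m : T) (x : ℝ) (n : T) (y : ℝ) :
    ℂ :=
  if 0 < x ∧ 0 < y then coreKernel ν a (t m) x (t n) y else 0

lemma isExtendedKernel_posKernel (hν : -1 < ν) {T : Type*} [LinearOrder T] [Finite T]
    (a : Fin N → ℝ) {t : T → ℝ} (ht0 : ∀ m, 0 < t m) (ht : StrictMono t) :
    IsExtendedKernel (volume.restrict (Ioi 0)) N (posKernel ν a t) where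
  measurable m n := by
    have hs : MeasurableSet (Ioi (0 : ℝ) ×ˢ Ioi (0 : ℝ)) := measurableSet_Ioi.prod measurableSet_Ioi
    classical
    have h := (continuousOn_coreKernel a hν (t m) (t n)).measurable_piecewise
      (g := fun _ => 0) continuousOn_const hs
    convert h using 1
    funext p
    simp only [Set.piecewise, posKernel, Set.mem_prod, mem_Ioi]
  bound := by
    cases nonempty_fintype T
    have h := fun p : T × T => exists_norm_coreKernel_le a hν (ht0 p.1) (ht0 p.2)
    choose ε hε C hC hb using h
    -- There are finitely many pairs of times, so one margin `δ` serves all of them; it makes the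
    -- common weight `x ^ ν exp (-(δ x))` integrable.
    obtain ⟨δ, hδε, hδ⟩ : ∃ δ : ℝ, (∀ p, δ ≤ ε p) ∧ 0 < δ := by
      have h1 : ∀ᶠ δ in 𝓝[>] (0 : ℝ), ∀ p, δ ≤ ε p := eventually_all.2 fun p =>
        Filter.mem_of_superset (Ioc_mem_nhdsGT (hε p)) fun x hx => hx.2
      exact (h1.and self_mem_nhdsWithin).exists
    refine ⟨∑ p, C p, fun x => if 0 < x then x ^ ν * Real.exp (-(δ * x)) else 0,
      fun m x => Real.exp (1 / (4 * t m + 2) * x), Finset.sum_nonneg fun p _ => (hC p).le, ?_, ?_,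
      fun _ _ => Real.exp_pos _, ?_⟩
    · intro x
      dsimp only
      split_ifs with h <;> positivity
    · refine (integrableOn_rpow_mul_pow_mul_exp hν 0 hδ).congr ?_
      filter_upwards [ae_restrict_mem measurableSet_Ioi] with x hx
      rw [if_pos (by exact hx), pow_zero, mul_one]
    · intro m n x y
      dsimp only
      unfold posKernel
      by_cases h : 0 < x ∧ 0 < y
      · rw [if_pos h, if_pos h.1]
        refine (hb (m, n) x h.1 y h.2).trans ?_
        have h1 : C (m, n) ≤ ∑ p, C p :=
          Finset.single_le_sum (f := C) (fun p _ => (hC p).le) (Finset.mem_univ _)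
        refine mul_le_mul h1 (mul_le_mul_of_nonneg_right ?_ (Real.exp_pos _).le) ?_
          (Finset.sum_nonneg fun p _ => (hC p).le)
        · rw [mul_assoc]
          refine mul_le_mul_of_nonneg_left ?_ (Real.rpow_nonneg h.1.le _)
          rw [← Real.exp_neg, ← Real.exp_add]
          refine Real.exp_le_exp.2 ?_
          have := mul_le_mul_of_nonneg_right (hδε (m, n)) h.1.le
          linarith
        · have := Real.rpow_nonneg h.1.le ν
          positivity
      · rw [if_neg h, norm_zero]
        refine mul_nonneg (Finset.sum_nonneg fun p _ => (hC p).le) ?_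
        split_ifs <;> positivity
  comp m r n x y := by
    by_cases h : 0 < x ∧ 0 < y
    · have h1 : ∫ u in Ioi (0 : ℝ), posKernel ν a t m x r u * posKernel ν a t r u n y =
          ∫ u in Ioi (0 : ℝ), coreKernel ν a (t m) x (t r) u * coreKernel ν a (t r) u (t n) y := by
        refine setIntegral_congr_fun measurableSet_Ioi fun u hu => ?_
        have hu : 0 < u := hu
        simp only [posKernel, h.1, h.2, hu, and_self, if_true]
      rw [h1, integral_coreKernel_mul_coreKernel a hν (ht0 r) h.1]
      simp only [ht.lt_iff_lt, posKernel, if_pos h]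
    · have h1 : ∀ u, posKernel ν a t m x r u * posKernel ν a t r u n y = 0 := by
        intro u
        rcases not_and_or.1 h with h | h <;> simp [posKernel, h]
      simp_rw [h1]
      simp [posKernel, h]
  trace r := by
    rw [← integral_coreKernel_diag a hν (ht0 r)]
    refine setIntegral_congr_fun measurableSet_Ioi fun u hu => ?_
    have hu : 0 < u := hu
    simp only [posKernel, hu, and_self, if_true]

lemma labelledDet_posKernel {T ι : Type*} [Fintype ι] [DecidableEq ι] (a : Fin N → ℝ) (t : T → ℝ)
    (τ : ι → T) {x : ι → ℝ} (hx : ∀ i, 0 < x i) :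
    labelledDet (posKernel ν a t) τ x =
      labelledDet (fun m x n y => coreKernel ν a (t m) x (t n) y) τ x := by
  unfold labelledDet
  congr 1
  ext i j
  simp [posKernel, hx]

end Density

/-! ## Correlation functions -/

lemma measurePreserving_sigmaCurry {ι α : Type*} [Fintype ι] {κ : ι → Type*}
    [∀ i, Fintype (κ i)] [MeasurableSpace α] (μ : Measure α) [SigmaFinite μ] :
    MeasurePreserving (MeasurableEquiv.piCurry fun i (_ : κ i) => α)
      (Measure.pi fun _ : Σ i, κ i => μ) (Measure.pi fun i => Measure.pi fun _ : κ i => μ) := by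
  refine MeasurePreserving.symm (MeasurableEquiv.piCurry fun i (_ : κ i) => α).symm
    ⟨MeasurableEquiv.measurable _, (Measure.pi_eq fun s hs => ?_).symm⟩
  rw [MeasurableEquiv.map_apply]
  have : (MeasurableEquiv.piCurry fun i (_ : κ i) => α).symm ⁻¹' (Set.univ.pi s) =
      Set.univ.pi fun i => Set.univ.pi fun j => s ⟨i, j⟩ := by
    ext x
    simp [Sigma.forall, MeasurableEquiv.coe_piCurry_symm, Sigma.uncurry]
  rw [this, Measure.pi_pi]
  simp_rw [Measure.pi_pi]
  rw [Fintype.prod_sigma]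

lemma volume_restrict_pi_eq {ι : Type*} [Fintype ι] (s : Set ℝ) :
    (volume : Measure (ι → ℝ)).restrict {x | ∀ i, x i ∈ s} =
      Measure.pi fun _ => volume.restrict s := by
  rw [← Measure.restrict_pi_pi, ← volume_pi]
  congr 1
  ext x
  simp

lemma volume_restrict_pi_pi_eq {ι : Type*} [Fintype ι] {κ : ι → Type*} [∀ i, Fintype (κ i)]
    (s : Set ℝ) :
    (volume : Measure ((i : ι) → κ i → ℝ)).restrict {x | ∀ i j, x i j ∈ s} =
      Measure.pi fun i => Measure.pi fun _ : κ i => volume.restrict s := by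
  have : {x : (i : ι) → κ i → ℝ | ∀ i j, x i j ∈ s} =
      Set.univ.pi fun i => {x : κ i → ℝ | ∀ j, x j ∈ s} := by
    ext x
    simp
  rw [this, volume_pi, Measure.restrict_pi_pi]
  simp_rw [volume_restrict_pi_eq]

/-- The observed and the unobserved particles together are all particles. -/
def observedEquiv {N M : ℕ} (n : Fin (M + 1) → ℕ) (hn : ∀ m, n m ≤ N) :
    (Σ m, Fin (n m)) ⊕ (Σ m, Fin (N - n m)) ≃ Fin (M + 1) × Fin N where
  toFun := Sum.elim (fun p => (p.1, ⟨p.2, p.2.2.trans_le (hn p.1)⟩))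
    (fun p => (p.1, ⟨n p.1 + p.2, by have := p.2.2; omega⟩))
  invFun p := if h : (p.2 : ℕ) < n p.1 then Sum.inl ⟨p.1, ⟨p.2, h⟩⟩
    else Sum.inr ⟨p.1, ⟨p.2 - n p.1, by have := p.2.2; omega⟩⟩
  left_inv := by
    rintro (⟨m, i⟩ | ⟨m, i⟩)
    · simp
    · simp
  right_inv := by
    rintro ⟨m, i⟩
    by_cases h : (i : ℕ) < n m
    · simp [h]
    · simp only [h, dite_false, Sum.elim_inr, Prod.mk.injEq, true_and]
      ext
      simp only
      omega

lemma card_filter_sigma_fst {T : Type*} [Fintype T] [DecidableEq T] (n : T → ℕ) (r : T) :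
    (Finset.univ.filter fun p : Σ m, Fin (n m) => p.1 = r).card = n r := by
  rw [Finset.card_filter, Fintype.sum_sigma, Finset.sum_eq_single r]
  · simp
  · intro m _ hm
    simp [hm]
  · simp

section Correlation

variable {N M : ℕ} {ν : ℝ} {a : Fin N → ℝ} {t : Fin (M + 1) → ℝ}

lemma ofReal_multitimeDensity_combine (hν : -1 < ν) (ha0 : ∀ i, 0 ≤ a i) (ha : Monotone a)
    (ht0 : ∀ m, 0 < t m) (ht : StrictMono t) {n : Fin (M + 1) → ℕ} (hn : ∀ m, n m ≤ N)
    {X : (Σ m, Fin (n m)) → ℝ} (hX : ∀ p, 0 < X p) {Y : (Σ m, Fin (N - n m)) → ℝ}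
    (hY : ∀ p, 0 < Y p) :
    (multitimeDensity ν a t (combine n X (Sigma.curry Y)) : ℂ) =
      labelledDet (posKernel ν a t) (Sum.elim Sigma.fst Sigma.fst) (Sum.elim X Y) := by
  have hpos : ∀ m i, 0 < combine n X (Sigma.curry Y) m i := by
    intro m i
    unfold combine
    split_ifs
    · exact hX _
    · exact hY _
  rw [ofReal_multitimeDensity hν ha0 ha ht0 ht hpos,
    ← labelledDet_comp_equiv _ (observedEquiv n hn),
    labelledDet_posKernel a t _ (by rintro (p | p) <;> simp [hX, hY])]
  congr 1
  · funext p
    rcases p with p | p <;> rfl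
  · funext p
    rcases p with ⟨m, i⟩ | ⟨m, i⟩
    · simp [observedEquiv, combine]
    · simp [observedEquiv, combine, Sigma.curry]

/-- The density formula equals the full determinant at all positive positions, not only ordered
ones. Integrating out the unobserved particles produces the factorials `(N - n m)!`, which the
normalization removes. -/
lemma correlation_eq_labelledDet (hν : -1 < ν) (ha0 : ∀ i, 0 ≤ a i) (ha : Monotone a)
    (ht0 : ∀ m, 0 < t m) (ht : StrictMono t) {n : Fin (M + 1) → ℕ} (hn : ∀ m, n m ≤ N)
    {X : (Σ m, Fin (n m)) → ℝ} (hX : ∀ p, 0 < X p) :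
    IntegrableOn (fun Y => multitimeDensity ν a t (combine n X Y)) (unobserved N n) ∧
      (correlation ν a t n X : ℂ) = labelledDet (posKernel ν a t) Sigma.fst X := by
  have hK := isExtendedKernel_posKernel hν a ht0 ht
  have hmeas : (volume.restrict (unobserved N n)) =
      Measure.pi fun m => Measure.pi fun _ : Fin (N - n m) => volume.restrict (Ioi (0 : ℝ)) :=
    volume_restrict_pi_pi_eq (Ioi 0)
  have hmp := measurePreserving_sigmaCurry (κ := fun m : Fin (M + 1) => Fin (N - n m))
    (volume.restrict (Ioi (0 : ℝ)))
  have hae : ∀ᵐ Y : (Σ m, Fin (N - n m)) → ℝ ∂(Measure.pi fun _ => volume.restrict (Ioi (0 : ℝ))),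
      (multitimeDensity ν a t (combine n X (Sigma.curry Y)) : ℂ) =
        labelledDet (posKernel ν a t) (Sum.elim Sigma.fst Sigma.fst) (Sum.elim X Y) := by
    rw [← volume_restrict_pi_eq]
    have hms : MeasurableSet {Y : (Σ m, Fin (N - n m)) → ℝ | ∀ i, Y i ∈ Ioi 0} := by
      rw [Set.ofPred_forall]
      exact MeasurableSet.iInter fun i => measurable_pi_apply i measurableSet_Ioi
    filter_upwards [ae_restrict_mem hms] with Y hY
    exact ofReal_multitimeDensity_combine hν ha0 ha ht0 ht hn hX hY
  have hintg := (hK.integrable_labelledDet_elim (Sigma.fst : (Σ m, Fin (n m)) → Fin (M + 1))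
    (Sigma.fst : (Σ m, Fin (N - n m)) → Fin (M + 1)) X).congr
    (hae.mono fun Y hY => hY.symm)
  have hintg2 : Integrable (fun Y => (multitimeDensity ν a t (combine n X Y) : ℂ))
      (volume.restrict (unobserved N n)) := by
    rw [hmeas, ← hmp.integrable_comp_emb (MeasurableEquiv.measurableEmbedding _)]
    exact hintg
  refine ⟨hintg2.re, ?_⟩
  rw [correlation, Complex.ofReal_mul, ← integral_complex_ofReal, hmeas,
    ← hmp.integral_comp' (g := fun Y => (multitimeDensity ν a t (combine n X Y) : ℂ))]
  have h1 := (integral_congr_ae hae).trans (hK.integral_labelledDet Sigma.fst Sigma.fst X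
    fun r => by rw [card_filter_sigma_fst, card_filter_sigma_fst, Nat.add_sub_cancel' (hn r)])
  refine (congrArg _ h1).trans ?_
  simp_rw [card_filter_sigma_fst]
  rw [← mul_assoc]
  push_cast
  rw [← Finset.prod_mul_distrib, Finset.prod_eq_one, one_mul]
  intro m _
  exact inv_mul_cancel₀ (by exact_mod_cast (Nat.factorial_ne_zero _))

end Correlation

/-! ## Expansion over subsets of particles -/

/-- A fibrewise enumeration of the particles with a given property. -/
def subtypeSigmaEquiv {T : Type*} {N : ℕ} (P : T → Fin N → Prop) [∀ m, DecidablePred (P m)]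
    {c : T → ℕ} (hc : ∀ m, Fintype.card {i // P m i} = c m) :
    {p : Σ _ : T, Fin N // P p.1 p.2} ≃ Σ m, Fin (c m) where
  toFun p := ⟨p.1.1, Fintype.equivFinOfCardEq (hc p.1.1) ⟨p.1.2, p.2⟩⟩
  invFun q := ⟨⟨q.1, (Fintype.equivFinOfCardEq (hc q.1)).symm q.2⟩,
    ((Fintype.equivFinOfCardEq (hc q.1)).symm q.2).2⟩
  left_inv := by
    rintro ⟨⟨m, i⟩, h⟩
    simp
  right_inv := by
    rintro ⟨m, i⟩
    simp

namespace IsExtendedKernel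

variable {α T : Type} [MeasurableSpace α] [LinearOrder T] {μ : Measure α}
  [SigmaFinite μ] {N : ℕ} {K : T → α → T → α → ℂ}

lemma integrable_labelledDet (hK : IsExtendedKernel μ N K) {κ : Type} [Fintype κ]
    [DecidableEq κ] (σ : κ → T) :
    Integrable (fun y : κ → α => labelledDet K σ y) (Measure.pi fun _ => μ) := by
  refine (hK.integrable_labelledDet_elim (Empty.elim : Empty → T) σ Empty.elim).congr
    (Eventually.of_forall fun y => ?_)
  simp only
  rw [← labelledDet_comp_equiv K (Equiv.emptySum Empty κ).symm]
  rfl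

variable [Fintype T]

/-- Only the particles in `A m` carry a factor `χ`, so the others can be integrated out. After
relabelling, the result depends on `A` only through its cardinalities. -/
lemma integral_labelledDet_mul_prod (hK : IsExtendedKernel μ N K) {χ : T → α → ℂ}
    (hχ : ∀ m, Measurable (χ m)) (hb : ∃ B, ∀ m x, ‖χ m x‖ ≤ B) (A : T → Finset (Fin N)) :
    Integrable (fun X : (Σ _ : T, Fin N) → α => labelledDet K Sigma.fst X *
      ∏ m, ∏ i ∈ A m, χ m (X ⟨m, i⟩)) (Measure.pi fun _ => μ) ∧
    ∫ X : (Σ _ : T, Fin N) → α, labelledDet K Sigma.fst X * ∏ m, ∏ i ∈ A m, χ m (X ⟨m, i⟩)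
        ∂(Measure.pi fun _ => μ) =
      (∏ m, ((N - (A m).card)! : ℂ)) * ∫ X : (Σ m, Fin (A m).card) → α,
        (∏ p, χ p.1 (X p)) * labelledDet K Sigma.fst X ∂(Measure.pi fun _ => μ) := by
  obtain ⟨B, hB⟩ := hb
  have hintg : Integrable (fun X : (Σ _ : T, Fin N) → α => labelledDet K Sigma.fst X *
      ∏ m, ∏ i ∈ A m, χ m (X ⟨m, i⟩)) (Measure.pi fun _ => μ) := by
    refine (hK.integrable_labelledDet Sigma.fst).mul_bdd (c := ∏ m, ∏ i ∈ A m, B) ?_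
      (Eventually.of_forall fun X => ?_)
    · refine Measurable.aestronglyMeasurable ?_
      exact Finset.measurable_prod _ fun m _ => Finset.measurable_prod _ fun i _ =>
        (hχ m).comp (measurable_pi_apply _)
    · simp_rw [norm_prod]
      exact Finset.prod_le_prod (fun m _ => Finset.prod_nonneg fun i _ => norm_nonneg _)
        fun m _ => Finset.prod_le_prod (fun i _ => norm_nonneg _) fun i _ => hB _ _
  refine ⟨hintg, ?_⟩
  let P : T → Fin N → Prop := fun m i => i ∈ A m
  let eA := subtypeSigmaEquiv P (c := fun m => (A m).card) fun m => by
    simp [Fintype.card_subtype, P]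
  let eB := subtypeSigmaEquiv (fun m i => ¬P m i) (c := fun m => N - (A m).card) fun m => by
    rw [Fintype.card_subtype_compl, Fintype.card_fin,
      Fintype.card_of_subtype (p := P m) (A m) fun i => Iff.rfl]
  have hcA : ∀ r, (Finset.univ.filter fun p : {p : Σ _ : T, Fin N // P p.1 p.2} =>
      p.1.1 = r).card = (A r).card := by
    intro r
    rw [← card_filter_sigma_fst (fun m => (A m).card) r, Finset.card_filter, Finset.card_filter]
    exact eA.sum_comp fun q => if q.1 = r then 1 else 0
  have hcB : ∀ r, (Finset.univ.filter fun p : {p : Σ _ : T, Fin N // ¬P p.1 p.2} =>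
      p.1.1 = r).card = N - (A r).card := by
    intro r
    rw [← card_filter_sigma_fst (fun m => N - (A m).card) r, Finset.card_filter,
      Finset.card_filter]
    exact eB.sum_comp fun q => if q.1 = r then 1 else 0
  have hmp := (measurePreserving_piEquivPiSubtypeProd (fun _ : (Σ _ : T, Fin N) => μ)
    fun p => P p.1 p.2).symm
  have hsplit : ∀ z : ({p : Σ _ : T, Fin N // P p.1 p.2} → α) ×
      ({p : Σ _ : T, Fin N // ¬P p.1 p.2} → α),
      labelledDet K Sigma.fst ((MeasurableEquiv.piEquivPiSubtypeProd (fun _ => α)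
        fun p : Σ _ : T, Fin N => P p.1 p.2).symm z) * ∏ m, ∏ i ∈ A m,
        χ m ((MeasurableEquiv.piEquivPiSubtypeProd (fun _ => α)
          fun p : Σ _ : T, Fin N => P p.1 p.2).symm z ⟨m, i⟩) =
      (∏ p : {p : Σ _ : T, Fin N // P p.1 p.2}, χ p.1.1 (z.1 p)) *
        labelledDet K (Sum.elim (fun p => p.1.1) fun p => p.1.1) (Sum.elim z.1 z.2) := by
    intro z
    rw [mul_comm]
    congr 1
    · rw [← Finset.prod_sigma' (s := Finset.univ) (t := A) (f := fun m i =>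
        χ m ((MeasurableEquiv.piEquivPiSubtypeProd (fun _ => α)
          fun p : Σ _ : T, Fin N => P p.1 p.2).symm z ⟨m, i⟩)) |>.symm,
        Finset.prod_subtype (p := fun p : Σ _ : T, Fin N => P p.1 p.2) _ (by simp [P])]
      refine Finset.prod_congr rfl fun p _ => ?_
      congr 1
      simp [MeasurableEquiv.piEquivPiSubtypeProd, Equiv.piEquivPiSubtypeProd, p.2]
    · rw [← labelledDet_comp_equiv K (Equiv.sumCompl fun p : Σ _ : T, Fin N => P p.1 p.2)]
      congr 1
      · funext p
        rcases p with p | p <;> rfl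
      · funext p
        rcases p with p | p <;>
          simp [MeasurableEquiv.piEquivPiSubtypeProd, Equiv.piEquivPiSubtypeProd, p.2]
  have hintg2 := hintg
  rw [← hmp.integrable_comp_emb (MeasurableEquiv.measurableEmbedding _)] at hintg2
  have hintg3 := hintg2.congr (Eventually.of_forall hsplit)
  rw [← hmp.integral_comp' (g := fun X => labelledDet K Sigma.fst X *
    ∏ m, ∏ i ∈ A m, χ m (X ⟨m, i⟩))]
  refine (integral_congr_ae (Eventually.of_forall hsplit)).trans ((integral_prod _ hintg3).trans ?_)
  simp only
  simp_rw [integral_const_mul]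
  have hin : ∀ x : {p : Σ _ : T, Fin N // P p.1 p.2} → α,
      ∫ y : {p : Σ _ : T, Fin N // ¬P p.1 p.2} → α,
        labelledDet K (Sum.elim (fun p => p.1.1) fun p => p.1.1) (Sum.elim x y)
          ∂(Measure.pi fun _ => μ) = (∏ m, ((N - (A m).card)! : ℂ)) *
        labelledDet K (fun p => p.1.1) x := by
    intro x
    rw [hK.integral_labelledDet]
    · simp_rw [hcB]
    · intro r
      rw [hcA, hcB, Nat.add_sub_cancel' (card_finset_fin_le _)]
  simp_rw [hin, mul_left_comm _ (∏ m, ((N - (A m).card)! : ℂ))]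
  rw [integral_const_mul]
  congr 1
  have hmpA := measurePreserving_piCongrLeft (fun _ : (Σ m, Fin (A m).card) => μ) eA
  rw [← hmpA.integral_comp' (g := fun X => (∏ p, χ p.1 (X p)) * labelledDet K Sigma.fst X)]
  refine integral_congr_ae (Eventually.of_forall fun x => ?_)
  have hx : ∀ p, (MeasurableEquiv.piCongrLeft (fun _ => α) eA x) (eA p) = x p := fun p =>
    Equiv.piCongrLeft_apply_apply (fun _ => α) eA x p
  simp only
  rw [← eA.prod_comp, ← labelledDet_comp_equiv K eA]
  congr 1
  · exact Finset.prod_congr rfl fun p _ => by rw [hx]; rfl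
  · congr 1
    funext p
    exact (hx p).symm

/-- The expansion of a multiplicative statistic of all particles. -/
lemma integral_labelledDet_mul_prod_one_add (hK : IsExtendedKernel μ N K) {χ : T → α → ℂ}
    (hχ : ∀ m, Measurable (χ m)) (hb : ∃ B, ∀ m x, ‖χ m x‖ ≤ B) :
    ∫ X : (Σ _ : T, Fin N) → α, labelledDet K Sigma.fst X * ∏ m, ∏ i, (1 + χ m (X ⟨m, i⟩))
        ∂(Measure.pi fun _ => μ) =
      (N ! : ℂ) ^ Fintype.card T *
        ∑ n ∈ Fintype.piFinset (fun _ : T => Finset.range (N + 1)), (∏ m, ((n m)! : ℂ)⁻¹) *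
        ∫ X : (Σ m, Fin (n m)) → α, (∏ p, χ p.1 (X p)) * labelledDet K Sigma.fst X
          ∂(Measure.pi fun _ => μ) := by
  have hexp : ∀ X : (Σ _ : T, Fin N) → α,
      labelledDet K Sigma.fst X * ∏ m, ∏ i, (1 + χ m (X ⟨m, i⟩)) =
      ∑ A ∈ Fintype.piFinset (fun _ : T => (Finset.univ : Finset (Finset (Fin N)))),
        labelledDet K Sigma.fst X * ∏ m, ∏ i ∈ A m, χ m (X ⟨m, i⟩) := by
    intro X
    simp_rw [Finset.prod_one_add, Finset.powerset_univ]
    rw [Finset.prod_univ_sum, Finset.mul_sum]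
  simp_rw [hexp]
  rw [integral_finsetSum _ fun A _ => (hK.integral_labelledDet_mul_prod hχ hb A).1]
  let J : (T → ℕ) → ℂ := fun n => ∫ X : (Σ m, Fin (n m)) → α,
    (∏ p, χ p.1 (X p)) * labelledDet K Sigma.fst X ∂(Measure.pi fun _ => μ)
  refine (Finset.sum_congr rfl fun A _ => (hK.integral_labelledDet_mul_prod hχ hb A).2).trans ?_
  change ∑ A ∈ Fintype.piFinset (fun _ : T => (Finset.univ : Finset (Finset (Fin N)))),
    (∏ m, ((N - (A m).card)! : ℂ)) * J (fun m => (A m).card) = (N ! : ℂ) ^ Fintype.card T *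
      ∑ n ∈ Fintype.piFinset (fun _ : T => Finset.range (N + 1)), (∏ m, ((n m)! : ℂ)⁻¹) * J n
  -- The subsets are grouped by their cardinalities; the weight of a group is `∏ C(N, n m) (N - n
  -- m)! = ∏ N! / (n m)!`.
  rw [← Finset.sum_fiberwise_of_maps_to (t := Fintype.piFinset fun _ : T => Finset.range (N + 1))
    (g := fun (A : T → Finset (Fin N)) m => (A m).card) (fun A _ => Fintype.mem_piFinset.2 fun m =>
      Finset.mem_range.2 (Nat.lt_succ_of_le (card_finset_fin_le _))), Finset.mul_sum]
  refine Finset.sum_congr rfl fun n hn => ?_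
  have hfib : ((Fintype.piFinset fun _ : T => (Finset.univ : Finset (Finset (Fin N)))).filter
      fun A => (fun m => (A m).card) = n) =
      Fintype.piFinset fun m => Finset.powersetCard (n m) Finset.univ := by
    ext A
    simp [Fintype.mem_piFinset, Finset.mem_powersetCard, funext_iff]
  have hterm : ∀ A ∈ ((Fintype.piFinset fun _ : T =>
      (Finset.univ : Finset (Finset (Fin N)))).filter fun A => (fun m => (A m).card) = n),
      (∏ m, ((N - (A m).card)! : ℂ)) * J (fun m => (A m).card) =
        (∏ m, ((N - n m)! : ℂ)) * J n := by
    intro A hA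
    obtain rfl := (Finset.mem_filter.1 hA).2
    rfl
  rw [Finset.sum_congr rfl hterm, Finset.sum_const, hfib, Fintype.card_piFinset, nsmul_eq_mul,
    ← mul_assoc, ← mul_assoc]
  congr 1
  push_cast
  rw [← Finset.card_univ, ← Finset.prod_const, ← Finset.prod_mul_distrib,
    ← Finset.prod_mul_distrib]
  refine Finset.prod_congr rfl fun m _ => ?_
  have hm : n m ≤ N := Nat.lt_succ_iff.1 (Finset.mem_range.1 (Fintype.mem_piFinset.1 hn m))
  rw [Finset.card_powersetCard, Finset.card_univ, Fintype.card_fin,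
    eq_mul_inv_iff_mul_eq₀ (by exact_mod_cast Nat.factorial_ne_zero _),
    ← Nat.choose_mul_factorial_mul_factorial hm]
  push_cast
  ring

end IsExtendedKernel

/-! ## Symmetrization over the Weyl chambers -/

section Symmetrize

variable {T : Type} [Fintype T] {N : ℕ}

/-- The product over all particles of Lebesgue measure on the positive half line. -/
def posVolume (T : Type) [Fintype T] (N : ℕ) : Measure (T → Fin N → ℝ) :=
  Measure.pi fun _ => Measure.pi fun _ => volume.restrict (Ioi 0)

lemma posVolume_eq_restrict :
    posVolume T N = volume.restrict {X : T → Fin N → ℝ | ∀ m i, X m i ∈ Ioi 0} :=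
  (volume_restrict_pi_pi_eq _).symm

lemma ae_posVolume_pos : ∀ᵐ X ∂(posVolume T N), ∀ m i, 0 < X m i := by
  rw [posVolume_eq_restrict]
  have hms : MeasurableSet {X : T → Fin N → ℝ | ∀ m i, X m i ∈ Ioi 0} := by
    simp_rw [Set.ofPred_forall]
    exact MeasurableSet.iInter fun m => MeasurableSet.iInter fun i =>
      ((measurable_pi_apply i).comp (measurable_pi_apply m)) measurableSet_Ioi
  filter_upwards [ae_restrict_mem hms] with X hX using hX

lemma ae_posVolume_injective : ∀ᵐ X ∂(posVolume T N), ∀ m, Function.Injective (X m) := by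
  have h : ∀ᵐ X : T → Fin N → ℝ, ∀ m i j, i ≠ j → X m i ≠ X m j := by
    refine ae_all_iff.2 fun m => ae_all_iff.2 fun i => ae_all_iff.2 fun j => ?_
    by_cases hij : i = j
    · simp [hij]
    let L : (T → Fin N → ℝ) →ₗ[ℝ] ℝ :=
      ((LinearMap.proj i : (Fin N → ℝ) →ₗ[ℝ] ℝ) - (LinearMap.proj j : (Fin N → ℝ) →ₗ[ℝ] ℝ)) ∘ₗ
        (LinearMap.proj m : (T → Fin N → ℝ) →ₗ[ℝ] (Fin N → ℝ))
    have hL : LinearMap.ker L ≠ ⊤ := by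
      intro h
      have h1 : (fun _ => Pi.single i 1 : T → Fin N → ℝ) ∈ LinearMap.ker L := by
        rw [h]
        trivial
      rw [LinearMap.mem_ker] at h1
      simp [L, Ne.symm hij] at h1
    have h0 := Measure.addHaar_submodule volume (LinearMap.ker L) hL
    rw [ae_iff]
    refine measure_mono_null (fun X hX => ?_) h0
    simp only [ne_eq, not_forall, not_not] at hX
    obtain ⟨-, hX⟩ := hX
    change L X = 0
    simp [L, hX]
  rw [posVolume_eq_restrict]
  filter_upwards [ae_restrict_of_ae h] with X hX m i j hij
  by_contra hne
  exact hX m i j hne hij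

lemma measurePreserving_permute (σ : T → Equiv.Perm (Fin N)) :
    MeasurePreserving (fun (X : T → Fin N → ℝ) m => X m ∘ σ m) (posVolume T N)
      (posVolume T N) := by
  refine measurePreserving_pi _ _ (f := fun m (x : Fin N → ℝ) => x ∘ σ m) fun m => ?_
  have h := measurePreserving_piCongrLeft (fun _ : Fin N => (volume.restrict (Ioi (0 : ℝ))))
    (σ m).symm
  convert h using 1
  funext x i
  have := Equiv.piCongrLeft_apply_apply (fun _ => ℝ) (σ m).symm x (σ m i)
  rw [Equiv.symm_apply_apply] at this
  exact this.symm

lemma measurableSet_strictMono : MeasurableSet {X : T → Fin N → ℝ | ∀ m, StrictMono (X m)} := by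
  unfold StrictMono
  simp_rw [Set.ofPred_forall]
  refine MeasurableSet.iInter fun m => MeasurableSet.iInter fun i => MeasurableSet.iInter fun j =>
    MeasurableSet.iInter fun _ => measurableSet_lt ?_ ?_ <;> fun_prop

/-- A symmetric function integrates to the same value over all orderings of the particles. -/
lemma integral_eq_factorial_mul_setIntegral_strictMono {F : (T → Fin N → ℝ) → ℂ}
    (hF : Integrable F (posVolume T N)) (hFm : Measurable F)
    (hsymm : ∀ (σ : T → Equiv.Perm (Fin N)) X, F (fun m => X m ∘ σ m) = F X) :
    ∫ X, F X ∂(posVolume T N) = (N ! : ℂ) ^ Fintype.card T *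
      ∫ X in {X : T → Fin N → ℝ | ∀ m, StrictMono (X m)}, F X ∂(posVolume T N) := by
  classical
  set S := {X : T → Fin N → ℝ | ∀ m, StrictMono (X m)} with hS
  have hSm : MeasurableSet S := measurableSet_strictMono
  -- Away from coincidences, a null set, exactly one permutation at each time puts the coordinates
  -- in increasing order, namely the sorting permutation.
  have hsum : ∀ᵐ X ∂(posVolume T N), F X =
      ∑ σ : T → Equiv.Perm (Fin N), S.indicator F (fun m => X m ∘ σ m) := by
    filter_upwards [ae_posVolume_injective] with X hX
    rw [Finset.sum_eq_single fun m => Tuple.sort (X m)]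
    · rw [Set.indicator_of_mem, hsymm]
      intro m
      exact (Tuple.monotone_sort (X m)).strictMono_of_injective
        ((hX m).comp (Tuple.sort (X m)).injective)
    · intro σ _ hσ
      refine Set.indicator_of_notMem (fun hmem => hσ ?_) _
      funext m
      have := Tuple.unique_monotone (hmem m).monotone (Tuple.monotone_sort (X m))
      exact Equiv.ext fun i => hX m (congrFun this i)
    · simp
  rw [integral_congr_ae hsum]
  have hintg : ∀ σ : T → Equiv.Perm (Fin N),
      Integrable (fun X : T → Fin N → ℝ => S.indicator F (fun m => X m ∘ σ m)) (posVolume T N) :=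
    fun σ => (measurePreserving_permute σ).integrable_comp_of_integrable (hF.indicator hSm)
  rw [integral_finsetSum _ fun σ _ => hintg σ]
  have hval : ∀ σ : T → Equiv.Perm (Fin N),
      ∫ X : T → Fin N → ℝ, S.indicator F (fun m => X m ∘ σ m) ∂(posVolume T N) =
        ∫ X in S, F X ∂(posVolume T N) := by
    intro σ
    rw [← integral_indicator hSm]
    have hmp := measurePreserving_permute (T := T) σ
    conv_rhs => rw [← hmp.map_eq]
    rw [integral_map hmp.measurable.aemeasurable
      (hFm.indicator hSm).aestronglyMeasurable]
  simp_rw [hval]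
  rw [Finset.sum_const, Finset.card_univ, Fintype.card_fun, Fintype.card_perm, Fintype.card_fin,
    nsmul_eq_mul]
  push_cast
  rfl

/-- The open and closed half lines differ by a null set, so the chamber may be taken inside the
positive positions where the kernel is controlled. -/
lemma volume_restrict_weylChamber :
    volume.restrict {X : T → Fin N → ℝ | ∀ m, X m ∈ weylChamber N} =
      (posVolume T N).restrict {X : T → Fin N → ℝ | ∀ m, StrictMono (X m)} := by
  have h1 : posVolume T N = volume.restrict {X : T → Fin N → ℝ | ∀ m i, X m i ∈ Ici 0} := by
    rw [volume_restrict_pi_pi_eq, posVolume]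
    simp_rw [restrict_Ioi_eq_restrict_Ici]
  rw [h1, Measure.restrict_restrict measurableSet_strictMono]
  congr 1
  ext X
  simp only [weylChamber, mem_ofPred_eq, mem_inter_iff, mem_Ici]
  exact ⟨fun h => ⟨fun m => (h m).2, fun m => (h m).1⟩, fun h m => ⟨h.2 m, h.1 m⟩⟩

end Symmetrize

section Generating

variable {N M : ℕ} {ν : ℝ} {a : Fin N → ℝ} {t : Fin (M + 1) → ℝ}

lemma labelledDet_permute {T α : Type*} [Fintype T] [DecidableEq T] (K : T → α → T → α → ℂ)
    (σ : T → Equiv.Perm (Fin N)) (X : T → Fin N → α) :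
    labelledDet K Sigma.fst (Sigma.uncurry fun m => X m ∘ σ m) =
      labelledDet K Sigma.fst (Sigma.uncurry X) := by
  rw [← labelledDet_comp_equiv K (Equiv.sigmaCongrRight σ) Sigma.fst (Sigma.uncurry X)]
  rfl

lemma ofReal_multitimeDensity_eq_posKernel (hν : -1 < ν) (ha0 : ∀ i, 0 ≤ a i) (ha : Monotone a)
    (ht0 : ∀ m, 0 < t m) (ht : StrictMono t) {X : Fin (M + 1) → Fin N → ℝ}
    (hX : ∀ m i, 0 < X m i) :
    (multitimeDensity ν a t X : ℂ) =
      labelledDet (posKernel ν a t) Sigma.fst (Sigma.uncurry X) := by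
  rw [ofReal_multitimeDensity hν ha0 ha ht0 ht hX,
    ← labelledDet_comp_equiv _ (Equiv.sigmaEquivProd (Fin (M + 1)) (Fin N)),
    labelledDet_posKernel a t Sigma.fst (x := Sigma.uncurry X) fun p => hX p.1 p.2]
  rfl

/-- Multiplicative statistics of the ordered particles, as an integral over all positions. -/
lemma setIntegral_weylChamber_mul_prod (hν : -1 < ν) (ha0 : ∀ i, 0 ≤ a i) (ha : Monotone a)
    (ht0 : ∀ m, 0 < t m) (ht : StrictMono t) {χ : Fin (M + 1) → ℝ → ℂ}
    (hχ : ∀ m, Measurable (χ m)) (hb : ∃ B, ∀ m x, ‖χ m x‖ ≤ B) :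
    IntegrableOn (fun X => (multitimeDensity ν a t X : ℂ) * ∏ m, ∏ i, (1 + χ m (X m i)))
      {X | ∀ m, X m ∈ weylChamber N} ∧
    (N ! : ℂ) ^ Fintype.card (Fin (M + 1)) * ∫ X in {X | ∀ m, X m ∈ weylChamber N},
        (multitimeDensity ν a t X : ℂ) * ∏ m, ∏ i, (1 + χ m (X m i)) =
      ∫ X : (Σ _ : Fin (M + 1), Fin N) → ℝ, labelledDet (posKernel ν a t) Sigma.fst X *
        ∏ m, ∏ i, (1 + χ m (X ⟨m, i⟩)) ∂(Measure.pi fun _ => volume.restrict (Ioi 0)) := by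
  obtain ⟨B, hB⟩ := hb
  have hK := isExtendedKernel_posKernel hν a ht0 ht
  set F : (Fin (M + 1) → Fin N → ℝ) → ℂ := fun X =>
    labelledDet (posKernel ν a t) Sigma.fst (Sigma.uncurry X) * ∏ m, ∏ i, (1 + χ m (X m i)) with hF
  have hmp : MeasurePreserving (MeasurableEquiv.piCurry fun (_ : Fin (M + 1)) (_ : Fin N) => ℝ)
      (Measure.pi fun _ => volume.restrict (Ioi 0)) (posVolume (Fin (M + 1)) N) :=
    measurePreserving_sigmaCurry _
  have hprodm : Measurable fun X : Fin (M + 1) → Fin N → ℝ => ∏ m, ∏ i, (1 + χ m (X m i)) := by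
    refine Finset.measurable_prod _ fun m _ => Finset.measurable_prod _ fun i _ =>
      measurable_const.add ((hχ m).comp ?_)
    fun_prop
  have hunc : Measurable fun X : Fin (M + 1) → Fin N → ℝ =>
      (Sigma.uncurry X : (Σ _ : Fin (M + 1), Fin N) → ℝ) := measurable_sigmaUncurry
  have hFm : Measurable F := (hK.measurable_labelledDet Sigma.fst hunc).mul hprodm
  have hFi : Integrable F (posVolume (Fin (M + 1)) N) := by
    have h1 : Integrable (fun X : Fin (M + 1) → Fin N → ℝ =>
        labelledDet (posKernel ν a t) Sigma.fst (Sigma.uncurry X))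
        (posVolume (Fin (M + 1)) N) := by
      rw [← hmp.integrable_comp_emb (MeasurableEquiv.measurableEmbedding _)]
      exact hK.integrable_labelledDet Sigma.fst
    refine h1.mul_bdd (c := ∏ _m : Fin (M + 1), ∏ _i : Fin N, (1 + B))
      hprodm.aestronglyMeasurable (Eventually.of_forall fun X => ?_)
    simp_rw [norm_prod]
    refine Finset.prod_le_prod (fun m _ => Finset.prod_nonneg fun i _ => norm_nonneg _)
      fun m _ => Finset.prod_le_prod (fun i _ => norm_nonneg _) fun i _ => ?_
    refine (norm_add_le _ _).trans ?_
    rw [norm_one]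
    exact add_le_add_right (hB _ _) _
  have hae : ∀ᵐ X ∂(posVolume (Fin (M + 1)) N),
      (multitimeDensity ν a t X : ℂ) * ∏ m, ∏ i, (1 + χ m (X m i)) = F X := by
    filter_upwards [ae_posVolume_pos] with X hX
    rw [hF, ofReal_multitimeDensity_eq_posKernel hν ha0 ha ht0 ht hX]
  rw [IntegrableOn, volume_restrict_weylChamber]
  refine ⟨hFi.integrableOn.congr (ae_restrict_of_ae (hae.mono fun X hX => hX.symm)), ?_⟩
  rw [integral_congr_ae (ae_restrict_of_ae hae),
    ← integral_eq_factorial_mul_setIntegral_strictMono hFi hFm, ← hmp.integral_comp']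
  · rfl
  · intro σ X
    simp only [hF]
    rw [labelledDet_permute]
    congr 1
    refine Finset.prod_congr rfl fun m _ => ?_
    exact Equiv.prod_comp (σ m) fun i => 1 + χ m (X m i)

lemma fredholmDet_coreKernel (χ : Fin (M + 1) → ℝ → ℝ) :
    fredholmDet N (coreKernel ν a) t χ =
      ∑ n ∈ Fintype.piFinset (fun _ : Fin (M + 1) => Finset.range (N + 1)),
        (∏ m, ((n m)! : ℂ)⁻¹) * ∫ X : (Σ m, Fin (n m)) → ℝ, (∏ p, (χ p.1 (X p) : ℂ)) *
          labelledDet (posKernel ν a t) Sigma.fst X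
            ∂(Measure.pi fun _ => volume.restrict (Ioi 0)) := by
  unfold fredholmDet
  refine Finset.sum_congr rfl fun n _ => ?_
  congr 1
  rw [← volume_restrict_pi_eq]
  have hms : MeasurableSet {X : (Σ m, Fin (n m)) → ℝ | ∀ p, X p ∈ Ioi 0} := by
    simp_rw [Set.ofPred_forall]
    exact MeasurableSet.iInter fun p => measurable_pi_apply p measurableSet_Ioi
  refine setIntegral_congr_fun hms fun X hX => ?_
  rw [labelledDet_posKernel a t _ hX]
  rfl

lemma exists_bound_exp_sub_one (θ : Fin (M + 1) → ℝ) {f : Fin (M + 1) → ℝ → ℝ}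
    (hf : ∀ m, Continuous (f m)) (hfc : ∀ m, HasCompactSupport (f m)) :
    ∃ B, ∀ m x, ‖((Real.exp (θ m * f m x) - 1 : ℝ) : ℂ)‖ ≤ B := by
  have h : ∀ m, ∃ B, ∀ x, ‖((Real.exp (θ m * f m x) - 1 : ℝ) : ℂ)‖ ≤ B := by
    intro m
    obtain ⟨C, hC⟩ := (hf m).bounded_above_of_compact_support (hfc m)
    refine ⟨Real.exp (|θ m| * C) + 1, fun x => ?_⟩
    rw [Complex.norm_real]
    refine (norm_sub_le _ _).trans ?_
    rw [Real.norm_of_nonneg (Real.exp_pos _).le, norm_one]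
    refine add_le_add_left (Real.exp_le_exp.2 ?_) _
    refine (le_abs_self _).trans ?_
    rw [abs_mul]
    exact mul_le_mul_of_nonneg_left (hC x) (abs_nonneg _)
  choose B hB using h
  exact ⟨∑ m, |B m|, fun m x => (hB m x).trans ((le_abs_self _).trans
    (Finset.single_le_sum (f := fun m => |B m|) (fun m _ => abs_nonneg _) (Finset.mem_univ m)))⟩

/-- With `exp (θ f) = 1 + χ` the statistic is a product over particles. Symmetrization over the
chambers and the expansion over subsets both produce the same power of `N!`, which cancels. -/
lemma generatingFunction_eq_fredholmDet (hν : -1 < ν) (ha0 : ∀ i, 0 ≤ a i) (ha : Monotone a)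
    (ht0 : ∀ m, 0 < t m) (ht : StrictMono t) (θ : Fin (M + 1) → ℝ) {f : Fin (M + 1) → ℝ → ℝ}
    (hf : ∀ m, Continuous (f m)) (hfc : ∀ m, HasCompactSupport (f m)) :
    (generatingFunction ν a t θ f : ℂ) =
      fredholmDet N (coreKernel ν a) t fun m x => Real.exp (θ m * f m x) - 1 := by
  have hb := exists_bound_exp_sub_one θ hf hfc
  have hχ : ∀ m, Measurable fun x => ((Real.exp (θ m * f m x) - 1 : ℝ) : ℂ) := by
    intro m
    have := hf m
    exact Continuous.measurable (by fun_prop)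
  have h1 := (setIntegral_weylChamber_mul_prod hν ha0 ha ht0 ht hχ hb).2
  rw [(isExtendedKernel_posKernel hν a ht0 ht).integral_labelledDet_mul_prod_one_add hχ hb]
    at h1
  have h0 : (N ! : ℂ) ^ Fintype.card (Fin (M + 1)) ≠ 0 :=
    pow_ne_zero _ (by exact_mod_cast Nat.factorial_ne_zero _)
  rw [fredholmDet_coreKernel, ← mul_left_cancel₀ h0 h1, generatingFunction, ← integral_complex_ofReal]
  congr 1
  funext X
  push_cast
  congr 1
  rw [Complex.exp_sum]
  refine Finset.prod_congr rfl fun m _ => ?_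
  rw [Finset.mul_sum, Complex.exp_sum]
  exact Finset.prod_congr rfl fun i _ => by ring

/-- The multitime density is normalized. -/
lemma setIntegral_multitimeDensity (hν : -1 < ν) (ha0 : ∀ i, 0 ≤ a i) (ha : Monotone a)
    (ht0 : ∀ m, 0 < t m) (ht : StrictMono t) :
    IntegrableOn (multitimeDensity ν a t) {X | ∀ m, X m ∈ weylChamber N} ∧
      ∫ X in {X | ∀ m, X m ∈ weylChamber N}, multitimeDensity ν a t X = 1 := by
  have h := setIntegral_weylChamber_mul_prod hν ha0 ha ht0 ht (χ := fun _ _ => 0)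
    (fun _ => measurable_const) ⟨0, by simp⟩
  simp only [add_zero, Finset.prod_const_one, mul_one] at h
  refine ⟨h.1.re, ?_⟩
  have hK := isExtendedKernel_posKernel hν a ht0 ht
  -- Here nothing is observed: integrating out all `N` particles at each time leaves an empty
  -- determinant times the factorials.
  have h2 : ∫ X : (Σ _ : Fin (M + 1), Fin N) → ℝ, labelledDet (posKernel ν a t) Sigma.fst X
      ∂(Measure.pi fun _ => volume.restrict (Ioi 0)) =
      (N ! : ℂ) ^ Fintype.card (Fin (M + 1)) := by
    have h3 := hK.integral_labelledDet (Empty.elim : Empty → Fin (M + 1))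
      (Sigma.fst : (Σ _ : Fin (M + 1), Fin N) → Fin (M + 1)) Empty.elim
      (fun r => by rw [card_filter_sigma_fst]; simp)
    simp_rw [card_filter_sigma_fst] at h3
    rw [Finset.prod_const, Finset.card_univ, labelledDet, Matrix.det_isEmpty, mul_one] at h3
    rw [← h3]
    congr 1
    funext X
    rw [← labelledDet_comp_equiv _ (Equiv.emptySum Empty _).symm]
    rfl
  have h0 : (N ! : ℂ) ^ Fintype.card (Fin (M + 1)) ≠ 0 :=
    pow_ne_zero _ (by exact_mod_cast Nat.factorial_ne_zero _)
  have h4 := h.2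
  rw [h2, mul_eq_left₀ h0, integral_complex_ofReal] at h4
  exact_mod_cast h4

end Generating

/-! ## Expectations of multiplicative statistics -/

/-- The integral is `0` for measures that do not integrate `f`, so it is measurable by cases: the
set of integrating measures is measurable, and on it the positive and negative parts are. -/
lemma measurable_integral_measure {f : ℝ → ℝ} (hf : Measurable f) :
    Measurable fun ζ : Measure ℝ => ∫ x, f x ∂ζ := by
  classical
  have h : (fun ζ : Measure ℝ => ∫ x, f x ∂ζ) = fun ζ => if ∫⁻ x, ‖f x‖ₑ ∂ζ < ⊤ then
      (∫⁻ x, ENNReal.ofReal (f x) ∂ζ).toReal - (∫⁻ x, ENNReal.ofReal (-f x) ∂ζ).toReal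
      else 0 := by
    funext ζ
    split_ifs with hfin
    · exact integral_eq_lintegral_pos_part_sub_lintegral_neg_part ⟨hf.aestronglyMeasurable, hfin⟩
    · exact integral_undef fun hi => hfin hi.2
  rw [h]
  refine Measurable.ite (measurableSet_lt (Measure.measurable_lintegral hf.enorm)
    measurable_const) ?_ measurable_const
  exact (Measure.measurable_lintegral hf.ennreal_ofReal).ennreal_toReal.sub
    (Measure.measurable_lintegral hf.neg.ennreal_ofReal).ennreal_toReal

lemma measurable_config {N : ℕ} : Measurable (config : (Fin N → ℝ) → Measure ℝ) := by
  refine Measure.measurable_of_measurable_coe _ fun s hs => ?_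
  simp only [config, Measure.coe_finsetSum, Finset.sum_apply]
  refine Finset.measurable_sum _ fun i _ => ?_
  exact (Measure.measurable_coe hs).comp (Measure.measurable_dirac.comp (measurable_pi_apply i))

lemma integral_config {N : ℕ} (f : ℝ → ℝ) (x : Fin N → ℝ) :
    ∫ y, f y ∂(config x) = ∑ i, f (x i) := by
  rw [config, integral_finsetSum_measure fun i _ => integrable_dirac (by simp)]
  simp

section Expectation

variable {N : ℕ} {ν : ℝ} {a : Fin N → ℝ}

/-- The finite dimensional law sees only the positive part of the density, and nonnegativity is not
proved directly. It follows almost everywhere from comparing masses: the positive part has mass one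
because the law is a probability, and the signed density has integral one. -/
lemma integral_exp_eq_generatingFunction (hν : -1 < ν) (ha0 : ∀ i, 0 ≤ a i) (ha : Monotone a)
    {Ω : Type*} [MeasurableSpace Ω] {P : Measure Ω} [IsProbabilityMeasure P]
    {Ξ : ℝ → Ω → Measure ℝ} (hΞ : IsNoncollidingBESQ ν a P Ξ) {M : ℕ} {t : Fin (M + 1) → ℝ}
    (ht0 : ∀ m, 0 < t m) (ht : StrictMono t) (θ : Fin (M + 1) → ℝ) {f : Fin (M + 1) → ℝ → ℝ}
    (hf : ∀ m, Continuous (f m)) :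
    ∫ ω, Real.exp (∑ m, θ m * ∫ x, f m x ∂(Ξ (t m) ω)) ∂P = generatingFunction ν a t θ f := by
  obtain ⟨hintg, hone⟩ := setIntegral_multitimeDensity hν ha0 ha ht0 ht
  set W := {X : Fin (M + 1) → Fin N → ℝ | ∀ m, X m ∈ weylChamber N} with hW
  set ρ := multitimeDensity ν a t with hρ
  have hΞm : Measurable fun ω m => Ξ (t m) ω :=
    measurable_pi_iff.2 fun m => hΞ.measurable _ (ht0 m).le
  have hcm : Measurable fun (X : Fin (M + 1) → Fin N → ℝ) m => config (X m) :=
    measurable_pi_iff.2 fun m => measurable_config.comp (measurable_pi_apply m)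
  have hfdd := hΞ.fdd M t ht0 ht
  have hmass : ∫⁻ X in W, ENNReal.ofReal (ρ X) = 1 := by
    have h1 : P.map (fun ω m => Ξ (t m) ω) univ = 1 := by
      rw [Measure.map_apply hΞm MeasurableSet.univ, preimage_univ, measure_univ]
    rw [hfdd, Measure.map_apply hcm MeasurableSet.univ, preimage_univ,
      withDensity_apply _ MeasurableSet.univ, Measure.restrict_univ] at h1
    exact h1
  have hmax : ∫ X in W, (ENNReal.ofReal (ρ X)).toReal = 1 := by
    rw [integral_toReal hintg.1.aemeasurable.ennreal_ofReal
      (Eventually.of_forall fun _ => ENNReal.ofReal_lt_top), hmass, ENNReal.toReal_one]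
  have hmaxi : Integrable (fun X => (ENNReal.ofReal (ρ X)).toReal) (volume.restrict W) :=
    integrable_toReal_of_lintegral_ne_top hintg.1.aemeasurable.ennreal_ofReal (by simp [hmass])
  -- The density lies below its positive part and has the same integral, so the two agree almost
  -- everywhere on the chamber.
  have hnonneg : (fun X => (ENNReal.ofReal (ρ X)).toReal) =ᵐ[volume.restrict W] ρ := by
    refine ((integral_eq_iff_of_ae_le hintg hmaxi (Eventually.of_forall fun X => ?_)).1
      (hone.trans hmax.symm)).symm
    dsimp only
    rw [ENNReal.toReal_ofReal']
    exact le_max_left _ _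
  have hZm : Measurable fun ζ : Fin (M + 1) → Measure ℝ =>
      Real.exp (∑ m, θ m * ∫ x, f m x ∂(ζ m)) := by
    refine Real.measurable_exp.comp (Finset.measurable_sum _ fun m _ => Measurable.const_mul ?_ _)
    exact (measurable_integral_measure (hf m).measurable).comp (measurable_pi_apply m)
  have h1 := integral_map (μ := P) hΞm.aemeasurable (hZm.aestronglyMeasurable)
  rw [← h1, hfdd, integral_map hcm.aemeasurable hZm.aestronglyMeasurable,
    integral_withDensity_eq_integral_toReal_smul₀ hintg.1.aemeasurable.ennreal_ofReal
      (Eventually.of_forall fun _ => ENNReal.ofReal_lt_top), generatingFunction]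
  refine integral_congr_ae ?_
  filter_upwards [hnonneg] with X hX
  simp only [integral_config, smul_eq_mul]
  rw [hX]

/-- The process is determinantal with every kernel that is conjugate to `coreKernel`. -/
lemma isDeterminantalWith_of_conj.{v} (hν : -1 < ν) (ha0 : ∀ i, 0 ≤ a i) (ha : Monotone a)
    {K : ℝ → ℝ → ℝ → ℝ → ℂ} {g : ℝ → ℂ} (hg : ContinuousOn g (Ioi 0)) (hg0 : ∀ x > 0, g x ≠ 0)
    (hK : ∀ s x t y, 0 < s → 0 < x → 0 < t → 0 < y →
      K s x t y = g x * (coreKernel ν a s x t y * (g y)⁻¹)) :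
    IsDeterminantalWith.{v} ν a K := by
  have hdet : ∀ {M : ℕ} {t : Fin (M + 1) → ℝ}, (∀ m, 0 < t m) → ∀ {n : Fin (M + 1) → ℕ}
      {X : (Σ m, Fin (n m)) → ℝ}, (∀ p, 0 < X p) →
      kernelDet K t n X = kernelDet (coreKernel ν a) t n X := by
    intro M t ht0 n X hX
    -- The conjugating factors come out of the rows and columns, and their product over all
    -- particles is `1`.
    have h1 : kernelDet K t n X = (Matrix.of fun p q : (Σ m, Fin (n m)) => g (X p) *
        (Matrix.of fun p q : (Σ m, Fin (n m)) => (g (X q))⁻¹ *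
          (Matrix.of fun p q : (Σ m, Fin (n m)) =>
            coreKernel ν a (t p.1) (X p) (t q.1) (X q)) p q) p q).det := by
      unfold kernelDet
      congr 1
      ext p q
      simp only [Matrix.of_apply]
      rw [hK _ _ _ _ (ht0 _) (hX p) (ht0 _) (hX q)]
      ring
    rw [h1, Matrix.det_mul_column, Matrix.det_mul_row, ← mul_assoc, ← Finset.prod_mul_distrib,
      Finset.prod_eq_one fun p _ => mul_inv_cancel₀ (hg0 _ (hX p)), one_mul]
    rfl
  have hfred : ∀ {M : ℕ} {t : Fin (M + 1) → ℝ}, (∀ m, 0 < t m) → ∀ χ : Fin (M + 1) → ℝ → ℝ,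
      fredholmDet N K t χ = fredholmDet N (coreKernel ν a) t χ := by
    intro M t ht0 χ
    unfold fredholmDet
    refine Finset.sum_congr rfl fun n _ => ?_
    congr 1
    have hms : MeasurableSet {X : (Σ m, Fin (n m)) → ℝ | ∀ p, 0 < X p} := by
      simp_rw [Set.ofPred_forall]
      exact MeasurableSet.iInter fun p => measurableSet_lt measurable_const (measurable_pi_apply p)
    refine setIntegral_congr_fun hms fun X hX => ?_
    rw [hdet ht0 hX]
  refine ⟨fun s t hs ht => ?_, fun M t ht0 ht n hn X hX => ?_, fun M t ht0 ht θ f hf hfc => ?_,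
    fun Ω _ P _ Ξ hΞ M t ht0 ht θ f hf hfc => ?_⟩
  · have h1 : ContinuousOn (fun p : ℝ × ℝ => g p.1 * (coreKernel ν a s p.1 t p.2 * (g p.2)⁻¹))
        (Ioi 0 ×ˢ Ioi 0) := by
      refine (hg.comp continuousOn_fst fun p hp => hp.1).mul
        ((continuousOn_coreKernel a hν s t).mul ?_)
      exact (hg.comp continuousOn_snd fun p hp => hp.2).inv₀ fun p hp => hg0 _ hp.2
    exact h1.congr fun p hp => hK _ _ _ _ hs hp.1 ht hp.2
  · obtain ⟨h1, h2⟩ := correlation_eq_labelledDet hν ha0 ha ht0 ht hn hX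
    refine ⟨h1, h2.trans ?_⟩
    rw [hdet ht0 hX, labelledDet_posKernel a t _ hX]
    rfl
  · rw [hfred ht0, generatingFunction_eq_fredholmDet hν ha0 ha ht0 ht θ hf hfc]
  · rw [hfred ht0, integral_exp_eq_generatingFunction hν ha0 ha hΞ ht0 ht θ hf,
      generatingFunction_eq_fredholmDet hν ha0 ha ht0 ht θ hf hfc]

end Expectation

/-! ## The integrals over the negative half line -/

section HalfLine

variable {ν : ℝ}

/-- By homogeneity: the coefficient of `zᵏ` in the evolution of `zᵐ` is proportional to `t ^ (m -
k)`, so reflecting the variable before and after amounts to reversing time. -/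
lemma eval_besqPoly_neg_comp (t : ℝ) (p : Polynomial ℂ) (z : ℂ) :
    (besqPoly ν t (p.comp (-Polynomial.X))).eval (-z) = (besqPoly ν (-t) p).eval z := by
  induction p using Polynomial.induction_on' with
  | add p q hp hq => simp only [Polynomial.add_comp, map_add, Polynomial.eval_add, hp, hq]
  | monomial m c =>
    have h : (Polynomial.monomial m c).comp (-Polynomial.X) =
        Polynomial.monomial m ((-1) ^ m * c) := by
      rw [Polynomial.monomial_comp, neg_pow, ← Polynomial.C_mul_X_pow_eq_monomial]
      simp only [map_mul, map_pow, map_neg, map_one]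
      ring
    rw [h, besqPoly_monomial, besqPoly_monomial]
    simp only [besqMonomial, Polynomial.eval_smul, Polynomial.eval_finsetSum,
      Polynomial.eval_monomial, smul_eq_mul]
    rw [Finset.mul_sum, Finset.mul_sum]
    refine Finset.sum_congr rfl fun k hk => ?_
    have hk : k ≤ m := Nat.lt_succ_iff.1 (Finset.mem_range.1 hk)
    obtain ⟨j, rfl⟩ := Nat.exists_eq_add_of_le hk
    rw [Nat.add_sub_cancel_left]
    push_cast
    rw [neg_pow z, show (2 * -(t : ℂ)) = -(2 * t) by ring, neg_pow (2 * (t : ℂ)), pow_add]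
    have : ((-1 : ℂ) ^ k) * (-1) ^ k = 1 := by rw [← mul_pow]; simp
    linear_combination ((-1 : ℂ) ^ j * c * ((k + j).choose k *
      (Real.Gamma (ν + (k + j) + 1) / Real.Gamma (ν + k + 1)) * (2 * t) ^ j) * z ^ k) * this

/-- The substitution `y' = -u` reduces this to the moment formula for the reflected polynomial at
the point `-y`. It is the reason why the density at negative time inverts the semigroup. -/
lemma integral_Iio_poly_mul_besqEntire (hν : -1 < ν) {t : ℝ} (ht : 0 < t) (p : Polynomial ℂ)
    (y : ℝ) :
    IntegrableOn (fun y' : ℝ => p.eval (y' : ℂ) * besqEntire ν t (-y') (-y)) (Iio 0) ∧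
    ∫ y' in Iio (0 : ℝ), p.eval (y' : ℂ) * besqEntire ν t (-y') (-y) =
      (besqPoly ν (-t) p).eval (y : ℂ) := by
  have h1 := integrableOn_poly_mul_besqEntire hν ht (p.comp (-Polynomial.X)) (-(y : ℂ))
  have h2 := integral_poly_mul_besqEntire hν ht (p.comp (-Polynomial.X)) (-(y : ℂ))
  have hmp : MeasurePreserving (Neg.neg : ℝ → ℝ) := Measure.measurePreserving_neg volume
  have hpre : (Neg.neg : ℝ → ℝ) ⁻¹' (Iio 0) = Ioi 0 := by
    ext x
    simp
  have hcongr : (fun u : ℝ => (p.comp (-Polynomial.X)).eval (u : ℂ) * besqEntire ν t u (-y)) =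
      (fun y' : ℝ => p.eval (y' : ℂ) * besqEntire ν t (-y') (-y)) ∘ Neg.neg := by
    funext u
    simp [Polynomial.eval_comp]
  constructor
  · rw [← hmp.integrableOn_comp_preimage (Homeomorph.neg ℝ).measurableEmbedding, hpre, ← hcongr]
    exact h1
  · rw [← hmp.setIntegral_preimage_emb (Homeomorph.neg ℝ).measurableEmbedding, hpre,
      ← eval_besqPoly_neg_comp, ← h2, hcongr]
    rfl

end HalfLine

/-! ## Identification of the kernels -/

section Kernels

variable {N : ℕ} {ν : ℝ} {a : Fin N → ℝ}

/-- The interpolation polynomial of the transition density at the initial points. -/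
def besqInterp (ν : ℝ) (a : Fin N → ℝ) (s x : ℝ) : Polynomial ℂ :=
  ∑ k ∈ Finset.range N, besqDivDiff ν a k s x • newtonPoly (nodes a) k

lemma eval_besqInterp (s x : ℝ) (z : ℂ) : (besqInterp ν a s x).eval z =
    ∑ k ∈ Finset.range N, besqDivDiff ν a k s x * ∏ j ∈ Finset.range k, (z - nodes a j) := by
  simp [besqInterp, Polynomial.eval_finsetSum, eval_newtonPoly]

lemma coreKernel_eq_besqInterp (s x t y : ℝ) : coreKernel ν a s x t y =
    (besqPoly ν (-t) (besqInterp ν a s x)).eval (y : ℂ) -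
      if t < s then besqEntire ν (s - t) x y else 0 := by
  simp only [coreKernel, besqInterp, map_sum, map_smul, Polynomial.eval_finsetSum,
    Polynomial.eval_smul, smul_eq_mul, besqNewton]

/-- Hermite's contour formula for the interpolation polynomial at `y'`. In particular the integral
does not depend on the contour and is a polynomial in `y'` times the backward density. -/
lemma contourIntegrand_eq (hν : -1 < ν) {Γ : ℝ → ℝ → ℂ} {s x t y y' : ℝ} (hs : 0 < s)
    (hx : 0 < x) (ht : 0 < t) (hy : 0 < y) (hy' : y' < 0) (hΓ : Encircles (Γ y') a y') :
    contourIntegrand ν a Γ s x t y y' =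
      (besqInterp ν a s x).eval (y' : ℂ) * besqEntire ν t (-y') (-y) := by
  have hneg := besqC_neg_eq_besqEntire (ν := ν) ht (neg_pos.2 hy') hy
  rw [neg_neg] at hneg
  have hnode : ∀ j (hj : j < N), nodes a j = a ⟨j, hj⟩ := fun j hj => by simp [nodes, hj]
  have h := contourIntegral_eq_newton hΓ.curve (differentiable_besqEntire hν s x) (b := nodes a) N
    (w := y') (fun u hu j hj => by rw [hnode j hj]; exact hΓ.avoids_points u hu _)
    (fun j hj => by rw [hnode j hj]; exact hΓ.winding_points _) hΓ.avoids_outer hΓ.winding_outer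
  have hpi : (2 * Real.pi * Complex.I : ℂ) ≠ 0 := by simp [Real.pi_ne_zero]
  have hcongr : contourIntegral (Γ y') (fun z => besqC ν s x z * (1 / (y' - z)) *
      Phi0 (fun i => (a i : ℂ)) z y' * besqC ν (-t) y' y) =
      contourIntegral (Γ y') (fun z => ((∏ j ∈ Finset.range N, ((y' : ℂ) - nodes a j)) *
        besqEntire ν t (-y') (-y)) * (besqEntire ν s x z * (y' - z)⁻¹ *
          ∏ j ∈ Finset.range N, (z - nodes a j)⁻¹)) := by
    refine contourIntegral_congr fun u hu => ?_
    set z := Γ y' u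
    have hz : ∀ i, (a i : ℂ) - z ≠ 0 := fun i => sub_ne_zero.2 (hΓ.avoids_points u hu i).symm
    -- On the contour `z` avoids all nodes, so no factor is omitted from `Phi0`, and it is the
    -- quotient of the nodal polynomial at `y'` by that at `z`.
    have hPhi : Phi0 (fun i => (a i : ℂ)) z y' =
        (∏ j ∈ Finset.range N, ((y' : ℂ) - nodes a j)) *
          ∏ j ∈ Finset.range N, (z - nodes a j)⁻¹ := by
      unfold Phi0 Pi0
      rw [Finset.filter_true_of_mem fun i _ => hz i, Finset.prod_range, Finset.prod_range,
        ← Finset.prod_mul_distrib]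
      refine Finset.prod_congr rfl fun i _ => ?_
      have h1 := hz i
      have h2 : z - a i ≠ 0 := sub_ne_zero.2 (hΓ.avoids_points u hu i)
      rw [nodes_fin]
      field_simp
      ring
    rw [hneg, hPhi, besqC_eq_besqEntire hs hx, one_div]
    ring
  rw [contourIntegrand, hcongr, contourIntegral_const_mul, eval_besqInterp]
  simp only [besqDivDiff]
  rw [one_div, mul_right_comm _ (besqEntire ν t (-y') (-y)), mul_comm (∏ j ∈ _, _), h,
    ← mul_assoc, inv_mul_cancel_left₀ hpi]

lemma contourIntegrand_integrable (hν : -1 < ν) {Γ : ℝ → ℝ → ℂ}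
    (hΓ : ∀ y' < 0, Encircles (Γ y') a y') {s x t y : ℝ} (hs : 0 < s) (hx : 0 < x) (ht : 0 < t)
    (hy : 0 < y) : IntegrableOn (contourIntegrand ν a Γ s x t y) (Iio 0) :=
  (integral_Iio_poly_mul_besqEntire hν ht (besqInterp ν a s x) y).1.congr_fun
    (fun _ hy' => (contourIntegrand_eq hν hs hx ht hy hy' (hΓ _ hy')).symm) measurableSet_Iio

/-- The integrand is integrable on the whole negative half line, so the limit in `ε` is a plain
exhaustion with no cancellation at `0`. -/
lemma tendsto_integral_contourIntegrand (hν : -1 < ν) {Γ : ℝ → ℝ → ℂ}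
    (hΓ : ∀ y' < 0, Encircles (Γ y') a y') {s x t y : ℝ} (hs : 0 < s) (hx : 0 < x) (ht : 0 < t)
    (hy : 0 < y) :
    Tendsto (fun ε => ∫ y' in Iic (-ε), contourIntegrand ν a Γ s x t y y') (𝓝[>] 0)
      (𝓝 ((besqPoly ν (-t) (besqInterp ν a s x)).eval (y : ℂ))) := by
  have hintg := contourIntegrand_integrable hν hΓ hs hx ht hy
  have htend : Tendsto (fun ε : ℝ => -ε) (𝓝[>] 0) (𝓝 0) := by
    have h : Tendsto (fun ε : ℝ => -ε) (𝓝 0) (𝓝 (-0)) := tendsto_neg 0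
    rw [neg_zero] at h
    exact h.mono_left nhdsWithin_le_nhds
  have h1 := (aecover_Iio_of_Iic (μ := volume) htend).integral_tendsto_of_countably_generated hintg
  rw [setIntegral_congr_fun measurableSet_Iio fun y' hy' =>
    contourIntegrand_eq hν hs hx ht hy hy' (hΓ _ hy'),
    (integral_Iio_poly_mul_besqEntire hν ht (besqInterp ν a s x) y).2] at h1
  refine h1.congr' ?_
  filter_upwards [self_mem_nhdsWithin] with ε hε
  have hε : 0 < ε := hε
  rw [Measure.restrict_restrict_of_subset]
  exact fun u hu => lt_of_le_of_lt hu (by linarith : -ε < 0)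

lemma contourKernel_eq_coreKernel (hν : -1 < ν) {Γ : ℝ → ℝ → ℂ}
    (hΓ : ∀ y' < 0, Encircles (Γ y') a y') {s x t y : ℝ} (hs : 0 < s) (hx : 0 < x) (ht : 0 < t)
    (hy : 0 < y) : contourKernel ν a Γ s x t y = coreKernel ν a s x t y := by
  rw [contourKernel, (tendsto_integral_contourIntegrand hν hΓ hs hx ht hy).limUnder_eq,
    coreKernel_eq_besqInterp]
  congr 1
  split_ifs with h
  · exact besqC_eq_besqEntire (sub_pos.2 h) hx _
  · rfl

lemma eval_lagrange_basis (ha : StrictMono a) (i : Fin N) (z : ℂ) :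
    (Lagrange.basis Finset.univ (fun j => (a j : ℂ)) i).eval z =
      Phi0 (fun j => (a j : ℂ)) (a i) z := by
  have hf : (Finset.univ.filter fun j : Fin N => (a j : ℂ) - a i ≠ 0) = Finset.univ.erase i := by
    ext j
    simp only [Finset.mem_filter, Finset.mem_univ, true_and, Finset.mem_erase, and_true, ne_eq,
      sub_eq_zero, Complex.ofReal_inj, ha.injective.eq_iff]
  unfold Phi0 Pi0
  rw [hf, Lagrange.basis, Polynomial.eval_prod]
  refine Finset.prod_congr rfl fun j hj => ?_
  have h1 : (a j : ℂ) - a i ≠ 0 := by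
    rw [sub_ne_zero, ne_eq, Complex.ofReal_inj, ha.injective.eq_iff]
    exact Finset.ne_of_mem_erase hj
  have h2 : (a i : ℂ) - a j ≠ 0 := by
    rw [← neg_sub]
    exact neg_ne_zero.2 h1
  simp only [Lagrange.basisDivisor, Polynomial.eval_mul, Polynomial.eval_C, Polynomial.eval_sub,
    Polynomial.eval_X]
  field_simp
  ring

/-- The Newton and Lagrange forms are polynomials of degree less than `N` with the same values at
`N` distinct points. -/
lemma besqInterp_eq_lagrange (ha : StrictMono a) (s x : ℝ) : besqInterp ν a s x =
    ∑ i, besqEntire ν s x (a i) • Lagrange.basis Finset.univ (fun j => (a j : ℂ)) i := by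
  have hinj : Set.InjOn (fun j => (a j : ℂ)) (Finset.univ : Finset (Fin N)) :=
    fun i _ j _ h => ha.injective (Complex.ofReal_injective h)
  rw [Lagrange.eq_interpolate_of_eval_eq (r := fun i => besqEntire ν s x (a i)) hinj
    (f := besqInterp ν a s x), Lagrange.interpolate_apply]
  · simp_rw [Polynomial.smul_eq_C_mul]
  · rw [Finset.card_univ, Fintype.card_fin]
    refine (Polynomial.degree_sum_le _ _).trans_lt ?_
    refine (Finset.sup_lt_iff (WithBot.bot_lt_coe N)).2 fun k hk => ?_
    refine (Polynomial.degree_smul_le _ _).trans_lt ?_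
    rw [Polynomial.degree_eq_natDegree (monic_newtonPoly _ _).ne_zero, natDegree_newtonPoly]
    exact WithBot.coe_lt_coe.2 (Finset.mem_range.1 hk)
  · intro j _
    rw [besqEntire_eq_sum_divDiff, eval_besqInterp, Finset.sum_range]
    simp_rw [eval_newtonPoly]

lemma simpleIntegrand_eq (ha : StrictMono a) {s x t y y' : ℝ} (hs : 0 < s)
    (hx : 0 < x) (ht : 0 < t) (hy : 0 < y) (hy' : y' < 0) (i : Fin N) :
    simpleIntegrand ν a s x t y i y' = besqEntire ν s x (a i) *
      ((Lagrange.basis Finset.univ (fun j => (a j : ℂ)) i).eval (y' : ℂ) *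
        besqEntire ν t (-y') (-y)) := by
  have hneg := besqC_neg_eq_besqEntire (ν := ν) ht (neg_pos.2 hy') hy
  rw [neg_neg] at hneg
  rw [simpleIntegrand, eval_lagrange_basis ha, hneg, besqC_eq_besqEntire hs hx, mul_assoc]

lemma integrableOn_simpleIntegrand (hν : -1 < ν) (ha : StrictMono a) {s x t y : ℝ} (hs : 0 < s)
    (hx : 0 < x) (ht : 0 < t) (hy : 0 < y) (i : Fin N) :
    IntegrableOn (simpleIntegrand ν a s x t y i) (Iio 0) :=
  IntegrableOn.congr_fun ((integral_Iio_poly_mul_besqEntire hν ht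
    (Lagrange.basis Finset.univ (fun j => (a j : ℂ)) i) y).1.const_mul (besqEntire ν s x (a i)))
    (fun _ hy' => (simpleIntegrand_eq ha hs hx ht hy hy' i).symm) measurableSet_Iio

lemma simpleKernel_eq_coreKernel (hν : -1 < ν) (ha : StrictMono a) {s x t y : ℝ} (hs : 0 < s)
    (hx : 0 < x) (ht : 0 < t) (hy : 0 < y) :
    simpleKernel ν a s x t y = coreKernel ν a s x t y := by
  have hI : ∀ i, ∫ y' in Iio (0 : ℝ), simpleIntegrand ν a s x t y i y' = besqEntire ν s x (a i) *
      (besqPoly ν (-t) (Lagrange.basis Finset.univ (fun j => (a j : ℂ)) i)).eval (y : ℂ) := by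
    intro i
    rw [setIntegral_congr_fun measurableSet_Iio fun y' hy' =>
      simpleIntegrand_eq ha hs hx ht hy hy' i, integral_const_mul,
      (integral_Iio_poly_mul_besqEntire hν ht _ y).2]
  rw [simpleKernel, coreKernel_eq_besqInterp, besqInterp_eq_lagrange ha]
  simp only [hI, map_sum, map_smul, Polynomial.eval_finsetSum, Polynomial.eval_smul, smul_eq_mul]
  congr 1
  split_ifs with h
  · exact besqC_eq_besqEntire (sub_pos.2 h) hx _
  · rfl

/-- The powers of `a i` and of `y'` in the two densities cancel those in `PhiNu`. Powers of
quotients are quotients of principal powers, so the branch at `y' < 0` drops out; for `a i = 0` the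
conventions already omit the powers of `a i`. -/
lemma besselIntegrand_eq {s x t y y' : ℝ} (hx : 0 < x) (hy : 0 < y) (hy' : y' < 0) (i : Fin N) :
    besselIntegrand ν a s x t y i y' =
      ((x : ℂ) ^ ((ν : ℂ) / 2))⁻¹ * (y : ℂ) ^ ((ν : ℂ) / 2) *
        simpleIntegrand ν a s x t y i y' := by
  have hpow : ∀ z : ℂ, z ≠ 0 → z ^ ((ν : ℂ) / 2) ≠ 0 := fun z hz => by
    rw [Complex.cpow_def_of_ne_zero hz]
    exact Complex.exp_ne_zero _
  have hy0 : (y : ℂ) ≠ 0 := by exact_mod_cast hy.ne'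
  have h1 := hpow x (by exact_mod_cast hx.ne')
  have h2 := hpow y' (by exact_mod_cast hy'.ne)
  simp only [besselIntegrand, simpleIntegrand, besqJ, PhiNu, if_neg hy0, quotPow]
  by_cases ha : (a i : ℂ) = 0
  · simp only [if_pos ha]
    rw [ha, PiNu, neg_div, Complex.cpow_neg]
    simp only [Phi0, sub_zero]
    field_simp
  · have h3 := hpow _ ha
    simp only [if_neg ha]
    field_simp

lemma besselKernel_eq_simpleKernel {s x t y : ℝ} (hx : 0 < x) (hy : 0 < y) :
    besselKernel ν a s x t y =
      ((x : ℂ) ^ ((ν : ℂ) / 2))⁻¹ * (y : ℂ) ^ ((ν : ℂ) / 2) * simpleKernel ν a s x t y := by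
  have hI : ∀ i, ∫ y' in Iio (0 : ℝ), besselIntegrand ν a s x t y i y' =
      ((x : ℂ) ^ ((ν : ℂ) / 2))⁻¹ * (y : ℂ) ^ ((ν : ℂ) / 2) *
        ∫ y' in Iio (0 : ℝ), simpleIntegrand ν a s x t y i y' := by
    intro i
    rw [setIntegral_congr_fun measurableSet_Iio fun y' hy' => besselIntegrand_eq hx hy hy' i,
      integral_const_mul]
  simp only [besselKernel, simpleKernel, hI]
  rw [← Finset.mul_sum, mul_sub]
  congr 1
  split_ifs with h
  · rw [besqJ, if_neg (by exact_mod_cast hy.ne'), quotPow, div_eq_mul_inv,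
      mul_comm (_ ^ _) (_)⁻¹]
  · rw [mul_zero]

end Kernels

end NoncollidingBESQ

end

/-! ### Assembly of the theorem -/

theorem theorem1 (ν : ℝ) (hν : -1 < ν) (N : ℕ) (hN : 0 < N) (a : Fin N → ℝ)
    (ha0 : ∀ i, 0 ≤ a i) (ha : Monotone a) :
    -- the factor `f_N / h_N` at the initial configuration is a genuine limit
    (∀ t, 0 < t → ∀ y : Fin N → ℝ, (∀ i, 0 < y i) →
      Tendsto (fun x => karlinMcGregor ν t y x / vand x) (𝓝[weylChamber N] a)
        (𝓝 (kmRatio ν t y a))) ∧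
    -- the contour kernel, for every choice of the contours
    (∃ Γ : ℝ → ℝ → ℂ, ∀ y' < 0, Encircles (Γ y') a y') ∧
    (∀ Γ : ℝ → ℝ → ℂ, (∀ y' < 0, Encircles (Γ y') a y') →
      (∀ s x t y, 0 < s → 0 < x → 0 < t → 0 < y →
        (∀ ε, 0 < ε → IntegrableOn (contourIntegrand ν a Γ s x t y) (Iic (-ε))) ∧
        ∃ L, Tendsto (fun ε => ∫ y' in Iic (-ε), contourIntegrand ν a Γ s x t y y')
          (𝓝[>] 0) (𝓝 L)) ∧
      IsDeterminantalWith.{u} ν a (contourKernel ν a Γ)) ∧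
    -- configurations without multiple points
    (StrictMono a →
      (∀ s x t y, 0 < s → 0 < x → 0 < t → 0 < y →
        (∀ i, IntegrableOn (simpleIntegrand ν a s x t y i) (Iio 0)) ∧
        (∀ i, IntegrableOn (besselIntegrand ν a s x t y i) (Iio 0)) ∧
        (∀ Γ : ℝ → ℝ → ℂ, (∀ y' < 0, Encircles (Γ y') a y') →
          contourKernel ν a Γ s x t y = simpleKernel ν a s x t y) ∧
        simpleKernel ν a s x t y = ((x / y) ^ (ν / 2) : ℝ) * besselKernel ν a s x t y) ∧
      IsDeterminantalWith.{u} ν a (simpleKernel ν a) ∧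
      IsDeterminantalWith.{u} ν a (besselKernel ν a)) := by
  have hpow : ∀ x > 0, ((x : ℝ) : ℂ) ^ ((ν : ℂ) / 2) = ((x ^ (ν / 2) : ℝ) : ℂ) := by
    intro x hx
    rw [Complex.ofReal_cpow hx.le]
    push_cast
    rfl
  refine ⟨fun t ht y hy => tendsto_kmRatio hν ht hy ha0 ha, exists_encircles a ha0,
    fun Γ hΓ => ⟨fun s x t y hs hx ht hy => ⟨fun ε hε => ?_, _,
      tendsto_integral_contourIntegrand hν hΓ hs hx ht hy⟩, ?_⟩,
    fun hs => ⟨fun s x t y hs0 hx ht hy => ⟨integrableOn_simpleIntegrand hν hs hs0 hx ht hy,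
      fun i => ?_, fun Γ hΓ => ?_, ?_⟩, ?_, ?_⟩⟩
  · exact (contourIntegrand_integrable hν hΓ hs hx ht hy).mono_set
      fun u hu => lt_of_le_of_lt hu (by linarith : -ε < 0)
  · refine isDeterminantalWith_of_conj hν ha0 ha (g := fun _ => 1) continuousOn_const (by simp)
      fun s x t y hs hx ht hy => ?_
    rw [contourKernel_eq_coreKernel hν hΓ hs hx ht hy, inv_one, mul_one, one_mul]
  · exact IntegrableOn.congr_fun
      ((integrableOn_simpleIntegrand hν hs hs0 hx ht hy i).const_mul _)
      (fun y' hy' => (besselIntegrand_eq hx hy hy' i).symm) measurableSet_Iio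
  · rw [contourKernel_eq_coreKernel hν hΓ hs0 hx ht hy,
      simpleKernel_eq_coreKernel hν hs hs0 hx ht hy]
  · have hx' : ((x ^ (ν / 2) : ℝ) : ℂ) ≠ 0 := by
      exact_mod_cast (Real.rpow_pos_of_pos hx _).ne'
    have hy' : ((y ^ (ν / 2) : ℝ) : ℂ) ≠ 0 := by
      exact_mod_cast (Real.rpow_pos_of_pos hy _).ne'
    rw [besselKernel_eq_simpleKernel hx hy, hpow x hx, hpow y hy, Real.div_rpow hx.le hy.le,
      Complex.ofReal_div]
    field_simp
  · refine isDeterminantalWith_of_conj hν ha0 ha (g := fun _ => 1) continuousOn_const (by simp)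
      fun s x t y hs0 hx ht hy => ?_
    rw [simpleKernel_eq_coreKernel hν hs hs0 hx ht hy, inv_one, mul_one, one_mul]
  -- Here the conjugating function is `x ^ (-ν / 2)`, regular and nonzero on the open half line.
  · refine isDeterminantalWith_of_conj hν ha0 ha
      (g := fun x => (((x ^ (ν / 2) : ℝ) : ℂ))⁻¹) ?_ ?_ fun s x t y hs0 hx ht hy => ?_
    · refine ContinuousOn.inv₀ (Complex.continuous_ofReal.comp_continuousOn
        (continuousOn_id.rpow_const fun x hx => Or.inl (ne_of_gt hx))) fun x hx => ?_
      exact_mod_cast (Real.rpow_pos_of_pos hx _).ne'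
    · intro x hx
      exact inv_ne_zero (by exact_mod_cast (Real.rpow_pos_of_pos hx _).ne')
    · rw [besselKernel_eq_simpleKernel hx hy, hpow x hx, hpow y hy,
        simpleKernel_eq_coreKernel hν hs hs0 hx ht hy, inv_inv]
      ring
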